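/- All groups are finite. Consider the following classes of groups. - $\mathrm{Ab}$, $\mathrm{Nil}$, $\mathrm{Sup}$: the abelian, nilpotent and supersolvable groups; $\mathcal{A}$: the solvable groups all of whose Sylow subgroups are abelian. For classes $\mathcal{X},\mathcal{Y}$, $\mathcal{X}$-by-$\mathcal{Y}$ is the class of groups $G$ having a normal subgroup $N$ with $N\in\mathcal{X}$ and $G/N\in\mathcal{Y}$. - $\mathcal{C}$: the groups $G$ such that every subgroup of $G$ and every quotient group (of $G$ or of a subgroup of $G$) is either abelian or contains a noncentral abelian normal subgroup. - $\mathrm{nM}$ (respectively $\mathrm{sM}$): the groups all of whose complex irreducible characters are induced from linear characters of normal (respectively subnormal) subgroups. - $X$: the solvable groups $G$ such that, for every prime $p$ dividing $|G|$ and every subgroup $A$ of $G$, the group $O^p(A)$ (the smallest normal subgroup of $A$ with quotient a $p$-group) has no central $p$-factor, i.e. there are no normal subgroups $L\lneq K$ of $B=O^p(A)$ such that $K/L$ is a $p$-group contained in the center of $B/L$. - $\mathrm{stM}$ (strongly monomial groups): the groups $G$ such that every primitive central idempotent of $\mathbb{Q}G$ equals $\alpha\, e(G,H,K)$ for some strong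 Shoda pair $(H,K)$ of $G$ and some $\alpha\in\mathbb{Q}$. Here, for $K\unlhd H\leq G$, put $\widehat{H}=\frac{1}{|H|}\sum_{h\in H}h$; $\varepsilon(H,K)=\widehat{K}$ if $H=K$, and otherwise $\varepsilon(H,K)=\prod_L(\widehat{K}-\widehat{L})$, where $L$ runs over the minimal elements among the normal subgroups of $H$ containing $K$ properly; $e(G,H,K)$ is the sum of the distinct $G$-conjugates of $\varepsilon(H,K)$. The pair $(H,K)$ is a strong Shoda pair of $G$ if $K\unlhd H\unlhd N_G(K)$, $H/K$ is cyclic and a maximal abelian subgroup of $N_G(K)/K$, and the distinct $G$-conjugates of $\varepsilon(H,K)$ are mutually orthogonal. Then: (i) $\mathrm{Ab}\text{-by-}\mathrm{Nil}\subseteq \mathrm{Ab}\text{-by-}\mathrm{Sup}\subseteq \mathcal{A}\text{-by-}\mathrm{Sup}\subseteq\mathcal{C}$; (ii) $(\mathrm{nM}\cup \mathrm{Ab}\text{-by-}\mathrm{Nil})\subseteq \mathrm{sM}\subseteq X\subseteq\mathcal{C}$; (iii) $\mathcal{A}\text{-by-}\mathrm{Sup}\nsubseteq X$; (iv) $X\nsubseteq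 \mathcal{A}\text{-by-}\mathrm{Sup}$; (v) $\mathcal{C}\nsubseteq \mathrm{stM}$. A group that lies in $\mathcal{C}$ but not in $\mathrm{stM}$ is SmallGroup(1000,86), i.e. the group of order $1000$ generated by $x_1,\dots,x_6$ with the relations (where $[x,y]=x^{-1}y^{-1}xy$) $$x_1^2=x_2,\quad x_2^2=x_3,\quad x_3^2=x_4^5=x_5^5=x_6^5=1,$$ $$[x_2,x_1]=[x_3,x_1]=[x_3,x_2]=[x_6,x_3]=[x_6,x_4]=[x_6,x_5]=1,$$ $$[x_5,x_4]=x_6,\quad [x_5,x_1]=x_4x_5,\quad [x_6,x_1]=x_6^2,\quad [x_4,x_2]=x_4x_6^2,\quad [x_6,x_2]=x_6^3,$$ $$[x_5,x_2]=x_5x_6^2,\quad [x_5,x_3]=x_5^3x_6^2,\quad [x_4,x_3]=x_4^3x_6^2,\quad [x_4,x_1]=x_4^2x_5^3x_6^4.$$ -/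

import Mathlib

universe u

namespace MonomialClasses

/-! ### Classes of finite groups -/

/-- A class of finite groups, given by its membership predicate. -/
abbrev FinGroupClass : Type (u + 1) := ∀ (G : Type u) [Group G] [Finite G], Prop

/-- Inclusion of classes of finite groups. -/
def Contained (X Y : FinGroupClass.{u}) : Prop :=
  ∀ (G : Type u) [Group G] [Finite G], X G → Y G

/-- Union of two classes of finite groups. -/
def Union (X Y : FinGroupClass.{u}) : FinGroupClass.{u} := fun G _ _ => X G ∨ Y G

/-- `X`-by-`Y`: the groups `G` with a normal subgroup `N` such that `N ∈ X` and `G / N ∈ Y`. -/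
def By (X Y : FinGroupClass.{u}) : FinGroupClass.{u} := fun G _ _ =>
  ∃ (N : Subgroup G) (_ : N.Normal), X N ∧ Y (G ⧸ N)

/-- Abelian groups. -/
def Abelian : FinGroupClass.{u} := fun G _ _ => IsMulCommutative G

/-- Nilpotent groups. -/
def Nilpotent : FinGroupClass.{u} := fun G _ _ => Group.IsNilpotent G

/-- Supersolvable groups: there is a series `1 = N 0 ≤ N 1 ≤ ⋯ ≤ N n = G` of normal subgroups
of `G` whose factors `N (i + 1) / N i` are cyclic. -/
def Supersolvable : FinGroupClass.{u} := fun G _ _ =>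
  ∃ (n : ℕ) (N : ℕ → Subgroup G) (_ : ∀ i, (N i).Normal), N 0 = ⊥ ∧ N n = ⊤ ∧
    ∀ i < n, N i ≤ N (i + 1) ∧ IsCyclic (N (i + 1) ⧸ (N i).subgroupOf (N (i + 1)))

/-- The class `𝒜`: solvable groups all of whose Sylow subgroups are abelian. -/
def SolvableAbelianSylow : FinGroupClass.{u} := fun G _ _ =>
  Group.IsSolvable G ∧ ∀ p : ℕ, p.Prime → ∀ P : Sylow p G, IsMulCommutative P

/-- `Ab-by-Nil`. -/
def AbByNil : FinGroupClass.{u} := By Abelian Nilpotent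

/-- `Ab-by-Sup`. -/
def AbBySup : FinGroupClass.{u} := By Abelian Supersolvable

/-- `𝒜-by-Sup`. -/
def ABySup : FinGroupClass.{u} := By SolvableAbelianSylow Supersolvable

/-! ### The class `𝒞` -/

/-- The property: the group is abelian or it contains a noncentral abelian normal subgroup. -/
def AbelianOrNoncentral (G : Type u) [Group G] : Prop :=
  IsMulCommutative G ∨
    ∃ A : Subgroup G, A.Normal ∧ IsMulCommutative A ∧ ¬ A ≤ Subgroup.center G

/-- The class `𝒞`: all subgroups of `G` and all quotient groups (of `G` and of its subgroups)
are abelian or contain a noncentral abelian normal subgroup. See `ClassC.subgroup` and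
`ClassC.quotient` for the special cases of subgroups of `G` and of quotients of `G`. -/
def ClassC : FinGroupClass.{u} := fun G _ _ =>
  ∀ (H : Subgroup G) (N : Subgroup H) [N.Normal], AbelianOrNoncentral (H ⧸ N)

lemma AbelianOrNoncentral.of_equiv {G H : Type u} [Group G] [Group H] (e : G ≃* H)
    (h : AbelianOrNoncentral G) : AbelianOrNoncentral H := by
  rcases h with h | ⟨A, hA, hc, hn⟩
  · refine Or.inl ⟨⟨fun a b => e.symm.injective ?_⟩⟩
    rw [map_mul, map_mul, h.is_comm.comm]
  · refine Or.inr ⟨A.map e.toMonoidHom, hA.map _ e.surjective, ⟨⟨?_⟩⟩, fun hle => hn ?_⟩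
    · rintro ⟨_, a, ha, rfl⟩ ⟨_, b, hb, rfl⟩
      have := congrArg Subtype.val (hc.is_comm.comm (⟨a, ha⟩ : A) ⟨b, hb⟩)
      apply Subtype.ext
      change e a * e b = e b * e a
      rw [← map_mul, ← map_mul]
      exact congrArg e this
    · intro a ha
      rw [Subgroup.mem_center_iff]
      intro g
      have := Subgroup.mem_center_iff.1 (hle (Subgroup.mem_map_of_mem e.toMonoidHom ha)) (e g)
      apply e.injective
      rw [map_mul, map_mul]
      exact this

lemma ClassC.subgroup {G : Type u} [Group G] [Finite G] (h : ClassC G) (H : Subgroup G) :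
    AbelianOrNoncentral H :=
  (h H ⊥).of_equiv (QuotientGroup.quotientBot (G := H))

lemma ClassC.quotient {G : Type u} [Group G] [Finite G] (h : ClassC G) (N : Subgroup G)
    [N.Normal] : AbelianOrNoncentral (G ⧸ N) := by
  refine (h ⊤ (N.subgroupOf ⊤)).of_equiv
    (QuotientGroup.congr (N.subgroupOf ⊤) N Subgroup.topEquiv ?_)
  ext x
  constructor
  · rintro ⟨y, hy, rfl⟩
    exact hy
  · intro hx
    exact ⟨⟨x, trivial⟩, hx, rfl⟩

/-! ### Characters; normally and subnormally monomial groups -/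

/-- `χ` is the character of an irreducible finite-dimensional complex representation of `G`. -/
def IsIrrChar {G : Type u} [Group G] (χ : G → ℂ) : Prop :=
  ∃ (n : ℕ) (ρ : Representation ℂ G (Fin n → ℂ)), ρ.IsIrreducible ∧ χ = ρ.character

open scoped Classical in
/-- The character of `G` induced from a linear character `ψ` of the subgroup `H`:
`ψ^G(g) = |H|⁻¹ ∑ ψ(x⁻¹ g x)`, the sum being over the `x ∈ G` with `x⁻¹ g x ∈ H`. -/
noncomputable def inducedChar {G : Type u} [Group G] (H : Subgroup G) (ψ : H →* ℂˣ) (g : G) : ℂ :=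
  (Nat.card H : ℂ)⁻¹ *
    ∑ᶠ x : G, if h : x⁻¹ * g * x ∈ H then ((ψ ⟨x⁻¹ * g * x, h⟩ : ℂˣ) : ℂ) else 0

/-- `nM`: every irreducible complex character is induced from a linear character of a normal
subgroup. -/
def NormallyMonomial : FinGroupClass.{u} := fun G _ _ =>
  ∀ χ : G → ℂ, IsIrrChar χ →
    ∃ (H : Subgroup G) (ψ : H →* ℂˣ), H.Normal ∧ χ = inducedChar H ψ

/-- `sM`: every irreducible complex character is induced from a linear character of a subnormal
subgroup. -/
def SubnormallyMonomial : FinGroupClass.{u} := fun G _ _ =>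
  ∀ χ : G → ℂ, IsIrrChar χ →
    ∃ (H : Subgroup G) (ψ : H →* ℂˣ), H.IsSubnormal ∧ χ = inducedChar H ψ

/-! ### The class `X` -/

/-- `O^p(A)`, the smallest normal subgroup of `A` whose quotient is a `p`-group
(see `isLeast_pResidual`). -/
def pResidual (p : ℕ) (A : Type u) [Group A] : Subgroup A :=
  sInf {N : Subgroup A | ∃ _ : N.Normal, IsPGroup p (A ⧸ N)}

lemma isLeast_pResidual (p : ℕ) (A : Type u) [Group A] [Finite A] :
    IsLeast {N : Subgroup A | ∃ _ : N.Normal, IsPGroup p (A ⧸ N)} (pResidual p A) := by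
  have hn : (pResidual p A).Normal :=
    ⟨fun a ha g => Subgroup.mem_sInf.2 fun N hN => hN.1.conj_mem a (Subgroup.mem_sInf.1 ha N hN) g⟩
  refine ⟨⟨hn, fun q => ?_⟩, fun N hN => sInf_le hN⟩
  induction q using QuotientGroup.induction_on with
  | H a =>
    have key : ∀ N : Subgroup A, ∃ k : ℕ,
        (∃ _ : N.Normal, IsPGroup p (A ⧸ N)) → a ^ p ^ k ∈ N := by
      intro N
      by_cases hN : ∃ _ : N.Normal, IsPGroup p (A ⧸ N)
      · obtain ⟨hN1, hN2⟩ := hN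
        obtain ⟨k, hk⟩ := hN2 (a : A ⧸ N)
        exact ⟨k, fun _ => (QuotientGroup.eq_one_iff _).1 (by simpa using hk)⟩
      · exact ⟨0, fun h => absurd h hN⟩
    choose k hk using key
    obtain ⟨m, hm⟩ := (Set.finite_range k).bddAbove
    refine ⟨m, ?_⟩
    rw [← QuotientGroup.mk_pow, QuotientGroup.eq_one_iff]
    refine Subgroup.mem_sInf.2 fun N hN => ?_
    have hle : k N ≤ m := hm ⟨N, rfl⟩
    rw [← Nat.sub_add_cancel hle, pow_add, mul_comm, pow_mul]
    exact N.pow_mem (hk N hN) _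

/-- `B` has a central `p`-factor: there are normal subgroups `L < K` of `B` such that `K / L` is a
`p`-group contained in the centre of `B / L`. (Equivalently, refining `L < K`, some chief factor
of `B` of order `p` is central.) -/
def HasCentralPFactor (p : ℕ) (B : Type u) [Group B] : Prop :=
  ∃ (L K : Subgroup B) (_ : L.Normal), K.Normal ∧ L < K ∧
    IsPGroup p (K.map (QuotientGroup.mk' L)) ∧
    K.map (QuotientGroup.mk' L) ≤ Subgroup.center (B ⧸ L)

/-- The class `X`: solvable groups `G` such that, for all primes `p` dividing `|G|` and all
subgroups `A` of `G`, the group `O^p(A)` has no central `p`-factor. -/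
def ClassX : FinGroupClass.{u} := fun G _ _ =>
  Group.IsSolvable G ∧ ∀ p : ℕ, p.Prime → p ∣ Nat.card G → ∀ A : Subgroup G,
    ¬ HasCentralPFactor p (pResidual p A)

/-! ### Strong Shoda pairs and strongly monomial groups -/

section GroupAlgebra

variable {G : Type u} [Group G]

/-- `Ĥ = |H|⁻¹ ∑_{h ∈ H} h` in `ℚG`. -/
noncomputable def hat (H : Subgroup G) : MonoidAlgebra ℚ G :=
  (Nat.card H : ℚ)⁻¹ • ∑ᶠ h : H, MonoidAlgebra.single (h : G) (1 : ℚ)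

/-- The set of minimal elements among the normal subgroups of `H` containing `K` properly. -/
def minimalOver (H K : Subgroup G) : Set (Subgroup G) :=
  {L | Minimal (fun M : Subgroup G => M ≤ H ∧ (M.subgroupOf H).Normal ∧ K < M) L}

lemma commute_single_hat [Finite G] {H L : Subgroup G} (hL : L ≤ H)
    (hn : (L.subgroupOf H).Normal) {m : G} (hm : m ∈ H) :
    Commute (MonoidAlgebra.single m (1 : ℚ)) (hat L) := by
  classical
  have := Fintype.ofFinite L
  have hN : ∀ x : G, x ∈ H → ∀ l : G, l ∈ L → x * l * x⁻¹ ∈ L := fun x hx l hl =>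
    hn.conj_mem ⟨l, hL hl⟩ hl ⟨x, hx⟩
  unfold hat
  refine Commute.smul_right ?_ _
  rw [finsum_eq_sum_of_fintype, Commute, SemiconjBy, Finset.mul_sum, Finset.sum_mul]
  refine Finset.sum_bij' (fun l _ => ⟨m * l * m⁻¹, hN m hm l l.2⟩)
    (fun l _ => ⟨m⁻¹ * l * m, by simpa using hN m⁻¹ (H.inv_mem hm) l l.2⟩) ?_ ?_ ?_ ?_ ?_
  · intros; simp
  · intros; simp
  · intro a _; ext; simp [mul_assoc]
  · intro a _; ext; simp [mul_assoc]
  · intro a _; simp [MonoidAlgebra.single_mul_single]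

lemma commute_hat_hat [Finite G] {H L M : Subgroup G} (hL : L ≤ H)
    (hn : (L.subgroupOf H).Normal) (hM : M ≤ H) : Commute (hat M) (hat L) := by
  have := Fintype.ofFinite M
  rw [hat]
  refine Commute.smul_left ?_ _
  rw [finsum_eq_sum_of_fintype]
  exact Finset.sum_induction _ (fun x => Commute x (hat L)) (fun _ _ => Commute.add_left)
    (Commute.zero_left _) (fun m _ => commute_single_hat hL hn (hM m.2))

/-- The factors of the product defining `ε(H, K)` commute with each other. -/
lemma commute_factors [Finite G] (H K : Subgroup G) {L M : Subgroup G} (hL : L ∈ minimalOver H K)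
    (hM : M ∈ minimalOver H K) : Commute (hat K - hat L) (hat K - hat M) := by
  obtain ⟨⟨hL1, hL2, hL3⟩, -⟩ := hL
  obtain ⟨⟨hM1, hM2, hM3⟩, -⟩ := hM
  have hKH : K ≤ H := hL3.le.trans hL1
  exact ((Commute.refl _).sub_right (commute_hat_hat hM1 hM2 hKH)).sub_left
    (((commute_hat_hat hL1 hL2 hKH).symm).sub_right (commute_hat_hat hM1 hM2 hL1))

open scoped Classical in
/-- `ε(H, K)`: it is `K̂` if `H = K`, and otherwise the product of the `K̂ - L̂`, with `L` running
over the minimal normal subgroups of `H` containing `K` properly. -/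
noncomputable def epsilon [Finite G] (H K : Subgroup G) : MonoidAlgebra ℚ G :=
  if H = K then hat K
  else (Set.toFinite (minimalOver H K)).toFinset.noncommProd (fun L => hat K - hat L)
    (fun L hL M hM _ => commute_factors H K (by simpa using hL) (by simpa using hM))

/-- The conjugate `g⁻¹ a g` of `a ∈ ℚG`. -/
noncomputable def conjBy (a : MonoidAlgebra ℚ G) (g : G) : MonoidAlgebra ℚ G :=
  MonoidAlgebra.single g⁻¹ 1 * a * MonoidAlgebra.single g 1

/-- The set of the distinct `G`-conjugates of `a`. -/
def conjugates (a : MonoidAlgebra ℚ G) : Set (MonoidAlgebra ℚ G) := Set.range (conjBy a)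

/-- `e(G, H, K)`, the sum of all the distinct `G`-conjugates of `ε(H, K)`. -/
noncomputable def eSum [Finite G] (H K : Subgroup G) : MonoidAlgebra ℚ G :=
  ∑ᶠ a ∈ conjugates (epsilon H K), a

/-- The image of `H` in the quotient `N_G(K) / K`. -/
def imageInNormalizerQuotient (H K : Subgroup G) :
    Subgroup (Subgroup.normalizer (K : Set G) ⧸ K.subgroupOf (Subgroup.normalizer (K : Set G))) :=
  (H.subgroupOf (Subgroup.normalizer (K : Set G))).map (QuotientGroup.mk' _)

/-- `(H, K)` is a strong Shoda pair of `G`. -/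
structure IsStrongShodaPair [Finite G] (H K : Subgroup G) : Prop where
  le : K ≤ H
  normal : (K.subgroupOf H).Normal
  le_normalizer : H ≤ Subgroup.normalizer (K : Set G)
  normal_normalizer : (H.subgroupOf (Subgroup.normalizer (K : Set G))).Normal
  cyclic : IsCyclic (imageInNormalizerQuotient H K)
  maximal_abelian : Maximal
    (fun A : Subgroup (Subgroup.normalizer (K : Set G) ⧸
      K.subgroupOf (Subgroup.normalizer (K : Set G))) => IsMulCommutative A)
    (imageInNormalizerQuotient H K)
  orthogonal : (conjugates (epsilon H K)).Pairwise fun a b => a * b = 0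

/-- A primitive central idempotent: a nonzero central idempotent that is not the sum of two
nonzero orthogonal central idempotents. -/
def IsPrimitiveCentralIdempotent {R : Type u} [Ring R] (e : R) : Prop :=
  e ∈ Subring.center R ∧ IsIdempotentElem e ∧ e ≠ 0 ∧
    ∀ f g : R, f ∈ Subring.center R → g ∈ Subring.center R → IsIdempotentElem f →
      IsIdempotentElem g → f * g = 0 → f + g = e → f = 0 ∨ g = 0

end GroupAlgebra

/-- `stM`: every primitive central idempotent of `ℚG` is realized by a strong Shoda pair `(H, K)`
of `G`, i.e. it is of the form `α e(G, H, K)` with `α ∈ ℚ`. -/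
def StronglyMonomial : FinGroupClass.{u} := fun G _ _ =>
  ∀ e : MonoidAlgebra ℚ G, IsPrimitiveCentralIdempotent e →
    ∃ (H K : Subgroup G) (α : ℚ), IsStrongShodaPair H K ∧ e = α • eSum H K

/-! ### The group `SmallGroup(1000, 86)` -/

/-- The generators `x₁, …, x₆`, as elements of the free group. -/
def x (i : Fin 6) : FreeGroup (Fin 6) := FreeGroup.of i

/-- The commutator `[a, b] = a⁻¹ b⁻¹ a b`. -/
def comm (a b : FreeGroup (Fin 6)) : FreeGroup (Fin 6) := a⁻¹ * b⁻¹ * a * b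

/-- The relators; a relation `a = b` is written as `a * b⁻¹`, and `xᵢ` is `x (i - 1)`. -/
def relators1000 : Set (FreeGroup (Fin 6)) :=
  let x₁ := x 0
  let x₂ := x 1
  let x₃ := x 2
  let x₄ := x 3
  let x₅ := x 4
  let x₆ := x 5
  {x₁ ^ 2 * x₂⁻¹, x₂ ^ 2 * x₃⁻¹, x₄ ^ 5, x₃ ^ 2, x₅ ^ 5, x₆ ^ 5,
    comm x₂ x₁, comm x₃ x₁, comm x₃ x₂, comm x₆ x₃, comm x₆ x₄, comm x₆ x₅,
    comm x₅ x₄ * x₆⁻¹, comm x₅ x₁ * (x₄ * x₅)⁻¹,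
    comm x₆ x₁ * (x₆ ^ 2)⁻¹, comm x₄ x₂ * (x₄ * x₆ ^ 2)⁻¹, comm x₆ x₂ * (x₆ ^ 3)⁻¹,
    comm x₅ x₂ * (x₅ * x₆ ^ 2)⁻¹, comm x₅ x₃ * (x₅ ^ 3 * x₆ ^ 2)⁻¹,
    comm x₄ x₃ * (x₄ ^ 3 * x₆ ^ 2)⁻¹, comm x₄ x₁ * (x₄ ^ 2 * x₅ ^ 3 * x₆ ^ 4)⁻¹}

/-- `SmallGroup(1000, 86)`, by its polycyclic presentation. -/
abbrev SmallGroup1000 : Type := PresentedGroup relators1000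

end MonomialClasses

namespace MonomialClasses

/-! ### Supersolvable groups -/

/-! The containments in `ClassC` rest on one extremal object. Given a solvable normal subgroup A
outside the centre, take N minimal among the noncentral normal subgroups of G inside A; then [N, N]
is central, and for some prime p so are all p-th powers of elements of N
(`exists_minimal_noncentral`). If A has abelian Sylow subgroups, N is a Sylow p-subgroup times a
central group, hence abelian; if A is central and G is not abelian, a cyclic normal subgroup of the
supersolvable group G/Z(G) pulls back to an abelian noncentral one. For G in X take A = G. Either N
lies in O^p(G), and then [N, N] is trivial because it would otherwise be a central p-factor, or
O^p(G) acts trivially on NZ(G)/Z(G), so that G acts there as a p-group and fixes a nontrivial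
element.

An Ab-by-Nil group is subnormally monomial by descent: among pairs (H, U) with H containing the
abelian normal subgroup A, U stable under H and |G : H| dim U ≤ dim V, one with dim U minimal has
dim U = 1, since otherwise a weight space and its stabilizer are smaller. Subgroups above A are
subnormal because G/A is nilpotent.

For sM ⊆ X, Taketa's argument gives solvability. The key is then
`SubnormallyMonomial.exists_isSubnormal`: a q-group Q stabilizing a linear character μ of a
q'-subgroup K fixes a point in a set of size prime to q, which yields a subnormal S ≥ Q with a
linear character agreeing with μ on K ∩ S. A minimal central p-factor lives in a group Γ = P⟨x⟩ with
P a normal p-subgroup, x a q-element and O^p(Γ) = Γ. There the subnormal subgroup contains all of Γ,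
so a character of p-power order that is nontrivial on the factor extends to Γ, although linear
characters of Γ have q-power order.

The separating groups are Heisenberg groups extended by units. Over the field with 3 elements the
group is supersolvable but has a central 3-factor in its own O^3. Over the field with 4 elements the
units act without fixed points, which gives X, while every normal subgroup with supersolvable
quotient contains the nonabelian Heisenberg group.

For (v), the presented group is identified with an explicit semidirect product 5^(1+2) : C8. Proper
sections in `ClassC` are handled by (i) and the rest by hand. With Z the centre of the Sylow
5-subgroup, the centre of ℚG(1 - Ẑ) is spanned by 1 - Ẑ and the sum s of the 25 involutions cut by 1
- Ẑ. Since s² = 25(1 - Ẑ), there is a primitive central idempotent e with coefficient 2/5 at 1. If e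
came from a strong Shoda pair (H, K), comparing this coefficient with the number of conjugates of
ε(H, K), which is at least |G : N_G(K)|, contradicts the subgroup structure. -/

lemma isCyclic_quotient_subgroupOf_iff {G : Type u} [Group G] {A B : Subgroup G} [A.Normal] :
    IsCyclic (B ⧸ A.subgroupOf B) ↔ ∃ g ∈ B, ∀ x ∈ B, ∃ k : ℤ, (g ^ k)⁻¹ * x ∈ A := by
  rw [isCyclic_iff_exists_zpowers_eq_top]
  constructor
  · rintro ⟨q, hq⟩
    induction q using QuotientGroup.induction_on with
    | H g =>
      refine ⟨g, g.2, fun x hx => ?_⟩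
      have : ((⟨x, hx⟩ : B) : B ⧸ A.subgroupOf B) ∈ Subgroup.zpowers (g : B ⧸ A.subgroupOf B) :=
        hq ▸ Subgroup.mem_top _
      obtain ⟨k, hk⟩ := Subgroup.mem_zpowers_iff.1 this
      refine ⟨k, ?_⟩
      rw [← QuotientGroup.mk_zpow, QuotientGroup.eq] at hk
      simpa [Subgroup.mem_subgroupOf] using hk
  · rintro ⟨g, hg, h⟩
    refine ⟨((⟨g, hg⟩ : B) : B ⧸ A.subgroupOf B), eq_top_iff.2 fun q _ => ?_⟩
    induction q using QuotientGroup.induction_on with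
    | H x =>
      obtain ⟨k, hk⟩ := h x x.2
      refine Subgroup.mem_zpowers_iff.2 ⟨k, ?_⟩
      rw [← QuotientGroup.mk_zpow, QuotientGroup.eq]
      simpa [Subgroup.mem_subgroupOf] using hk

lemma Supersolvable.of_surjective {G Q : Type u} [Group G] [Finite G] [Group Q] [Finite Q]
    (h : Supersolvable G) (f : G →* Q) (hf : Function.Surjective f) : Supersolvable Q := by
  obtain ⟨n, N, hN, h0, h1, h2⟩ := h
  refine ⟨n, fun i => (N i).map f, fun i => (hN i).map f hf, by simp [h0],
    by simp [h1, Subgroup.map_top_of_surjective f hf], fun i hi => ?_⟩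
  obtain ⟨hle, hc⟩ := h2 i hi
  have := hN i
  have := (hN i).map f hf
  rw [isCyclic_quotient_subgroupOf_iff] at hc
  refine ⟨Subgroup.map_mono hle, isCyclic_quotient_subgroupOf_iff.2 ?_⟩
  obtain ⟨g, hg, h⟩ := hc
  refine ⟨f g, Subgroup.mem_map_of_mem f hg, ?_⟩
  rintro _ ⟨x, hx, rfl⟩
  obtain ⟨k, hk⟩ := h x hx
  exact ⟨k, by simpa using Subgroup.mem_map_of_mem f hk⟩

/-- A group with a homomorphism to a supersolvable group with cyclic kernel is supersolvable. -/
lemma Supersolvable.of_hom {G Q : Type u} [Group G] [Finite G] [Group Q] [Finite Q]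
    (h : Supersolvable Q) (f : G →* Q) (hf : IsCyclic f.ker) : Supersolvable G := by
  obtain ⟨n, N, hN, h0, h1, h2⟩ := h
  -- The trivial group is put below the preimages of the given series: the extra bottom factor is
  -- the kernel, and all indices shift by one.
  refine ⟨n + 1, fun i => Nat.rec ⊥ (fun j _ => (N j).comap f) i, ?_, rfl, by simp [h1], ?_⟩
  · rintro (_ | i)
    · exact inferInstanceAs (⊥ : Subgroup G).Normal
    · exact (hN i).comap f
  · rintro (_ | i) hi
    · refine ⟨bot_le, ?_⟩
      change IsCyclic (Subgroup.comap f (N 0) ⧸ (⊥ : Subgroup G).subgroupOf (Subgroup.comap f (N 0)))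
      rw [h0, isCyclic_quotient_subgroupOf_iff]
      obtain ⟨g, hg⟩ := hf.exists_generator
      refine ⟨g, g.2, fun x hx => ?_⟩
      obtain ⟨k, hk⟩ := Subgroup.mem_zpowers_iff.1 (hg ⟨x, hx⟩)
      refine ⟨k, ?_⟩
      have : (g : G) ^ k = x := congrArg Subtype.val hk
      simp [this]
    · obtain ⟨hle, hc⟩ := h2 i (by omega)
      have := hN i
      refine ⟨Subgroup.comap_mono hle, ?_⟩
      change IsCyclic (Subgroup.comap f (N (i + 1)) ⧸
        (Subgroup.comap f (N i)).subgroupOf (Subgroup.comap f (N (i + 1))))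
      -- The map need not be surjective, so a factor upstairs only embeds in the cyclic factor
      -- downstairs, which is enough.
      let φ : Subgroup.comap f (N (i + 1)) →* N (i + 1) ⧸ (N i).subgroupOf (N (i + 1)) :=
        (QuotientGroup.mk' _).comp (f.subgroupComap (N (i + 1)))
      have hφ : (Subgroup.comap f (N i)).subgroupOf (Subgroup.comap f (N (i + 1))) = φ.ker := by
        ext x
        rw [MonoidHom.mem_ker]
        change _ ↔ ((f.subgroupComap (N (i + 1)) x : N (i + 1)) :
          N (i + 1) ⧸ (N i).subgroupOf (N (i + 1))) = 1
        rw [QuotientGroup.eq_one_iff]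
        rfl
      have := isCyclic_of_injective _ (QuotientGroup.kerLift_injective φ)
      exact isCyclic_of_surjective _
        (QuotientGroup.quotientMulEquivOfEq hφ).symm.surjective

/-- The first nontrivial term of the series lies directly above the trivial group, so it is itself
cyclic. -/
lemma Supersolvable.exists_normal_zpowers {G : Type u} [Group G] [Finite G] [Nontrivial G]
    (h : Supersolvable G) : ∃ g : G, g ≠ 1 ∧ (Subgroup.zpowers g).Normal := by
  obtain ⟨n, N, hN, h0, h1, h2⟩ := h
  have : ∃ i < n, N i = ⊥ ∧ N (i + 1) ≠ ⊥ := by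
    by_contra! hc
    have : ∀ i ≤ n, N i = ⊥ := by
      intro i
      induction i with
      | zero => exact fun _ => h0
      | succ i ih => exact fun hi => hc i hi (ih (by omega))
    exact bot_ne_top ((this n le_rfl).symm.trans h1)
  obtain ⟨i, hi, hb, hnb⟩ := this
  obtain ⟨-, hc⟩ := h2 i hi
  have := hN i
  rw [isCyclic_quotient_subgroupOf_iff] at hc
  obtain ⟨g, hg, h⟩ := hc
  have key : Subgroup.zpowers g = N (i + 1) := by
    refine le_antisymm ((Subgroup.zpowers_le).2 hg) fun x hx => ?_
    obtain ⟨k, hk⟩ := h x hx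
    rw [hb, Subgroup.mem_bot, inv_mul_eq_one] at hk
    exact hk ▸ Subgroup.zpow_mem_zpowers g k
  refine ⟨g, ?_, key ▸ hN (i + 1)⟩
  rintro rfl
  exact hnb (by simpa using key.symm)

/-- Induction on the order: a nontrivial central element generates a cyclic normal subgroup, and the
quotient by it is again nilpotent. -/
lemma Nilpotent.supersolvable : Contained Nilpotent.{u} Supersolvable := by
  suffices ∀ (n : ℕ) (G : Type u) [Group G] [Finite G], Nat.card G = n → Group.IsNilpotent G →
      Supersolvable G from fun G _ _ h => this _ G rfl h
  intro n
  induction n using Nat.strong_induction_on with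
  | _ n ih =>
    intro G _ _ hn hG
    rcases subsingleton_or_nontrivial G with hs | hs
    · exact ⟨0, fun _ => ⊥, fun _ => inferInstance, rfl, Subsingleton.elim _ _, by simp⟩
    · obtain ⟨z, hz, hz1⟩ := (Subgroup.ne_bot_iff_exists_ne_one.1
        (Group.IsNilpotent.center_ne_bot (G := G))).imp fun z h => (⟨z.2, h⟩ : _ ∧ _)
      have hn' : (Subgroup.zpowers (z : G)).Normal := ⟨by
        rintro _ ⟨k, rfl⟩ g
        have := Subgroup.mem_center_iff.1 ((Subgroup.center G).zpow_mem z.2 k) g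
        simp only [this, mul_inv_cancel_right]
        exact Subgroup.zpow_mem_zpowers _ k⟩
      have hlt : Nat.card (G ⧸ Subgroup.zpowers (z : G)) < n := by
        rw [← hn, Subgroup.card_eq_card_quotient_mul_card_subgroup (Subgroup.zpowers (z : G))]
        refine lt_mul_of_one_lt_right Nat.card_pos ?_
        have : Nontrivial (Subgroup.zpowers (z : G)) := by
          rw [Subgroup.nontrivial_iff_ne_bot, Ne, Subgroup.zpowers_eq_bot]
          exact fun h => hz1 (Subtype.ext h)
        exact Finite.one_lt_card
      refine (ih _ hlt (G ⧸ Subgroup.zpowers (z : G)) rfl inferInstance).of_hom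
        (QuotientGroup.mk' _) ?_
      rw [QuotientGroup.ker_mk']
      infer_instance

/-! ### Solvable groups with abelian Sylow subgroups -/

/-- Every p-subgroup lies in a Sylow subgroup, so commutativity can be tested on all p-subgroups; in
this form the class visibly passes to subgroups. -/
lemma solvableAbelianSylow_iff {G : Type u} [Group G] [Finite G] :
    SolvableAbelianSylow G ↔ Group.IsSolvable G ∧ ∀ p : ℕ, p.Prime → ∀ S : Subgroup G,
      IsPGroup p S → ∀ a ∈ S, ∀ b ∈ S, a * b = b * a := by
  refine and_congr_right fun _ => forall₂_congr fun p hp => ⟨fun h S hS a ha b hb => ?_,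
    fun h P => ⟨⟨fun a b => Subtype.ext (h P P.2 a a.2 b b.2)⟩⟩⟩
  obtain ⟨Q, hQ⟩ := hS.exists_le_sylow
  exact congrArg Subtype.val ((h Q).is_comm.comm ⟨a, hQ ha⟩ ⟨b, hQ hb⟩)

lemma SolvableAbelianSylow.of_injective {G H : Type u} [Group G] [Finite G] [Group H] [Finite H]
    (h : SolvableAbelianSylow G) (f : H →* G) (hf : Function.Injective f) :
    SolvableAbelianSylow H := by
  rw [solvableAbelianSylow_iff] at h ⊢
  have := h.1
  refine ⟨Group.isSolvable_of_isSolvable_injective hf, fun p hp S hS a ha b hb => hf ?_⟩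
  rw [map_mul, map_mul]
  exact h.2 p hp (S.map f) (hS.map f) _ (Subgroup.mem_map_of_mem f ha) _
    (Subgroup.mem_map_of_mem f hb)

lemma SolvableAbelianSylow.of_surjective {G Q : Type u} [Group G] [Finite G] [Group Q] [Finite Q]
    (h : SolvableAbelianSylow G) (f : G →* Q) (hf : Function.Surjective f) :
    SolvableAbelianSylow Q := by
  have := h.1
  refine ⟨Group.isSolvable_of_surjective hf, fun p hp P => ?_⟩
  have : Fact p.Prime := ⟨hp⟩
  obtain ⟨P', rfl⟩ := Sylow.mapSurjective_surjective hf p P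
  have hP := h.2 p hp P'
  refine ⟨⟨?_⟩⟩
  rintro ⟨_, a, ha, rfl⟩ ⟨_, b, hb, rfl⟩
  apply Subtype.ext
  change f a * f b = f b * f a
  rw [← map_mul, ← map_mul]
  exact congrArg f (congrArg Subtype.val (hP.is_comm.comm ⟨a, ha⟩ ⟨b, hb⟩))

lemma Abelian.solvableAbelianSylow : Contained Abelian.{u} SolvableAbelianSylow := by
  intro G _ _ h
  exact ⟨Group.isSolvable_of_comm h.is_comm.comm, fun p _ P => ⟨⟨fun a b => Subtype.ext
    (h.is_comm.comm _ _)⟩⟩⟩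

lemma By.mono {X X' Y Y' : FinGroupClass.{u}} (h : Contained X X') (h' : Contained Y Y') :
    Contained (By X Y) (By X' Y') := by
  rintro G _ _ ⟨N, hN, h1, h2⟩
  exact ⟨N, hN, h _ h1, h' _ h2⟩

lemma ABySup.of_injective {G H : Type u} [Group G] [Finite G] [Group H] [Finite H]
    (h : ABySup G) (f : H →* G) (hf : Function.Injective f) : ABySup H := by
  obtain ⟨N, hN, h1, h2⟩ := h
  refine ⟨N.comap f, hN.comap f, h1.of_injective (f.subgroupComap N) ?_,
    h2.of_hom (QuotientGroup.map (N.comap f) N f le_rfl) ?_⟩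
  · intro a b hab
    exact Subtype.ext (hf (congrArg Subtype.val hab))
  · have : (QuotientGroup.map (N.comap f) N f le_rfl).ker = ⊥ := by
      rw [QuotientGroup.ker_map, eq_bot_iff, Subgroup.map_le_iff_le_comap]
      exact fun x hx => (QuotientGroup.eq_one_iff x).2 hx
    rw [this]
    infer_instance

lemma ABySup.of_surjective {G Q : Type u} [Group G] [Finite G] [Group Q] [Finite Q]
    (h : ABySup G) (f : G →* Q) (hf : Function.Surjective f) : ABySup Q := by
  obtain ⟨N, hN, h1, h2⟩ := h
  have hN' := hN.map f hf
  refine ⟨N.map f, hN', h1.of_surjective (f.subgroupMap N) (f.subgroupMap_surjective N),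
    h2.of_surjective (QuotientGroup.map N (N.map f) f (Subgroup.le_comap_map f N)) ?_⟩
  exact QuotientGroup.map_surjective_of_surjective _ _ _ ((QuotientGroup.mk'_surjective _).comp hf) _

/-! ### Noncentral abelian normal subgroups -/

open Subgroup
open scoped commutatorElement

/-- N is a minimal noncentral normal subgroup inside A. By solvability [N, N] is smaller than N,
hence central. The elements of N with central p-th power then form a normal subgroup, which is
noncentral when p divides the order of some element of N modulo the centre; by minimality it is N.
-/
lemma exists_minimal_noncentral {G : Type u} [Group G] [Finite G] (A : Subgroup G) [A.Normal]
    (hs : Group.IsSolvable A) (hA : ¬ A ≤ center G) :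
    ∃ p : ℕ, p.Prime ∧ ∃ N : Subgroup G, N.Normal ∧ N ≤ A ∧ ¬ N ≤ center G ∧
      (∀ M : Subgroup G, M.Normal → M < N → M ≤ center G) ∧ ⁅N, N⁆ ≤ center G ∧
      ∀ x ∈ N, x ^ p ∈ center G := by
  obtain ⟨N, ⟨hN, hNA, hNc⟩, hmin⟩ := (Set.toFinite
    {N : Subgroup G | N.Normal ∧ N ≤ A ∧ ¬ N ≤ center G}).exists_minimal ⟨A, ‹_›, le_rfl, hA⟩
  have hmin' : ∀ M : Subgroup G, M.Normal → M < N → M ≤ center G := by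
    intro M hM hlt
    by_contra hc
    exact hlt.not_ge (hmin ⟨hM, hlt.le.trans hNA, hc⟩ hlt.le)
  have hNs : Group.IsSolvable N :=
    Group.isSolvable_of_isSolvable_injective (Subgroup.inclusion_injective hNA)
  have hNb : Nontrivial N := by
    rw [nontrivial_iff_ne_bot]
    rintro rfl
    exact hNc bot_le
  have hcomm : ⁅N, N⁆ ≤ center G := by
    refine hmin' _ inferInstance (lt_of_le_of_ne (commutator_le_left N N) fun h => ?_)
    have h1 : commutator N < ⊤ := Group.IsSolvable.commutator_lt_top_of_nontrivial N
    apply h1.ne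
    apply map_injective N.subtype_injective
    rw [commutator_def, map_commutator, ← MonoidHom.range_eq_map, range_subtype, h]
  obtain ⟨x, hx, hxc⟩ := SetLike.not_le_iff_exists.1 hNc
  have hn : orderOf (x : G ⧸ center G) ≠ 1 := by
    rw [Ne, orderOf_eq_one_iff, QuotientGroup.eq_one_iff]
    exact hxc
  obtain ⟨p, hp, hpd⟩ := Nat.exists_prime_and_dvd hn
  refine ⟨p, hp, N, hN, hNA, hNc, hmin', hcomm, ?_⟩
  let W : Subgroup G :=
    { carrier := {x | x ∈ N ∧ x ^ p ∈ center G}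
      one_mem' := by simp [N.one_mem]
      mul_mem' := by
        rintro a b ⟨ha, ha'⟩ ⟨hb, hb'⟩
        refine ⟨N.mul_mem ha hb, ?_⟩
        rw [← QuotientGroup.eq_one_iff] at ha' hb' ⊢
        have hab : Commute (a : G ⧸ center G) b := by
          have := hcomm (commutator_mem_commutator ha hb)
          rw [← QuotientGroup.eq_one_iff] at this
          exact commutatorElement_eq_one_iff_commute.1 this
        rw [QuotientGroup.mk_pow, QuotientGroup.mk_mul, hab.mul_pow, ← QuotientGroup.mk_pow,
          ← QuotientGroup.mk_pow, ha', hb', one_mul]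
      inv_mem' := by
        rintro a ⟨ha, ha'⟩
        exact ⟨N.inv_mem ha, by simpa using ha'⟩ }
  have hW : W.Normal := ⟨fun a ha g => ⟨hN.conj_mem a ha.1 g, by
    rw [conj_pow]
    exact (inferInstance : (center G).Normal).conj_mem _ ha.2 g⟩⟩
  have hWN : W = N := by
    by_contra hne
    have hle := hmin' W hW (lt_of_le_of_ne (fun a ha => ha.1) hne)
    -- This power of x has order exactly p modulo the centre: it lies in W without being central.
    have hy : x ^ (orderOf (x : G ⧸ center G) / p) ∈ W := by
      refine ⟨N.pow_mem hx _, ?_⟩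
      rw [← pow_mul, Nat.div_mul_cancel hpd, ← QuotientGroup.eq_one_iff, QuotientGroup.mk_pow,
        pow_orderOf_eq_one]
    have := hle hy
    rw [← QuotientGroup.eq_one_iff, QuotientGroup.mk_pow, ← orderOf_dvd_iff_pow_eq_one] at this
    have h1 := Nat.le_of_dvd
      (Nat.div_pos (Nat.le_of_dvd (orderOf_pos _) hpd) hp.pos) this
    exact absurd (Nat.div_lt_self (orderOf_pos (x : G ⧸ center G)) hp.one_lt) (not_lt.2 h1)
  intro x hx
  exact (hWN ▸ hx : x ∈ W).2

/-- If the normal closure of `y` modulo the centre is cyclic, then `y` and the centre generate an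
abelian normal subgroup. -/
lemma abelianOrNoncentral_of_conj {G : Type u} [Group G] {y : G} (hy : y ∉ center G)
    (h : ∀ g : G, ∃ k : ℤ, (y ^ k)⁻¹ * (g * y * g⁻¹) ∈ center G) : AbelianOrNoncentral G := by
  have hmem : ∀ x, x ∈ zpowers y ⊔ center G ↔ ∃ k : ℤ, (y ^ k)⁻¹ * x ∈ center G := by
    intro x
    rw [Subgroup.mem_sup_of_normal_right]
    constructor
    · rintro ⟨_, ⟨k, rfl⟩, z, hz, rfl⟩
      exact ⟨k, by simpa using hz⟩
    · rintro ⟨k, hk⟩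
      exact ⟨_, zpow_mem_zpowers y k, _, hk, by simp⟩
  have hcen : ∀ z ∈ center G, ∀ x, x * z = z * x := fun z hz => mem_center_iff.1 hz
  refine Or.inr ⟨zpowers y ⊔ center G, ⟨fun x hx g => ?_⟩, ⟨⟨?_⟩⟩, fun hle =>
    hy (hle (mem_sup_left (mem_zpowers y)))⟩
  · obtain ⟨k, hk⟩ := (hmem x).1 hx
    have hgy : g * y * g⁻¹ ∈ zpowers y ⊔ center G := (hmem _).2 (h g)
    have : g * x * g⁻¹ = (g * y * g⁻¹) ^ k * (g * ((y ^ k)⁻¹ * x) * g⁻¹) := by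
      rw [conj_zpow]; group
    rw [this]
    exact mul_mem (zpow_mem hgy k)
      (mem_sup_right ((inferInstance : (center G).Normal).conj_mem _ hk g))
  · rintro ⟨a, ha⟩ ⟨b, hb⟩
    apply Subtype.ext
    change a * b = b * a
    obtain ⟨k, hk⟩ := (hmem a).1 ha
    obtain ⟨l, hl⟩ := (hmem b).1 hb
    have e1 : a = y ^ k * ((y ^ k)⁻¹ * a) := by group
    have e2 : b = y ^ l * ((y ^ l)⁻¹ * b) := by group
    generalize (y ^ k)⁻¹ * a = z at e1 hk
    generalize (y ^ l)⁻¹ * b = w at e2 hl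
    subst e1 e2
    have c1 : Commute z (y ^ l * w) := (hcen z hk _).symm
    have c2 : Commute (y ^ k) (y ^ l * w) :=
      ((Commute.refl y).zpow_zpow k l).mul_right (hcen w hl _)
    exact c2.mul_left c1

/-- If the 𝒜-part A is central, G/Z(G) is a quotient of the supersolvable G/A and has a cyclic
normal subgroup to pull back. If not, the minimal noncentral N inside A is a product of an abelian
Sylow subgroup and a central subgroup. -/
lemma ABySup.abelianOrNoncentral {G : Type u} [Group G] [Finite G] (h : ABySup G) :
    AbelianOrNoncentral G := by
  obtain ⟨A, hA, h1, h2⟩ := h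
  by_cases hc : A ≤ center G
  · by_cases hab : IsMulCommutative G
    · exact Or.inl hab
    have hq : Supersolvable (G ⧸ center G) := h2.of_surjective
      (QuotientGroup.map A (center G) (MonoidHom.id G) hc)
      (QuotientGroup.map_surjective_of_surjective A (center G) (MonoidHom.id G)
        (QuotientGroup.mk'_surjective _) hc)
    have : Nontrivial (G ⧸ center G) := by
      rw [QuotientGroup.nontrivial_iff]
      intro ht
      refine hab ⟨⟨fun a b => ?_⟩⟩
      exact mem_center_iff.1 (ht ▸ mem_top b) a
    obtain ⟨q, hq1, hqn⟩ := hq.exists_normal_zpowers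
    induction q using QuotientGroup.induction_on with
    | H y =>
      refine abelianOrNoncentral_of_conj (y := y) (fun h => hq1 ((QuotientGroup.eq_one_iff _).2 h))
        fun g => ?_
      obtain ⟨k, hk⟩ := mem_zpowers_iff.1 (hqn.conj_mem _ (mem_zpowers _) (g : G ⧸ center G))
      refine ⟨k, ?_⟩
      rw [← QuotientGroup.mk_zpow, ← QuotientGroup.mk_inv, ← QuotientGroup.mk_mul,
        ← QuotientGroup.mk_mul, QuotientGroup.eq] at hk
      exact hk
  · rw [solvableAbelianSylow_iff] at h1
    obtain ⟨p, hp, N, hN, hNA, hNc, -, hcomm, hpow⟩ := exists_minimal_noncentral A h1.1 hc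
    refine Or.inr ⟨N, hN, ?_, hNc⟩
    have : Fact p.Prime := ⟨hp⟩
    obtain ⟨P⟩ : Nonempty (Sylow p N) := inferInstance
    let Z : Subgroup N := (center G).subgroupOf N
    -- PZ contains Z and hence all commutators of N, so it is normal even though P is not known to
    -- be.
    have hM : ((P : Subgroup N) ⊔ Z).Normal := by
      refine ⟨fun a ha g => ?_⟩
      have : g * a * g⁻¹ = ⁅g, a⁆ * a := by rw [commutatorElement_def]; group
      rw [this]
      exact mul_mem (mem_sup_right (hcomm (commutator_mem_commutator g.2 a.2))) ha
    -- The index of PZ in N is a power of p, because p-th powers are central, and divides the index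
    -- of P, which is prime to p.
    have htop : (P : Subgroup N) ⊔ Z = ⊤ := by
      rw [← Subgroup.index_eq_one]
      have hpg : IsPGroup p (N ⧸ ((P : Subgroup N) ⊔ Z)) := by
        intro q
        induction q using QuotientGroup.induction_on with
        | H a =>
          refine ⟨1, ?_⟩
          rw [← QuotientGroup.mk_pow, QuotientGroup.eq_one_iff, pow_one]
          exact mem_sup_right (show ((a ^ p : N) : G) ∈ center G from hpow a a.2)
      rcases hpg.card_eq_or_dvd with h | h
      · exact h
      · exact absurd (h.trans (Subgroup.index_dvd_of_le le_sup_left)) (Sylow.not_dvd_index P)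
    have hP : ∀ a ∈ (P : Subgroup N), ∀ b ∈ (P : Subgroup N), a * b = b * a := by
      intro a ha b hb
      have := h1.2 p hp ((P : Subgroup N).map (Subgroup.inclusion hNA)) (P.2.map _) _
        (mem_map_of_mem _ ha) _ (mem_map_of_mem _ hb)
      exact Subgroup.inclusion_injective hNA (by simpa using this)
    refine ⟨⟨fun a b => ?_⟩⟩
    have ha : a ∈ (P : Subgroup N) ⊔ Z := htop ▸ mem_top a
    have hb : b ∈ (P : Subgroup N) ⊔ Z := htop ▸ mem_top b
    obtain ⟨a, ha', z, hz, rfl⟩ := mem_sup_of_normal_right.1 ha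
    obtain ⟨b, hb', w, hw, rfl⟩ := mem_sup_of_normal_right.1 hb
    have hcen : ∀ z ∈ Z, ∀ x, Commute x z := fun z hz x =>
      Subtype.ext (mem_center_iff.1 (show (z : G) ∈ center G from hz) x)
    exact ((show Commute a b from hP a ha' b hb').mul_right (hcen w hw a)).mul_left
      (hcen z hz _).symm

theorem ABySup.classC : Contained ABySup.{u} ClassC := by
  intro G _ _ h H N _
  exact ((h.of_injective H.subtype H.subtype_injective).of_surjective (QuotientGroup.mk' N)
    (QuotientGroup.mk'_surjective N)).abelianOrNoncentral

/-! ### The class `X` is contained in `𝒞` -/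

lemma HasCentralPFactor_iff {p : ℕ} {B : Type u} [Group B] :
    HasCentralPFactor p B ↔ ∃ L K : Subgroup B, L.Normal ∧ K.Normal ∧ L < K ∧
      (∀ k ∈ K, ∃ n : ℕ, k ^ p ^ n ∈ L) ∧ ∀ k ∈ K, ∀ b : B, ⁅k, b⁆ ∈ L := by
  constructor
  · rintro ⟨L, K, hL, hK, hlt, h1, h2⟩
    refine ⟨L, K, hL, hK, hlt, fun k hk => ?_, fun k hk b => ?_⟩
    · obtain ⟨n, hn⟩ := h1 ⟨_, mem_map_of_mem (QuotientGroup.mk' L) hk⟩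
      refine ⟨n, (QuotientGroup.eq_one_iff _).1 ?_⟩
      simpa using congrArg Subtype.val hn
    · rw [← QuotientGroup.eq_one_iff]
      have := mem_center_iff.1 (h2 (mem_map_of_mem (QuotientGroup.mk' L) hk)) (b : B ⧸ L)
      exact commutatorElement_eq_one_iff_mul_comm.2 this.symm
  · rintro ⟨L, K, hL, hK, hlt, h1, h2⟩
    refine ⟨L, K, hL, hK, hlt, ?_, ?_⟩
    · rintro ⟨_, k, hk, rfl⟩
      obtain ⟨n, hn⟩ := h1 k hk
      refine ⟨n, Subtype.ext ?_⟩
      exact (QuotientGroup.eq_one_iff _).2 hn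
    · rintro _ ⟨k, hk, rfl⟩
      rw [mem_center_iff]
      intro q
      induction q using QuotientGroup.induction_on with
      | H b =>
        have := (QuotientGroup.eq_one_iff _).2 (h2 k hk b)
        exact (commutatorElement_eq_one_iff_mul_comm.1 this).symm

lemma HasCentralPFactor.of_surjective {p : ℕ} {B C : Type u} [Group B] [Group C]
    (h : HasCentralPFactor p C) (f : B →* C) (hf : Function.Surjective f) :
    HasCentralPFactor p B := by
  rw [HasCentralPFactor_iff] at h ⊢
  obtain ⟨L, K, hL, hK, hlt, h1, h2⟩ := h
  refine ⟨L.comap f, K.comap f, hL.comap f, hK.comap f, ?_, fun k hk => ?_, fun k hk b => ?_⟩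
  · exact (comap_lt_comap_of_surjective hf).2 hlt
  · obtain ⟨n, hn⟩ := h1 _ hk
    exact ⟨n, by simpa using hn⟩
  · have := h2 _ hk (f b)
    rwa [← map_commutatorElement] at this

lemma pResidual_normal (p : ℕ) (A : Type u) [Group A] [Finite A] : (pResidual p A).Normal :=
  (isLeast_pResidual p A).1.1

lemma exists_pow_mem_pResidual (p : ℕ) {A : Type u} [Group A] [Finite A] (a : A) :
    ∃ n : ℕ, a ^ p ^ n ∈ pResidual p A := by
  obtain ⟨hn, h⟩ := (isLeast_pResidual p A).1
  obtain ⟨n, hn⟩ := h (a : A ⧸ pResidual p A)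
  exact ⟨n, (QuotientGroup.eq_one_iff _).1 (by simpa using hn)⟩

lemma pResidual_le {p : ℕ} {A : Type u} [Group A] {N : Subgroup A} (hN : N.Normal)
    (h : ∀ a : A, ∃ n : ℕ, a ^ p ^ n ∈ N) : pResidual p A ≤ N := by
  refine sInf_le ⟨hN, fun q => ?_⟩
  induction q using QuotientGroup.induction_on with
  | H a =>
    obtain ⟨n, hn⟩ := h a
    exact ⟨n, (QuotientGroup.eq_one_iff _).2 hn⟩

lemma map_pResidual {p : ℕ} {A B : Type u} [Group A] [Finite A] [Group B] [Finite B] (f : A →* B)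
    (hf : Function.Surjective f) : (pResidual p A).map f = pResidual p B := by
  apply le_antisymm
  · rw [map_le_iff_le_comap]
    refine pResidual_le ((pResidual_normal p B).comap f) fun a => ?_
    obtain ⟨n, hn⟩ := exists_pow_mem_pResidual p (f a)
    exact ⟨n, by simpa using hn⟩
  · refine pResidual_le ((pResidual_normal p A).map f hf) fun b => ?_
    obtain ⟨a, rfl⟩ := hf b
    obtain ⟨n, hn⟩ := exists_pow_mem_pResidual p a
    exact ⟨n, by simpa using mem_map_of_mem f hn⟩

/-- A `p`-group of automorphisms of a nontrivial `p`-group has a nontrivial fixed point. -/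
lemma exists_fixed_of_isPGroup {p : ℕ} (hp : p.Prime) {N : Type u} [Group N] [Finite N]
    [Nontrivial N] (hN : IsPGroup p N) (Γ : Subgroup (MulAut N)) (hΓ : IsPGroup p Γ) :
    ∃ y : N, y ≠ 1 ∧ ∀ σ ∈ Γ, σ y = y := by
  have : Fact p.Prime := ⟨hp⟩
  have hd : p ∣ Nat.card N := by
    rcases hN.card_eq_or_dvd with h | h
    · exact absurd h Finite.one_lt_card.ne'
    · exact h
  have h1 : (1 : N) ∈ MulAction.fixedPoints Γ N := fun σ => map_one σ.1
  obtain ⟨y, hy, hy1⟩ := hΓ.exists_fixed_point_of_prime_dvd_card_of_fixed_point N hd h1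
  exact ⟨y, hy1.symm, fun σ hσ => hy ⟨σ, hσ⟩⟩

/-- The minimal noncentral N either lies in O^p(G), where a nontrivial [N, N] would be a central
p-factor and N is therefore abelian, or meets O^p(G) centrally, and then G acts on NZ(G)/Z(G) as a
p-group, with a nontrivial fixed point. -/
lemma abelianOrNoncentral_of_pResidual {G : Type u} [Group G] [Finite G]
    (hs : Group.IsSolvable G)
    (h : ∀ p : ℕ, p.Prime → p ∣ Nat.card G → ¬ HasCentralPFactor p (pResidual p G)) :
    AbelianOrNoncentral G := by
  by_cases hab : (⊤ : Subgroup G) ≤ center G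
  · exact Or.inl ⟨⟨fun a b => mem_center_iff.1 (hab (mem_top b)) a⟩⟩
  have hs' : Group.IsSolvable (⊤ : Subgroup G) := inferInstance
  obtain ⟨p, hp, N, hN, -, hNc, hmin, hcomm, hpow⟩ := exists_minimal_noncentral ⊤ hs' hab
  have : Fact p.Prime := ⟨hp⟩
  have hO := pResidual_normal p G
  by_cases hNO : N ≤ pResidual p G
  · refine Or.inr ⟨N, hN, ?_, hNc⟩
    -- Commutators of N are central, so [a, b]^p = [a^p, b], which is trivial because a^p is
    -- central.
    have hcp : ∀ x ∈ ⁅N, N⁆, x ^ p = 1 := by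
      intro x hx
      induction hx using Subgroup.closure_induction with
      | mem x hx =>
        obtain ⟨a, ha, b, hb, rfl⟩ := hx
        have h1 : ∀ n : ℕ, ⁅a, b⁆ ^ n = ⁅a ^ n, b⁆ := by
          intro n
          induction n with
          | zero => simp
          | succ n ih =>
            have hc := mem_center_iff.1 (hcomm (commutator_mem_commutator ha hb))
            rw [pow_succ, ih, pow_succ']
            have e : ⁅a * a ^ n, b⁆ = a * ⁅a ^ n, b⁆ * a⁻¹ * ⁅a, b⁆ := by
              simp only [commutatorElement_def]; group
            rw [e, ← ih, (mem_center_iff.1 (pow_mem (hcomm (commutator_mem_commutator ha hb)) n) a),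
              mul_inv_cancel_right]
        rw [h1]
        exact commutatorElement_eq_one_iff_mul_comm.2
          (mem_center_iff.1 (hpow a ha) b).symm
      | one => simp
      | mul x y hx hy ihx ihy =>
        have : Commute x y := mem_center_iff.1 (hcomm hy) x
        rw [this.mul_pow, ihx, ihy, one_mul]
      | inv x hx ih => simp [ih]
    have hbot : ⁅N, N⁆ = ⊥ := by
      by_contra hne
      obtain ⟨⟨c, hc⟩, hc1⟩ := ne_bot_iff_exists_ne_one.1 hne
      have hc1 : c ≠ 1 := fun h => hc1 (Subtype.ext h)
      refine h p hp ?_ (HasCentralPFactor_iff.2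
        ⟨⊥, ⁅N, N⁆.subgroupOf (pResidual p G), inferInstance, inferInstance, ?_, ?_, ?_⟩)
      · rw [← orderOf_eq_prime (hcp c hc) hc1]
        exact orderOf_dvd_natCard c
      · rw [bot_lt_iff_ne_bot, ne_bot_iff_exists_ne_one]
        exact ⟨⟨⟨c, hNO (commutator_le_left N N hc)⟩, hc⟩, fun h =>
          hc1 (congrArg Subtype.val (congrArg Subtype.val h))⟩
      · intro k hk
        refine ⟨1, ?_⟩
        rw [pow_one, mem_bot]
        exact Subtype.ext (hcp k hk)
      · intro k hk b
        rw [mem_bot]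
        exact commutatorElement_eq_one_iff_mul_comm.2
          (Subtype.ext (mem_center_iff.1 (hcomm hk) (b : G)).symm : k * b = b * k)
    refine ⟨⟨fun a b => Subtype.ext ?_⟩⟩
    have := commutator_mem_commutator a.2 b.2
    rw [hbot, mem_bot] at this
    exact commutatorElement_eq_one_iff_mul_comm.1 this
  · have hle : N ⊓ pResidual p G ≤ center G :=
      hmin _ inferInstance (lt_of_le_of_ne inf_le_left fun h => hNO (inf_eq_left.1 h))
    let M := N.map (QuotientGroup.mk' (center G))
    have hM : M.Normal := hN.map _ (QuotientGroup.mk'_surjective _)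
    let φ : G →* MulAut M := MulAut.conjNormal.comp (QuotientGroup.mk' (center G))
    have hMp : IsPGroup p M := by
      rintro ⟨_, a, ha, rfl⟩
      refine ⟨1, Subtype.ext ?_⟩
      rw [pow_one]
      exact (QuotientGroup.eq_one_iff _).2 (hpow a ha)
    have hMn : Nontrivial M := by
      rw [nontrivial_iff_ne_bot, Ne, Subgroup.map_eq_bot_iff, QuotientGroup.ker_mk']
      exact hNc
    -- [O^p(G), N] lies in N ∩ O^p(G), which is central, so O^p(G) acts trivially on M and only a
    -- p-group acts.
    have hφ : IsPGroup p φ.range := by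
      rintro ⟨_, g, rfl⟩
      obtain ⟨n, hn⟩ := exists_pow_mem_pResidual p g
      refine ⟨n, Subtype.ext ?_⟩
      change φ g ^ p ^ n = 1
      rw [← map_pow]
      generalize g ^ p ^ n = o at hn
      ext ⟨_, a, ha, rfl⟩
      change ((o : G ⧸ center G) * a * (o : G ⧸ center G)⁻¹) = (a : G ⧸ center G)
      have : ⁅o, a⁆ ∈ center G := hle (by
        rw [mem_inf]
        exact ⟨commutator_le_right ⊤ N (commutator_mem_commutator (mem_top o) ha),
          commutator_le_left (pResidual p G) ⊤ (commutator_mem_commutator hn (mem_top a))⟩)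
      rw [← QuotientGroup.eq_one_iff] at this
      rw [mul_inv_eq_iff_eq_mul]
      exact commutatorElement_eq_one_iff_mul_comm.1 this
    obtain ⟨⟨_, y, hyN, rfl⟩, hy1, hy⟩ := exists_fixed_of_isPGroup hp hMp φ.range hφ
    refine abelianOrNoncentral_of_conj (y := y)
      (fun h => hy1 (Subtype.ext ((QuotientGroup.eq_one_iff _).2 h))) fun g => ⟨1, ?_⟩
    have : (g : G ⧸ center G) * y * (g : G ⧸ center G)⁻¹ = y :=
      congrArg Subtype.val (hy (φ g) ⟨g, rfl⟩)
    rw [zpow_one, ← QuotientGroup.eq]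
    exact this.symm

/-- O^p(H/N) is the image of O^p(H), so a central p-factor of a section lifts to one forbidden by
membership in X. -/
theorem ClassX.classC : Contained ClassX.{u} ClassC := by
  intro G _ _ h H N _
  have := h.1
  refine abelianOrNoncentral_of_pResidual inferInstance fun p hp hd hf => ?_
  have hd' : p ∣ Nat.card G :=
    (hd.trans (Subgroup.card_quotient_dvd_card N)).trans (Subgroup.card_subgroup_dvd_card H)
  have hmap := map_pResidual (p := p) (QuotientGroup.mk' N) (QuotientGroup.mk'_surjective N)
  rw [← hmap] at hf
  exact h.2 p hp hd' H (hf.of_surjective ((QuotientGroup.mk' N).subgroupMap _)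
    ((QuotientGroup.mk' N).subgroupMap_surjective _))

end MonomialClasses

namespace MonomialClasses

open Module
open scoped DirectSum

/-! ### The formula for induced characters -/

open scoped Classical in
/-- The contribution `ψ(x⁻¹ g x)` of `x` to the value at `g` of the induced character. -/
noncomputable def inducedTerm {G : Type u} [Group G] (H : Subgroup G) (ψ : H →* ℂˣ) (g x : G) : ℂ :=
  if h : x⁻¹ * g * x ∈ H then ((ψ ⟨x⁻¹ * g * x, h⟩ : ℂˣ) : ℂ) else 0

lemma inducedTerm_mul {G : Type u} [Group G] (H : Subgroup G) (ψ : H →* ℂˣ) (g x : G) (h : H) :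
    inducedTerm H ψ g (x * h) = inducedTerm H ψ g x := by
  have e : (x * h : G)⁻¹ * g * (x * h) = (h : G)⁻¹ * (x⁻¹ * g * x) * h := by group
  unfold inducedTerm
  by_cases hx : x⁻¹ * g * x ∈ H
  · have hx' : (x * h : G)⁻¹ * g * (x * h) ∈ H := e ▸ H.mul_mem (H.mul_mem (H.inv_mem h.2) hx) h.2
    rw [dif_pos hx, dif_pos hx']
    have : (⟨_, hx'⟩ : H) = h⁻¹ * ⟨_, hx⟩ * h := Subtype.ext e
    rw [this, map_mul, map_mul, map_inv, mul_comm, mul_inv_cancel_left]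
  · have hx' : ¬ (x * h : G)⁻¹ * g * (x * h) ∈ H := by
      rw [e, Subgroup.mul_mem_cancel_right _ h.2, Subgroup.mul_mem_cancel_left _ (H.inv_mem h.2)]
      exact hx
    rw [dif_neg hx, dif_neg hx']

lemma inducedTerm_out {G : Type u} [Group G] (H : Subgroup G) (ψ : H →* ℂˣ) (g x : G) :
    inducedTerm H ψ g (x : G ⧸ H).out = inducedTerm H ψ g x := by
  obtain ⟨h, hh⟩ := QuotientGroup.mk_out_eq_mul H x
  rw [hh, inducedTerm_mul]

lemma inducedChar_eq_sum {G : Type u} [Group G] [Finite G] [Fintype G] (H : Subgroup G)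
    (ψ : H →* ℂˣ) (g : G) :
    inducedChar H ψ g = (Nat.card H : ℂ)⁻¹ * ∑ x : G, inducedTerm H ψ g x := by
  unfold inducedChar
  rw [finsum_eq_sum_of_fintype]
  rfl

lemma sum_eq_card_mul_sum_quotient {G : Type u} [Group G] [Fintype G] (H : Subgroup G)
    [Fintype (G ⧸ H)] (F : G → ℂ) (hF : ∀ (x : G) (h : H), F (x * h) = F x) :
    ∑ x : G, F x = (Nat.card H : ℂ) * ∑ q : G ⧸ H, F q.out := by
  classical
  have := Fintype.ofFinite H
  have hb : Function.Bijective fun p : (G ⧸ H) × H => p.1.out * (p.2 : G) := by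
    constructor
    · rintro ⟨q, h⟩ ⟨r, k⟩ he
      have he : q.out * (h : G) = r.out * k := he
      have hqr : q = r := by
        have := congrArg (QuotientGroup.mk (s := H)) he
        rwa [QuotientGroup.mk_mul_of_mem _ h.2, QuotientGroup.mk_mul_of_mem _ k.2,
          QuotientGroup.out_eq', QuotientGroup.out_eq'] at this
      subst hqr
      rw [mul_right_inj] at he
      rw [Subtype.ext he]
    · intro x
      obtain ⟨h, hh⟩ := QuotientGroup.mk_out_eq_mul H x
      exact ⟨((x : G ⧸ H), h⁻¹), by simp [hh]⟩
  rw [Finset.mul_sum, ← hb.sum_comp, Fintype.sum_prod_type]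
  refine Finset.sum_congr rfl fun q _ => ?_
  rw [Finset.sum_congr rfl fun h _ => hF q.out h, Finset.sum_const, Finset.card_univ,
    Nat.card_eq_fintype_card, nsmul_eq_mul]

lemma inducedChar_eq_sum_quotient {G : Type u} [Group G] [Finite G] (H : Subgroup G)
    [Fintype (G ⧸ H)] (ψ : H →* ℂˣ) (g : G) :
    inducedChar H ψ g = ∑ q : G ⧸ H, inducedTerm H ψ g q.out := by
  have := Fintype.ofFinite G
  rw [inducedChar_eq_sum, sum_eq_card_mul_sum_quotient H _ (inducedTerm_mul H ψ g),
    inv_mul_cancel_left₀]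
  exact_mod_cast Nat.card_pos.ne'

/-! ### Stabilizers of weight spaces -/

/-- X^n - 1 is separable, so an operator of finite order is semisimple. This lets the simultaneous
decomposition into generalized eigenspaces be read as one into weight spaces. -/
lemma maxGenEigenspace_eq_eigenspace_of_pow_eq_one {V : Type*} [AddCommGroup V] [Module ℂ V]
    [FiniteDimensional ℂ V] (f : End ℂ V) {n : ℕ} (hn : n ≠ 0) (hf : f ^ n = 1) (μ : ℂ) :
    f.maxGenEigenspace μ = f.eigenspace μ := by
  have hs : f.IsSemisimple := by
    refine Module.End.isSemisimple_of_squarefree_aeval_eq_zero (p := Polynomial.X ^ n - 1) ?_ ?_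
    · refine Polynomial.Separable.squarefree ?_
      rw [Polynomial.X_pow_sub_one_separable_iff]
      exact_mod_cast hn
    · simp [hf]
  exact hs.isFinitelySemisimple.maxGenEigenspace_eq_eigenspace μ

lemma sum_finrank_le_of_iSupIndep {ι V : Type*} [Fintype ι] [AddCommGroup V] [Module ℂ V]
    [FiniteDimensional ℂ V] {p : ι → Submodule ℂ V} (hp : iSupIndep p) :
    ∑ i, finrank ℂ (p i) ≤ finrank ℂ V := by
  classical
  rw [← finrank_directSum]
  exact LinearMap.finrank_le_finrank_of_injective (f := DFinsupp.lsum ℕ fun i => (p i).subtype)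
    hp.dfinsupp_lsum_injective

lemma rep_pow_card {H V : Type*} [Group H] [Finite H] [AddCommGroup V] [Module ℂ V]
    (σ : Representation ℂ H V) (h : H) : σ h ^ Nat.card H = 1 := by
  rw [← map_pow, pow_card_eq_one', map_one]

/-- If a normal subgroup `A` acts by commuting operators, not all scalar, then a weight space of
`A` and its stabilizer give a proper stable subspace whose translates are independent. -/
lemma exists_weight_space_stabilizer {H V : Type*} [Group H] [Finite H] [AddCommGroup V]
    [Module ℂ V] [FiniteDimensional ℂ V] (σ : Representation ℂ H V) (A : Subgroup H) [A.Normal]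
    (hcomm : ∀ a ∈ A, ∀ b ∈ A, Commute (σ a) (σ b))
    (hns : ∃ a ∈ A, ∀ c : ℂ, σ a ≠ algebraMap ℂ (End ℂ V) c) :
    ∃ (S : Subgroup H) (U : Submodule ℂ V), (∀ h, (∀ a ∈ A, Commute (σ h) (σ a)) → h ∈ S) ∧
      U ≠ ⊥ ∧ U ≠ ⊤ ∧ (∀ h ∈ S, ∀ u ∈ U, σ h u ∈ U) ∧ S.index * finrank ℂ U ≤ finrank ℂ V := by
  classical
  have hcard : Nat.card H ≠ 0 := Nat.card_pos.ne'
  -- Weights are arbitrary functions on A; that the occurring ones are multiplicative plays no role.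
  let E : (A → ℂ) → Submodule ℂ V := fun χ => ⨅ a : A, Module.End.eigenspace (σ a) (χ a)
  have hE : ∀ χ, E χ = ⨅ a : A, Module.End.maxGenEigenspace (σ a) (χ a) := fun χ =>
    iInf_congr fun a => (maxGenEigenspace_eq_eigenspace_of_pow_eq_one _ hcard
      (rep_pow_card σ (a : H)) _).symm
  have hmem : ∀ χ u, u ∈ E χ ↔ ∀ a : A, σ a u = χ a • u := by
    intro χ u
    simp only [E, Submodule.mem_iInf, Module.End.mem_eigenspace_iff]
  have hind : iSupIndep E := by
    have := Module.End.independent_iInf_maxGenEigenspace_of_forall_mapsTo (fun a : A => σ a)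
      fun a b φ => Module.End.mapsTo_maxGenEigenspace_of_comm (hcomm b b.2 a a.2) φ
    rwa [← funext hE] at this
  have htop : ⨆ χ, E χ = ⊤ := by
    have := Module.End.iSup_iInf_maxGenEigenspace_eq_top_of_iSup_maxGenEigenspace_eq_top_of_commute
      (fun a : A => σ a) (fun a b _ => hcomm a a.2 b b.2)
      (fun a => Module.End.iSup_maxGenEigenspace_eq_top _)
    rwa [← iSup_congr hE] at this
  obtain ⟨a₀, ha₀, hns⟩ := hns
  have hnt : Nontrivial V := by
    by_contra hc
    rw [not_nontrivial_iff_subsingleton] at hc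
    exact hns 0 (LinearMap.ext fun v => Subsingleton.elim _ _)
  obtain ⟨χ, hχ⟩ : ∃ χ, E χ ≠ ⊥ := by
    by_contra! hc
    rw [iSup_congr hc, iSup_bot] at htop
    exact bot_ne_top htop
  obtain ⟨u₀, hu₀, hu₀'⟩ := Submodule.exists_mem_ne_zero_of_ne_bot hχ
  -- The conjugation action of H on weights; σ h carries the weight space of χ into that of the
  -- twisted weight, and S will be the stabilizer of χ.
  let tw : H → (A → ℂ) → A → ℂ := fun h χ a => χ (MulAut.conjNormal h⁻¹ a)
  have hval : ∀ (h : H) (a : A), ((MulAut.conjNormal h⁻¹ a : A) : H) = h⁻¹ * a * h := by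
    intro h a; simp
  have htw1 : ∀ χ, tw 1 χ = χ := fun χ => by
    funext a
    exact congrArg χ (Subtype.ext (by simp))
  have htwm : ∀ h k χ, tw (h * k) χ = tw h (tw k χ) := fun h k χ => by
    funext a
    exact congrArg χ (Subtype.ext (by simp [mul_assoc]))
  have hmap : ∀ (h : H) (χ : A → ℂ) (u : V), u ∈ E χ → σ h u ∈ E (tw h χ) := by
    intro h χ u hu
    rw [hmem] at hu ⊢
    intro a
    have h1 := congrArg (σ h) (hu (MulAut.conjNormal h⁻¹ a))
    rw [map_smul, hval, ← Module.End.mul_apply, ← map_mul] at h1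
    refine Eq.trans ?_ h1
    rw [← Module.End.mul_apply, ← map_mul]
    congr 2
    group
  let S : Subgroup H :=
    { carrier := {h | tw h χ = χ}
      one_mem' := htw1 χ
      mul_mem' := fun {a b} ha hb => by
        change tw (a * b) χ = χ
        rw [htwm, show tw b χ = χ from hb, show tw a χ = χ from ha]
      inv_mem' := fun {a} ha => by
        change tw a⁻¹ χ = χ
        conv_lhs => rw [← show tw a χ = χ from ha]
        rw [← htwm, inv_mul_cancel, htw1] }
  refine ⟨S, E χ, fun h hh => ?_, hχ, fun ht => ?_, fun h hh u hu => ?_, ?_⟩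
  -- If σ h commutes with the operators of A, then a and its conjugate by h act equally, and
  -- comparing eigenvalues on the nonzero vector u₀ shows that h fixes χ.
  · change tw h χ = χ
    funext a
    have h1 := (hmem χ u₀).1 hu₀ a
    have h2 := (hmem χ u₀).1 hu₀ (MulAut.conjNormal h⁻¹ a)
    have h3 : σ (h⁻¹ * a * h) = σ a := by
      rw [map_mul, map_mul, mul_assoc, ← (hh a a.2).eq, ← mul_assoc, ← map_mul, inv_mul_cancel,
        map_one, one_mul]
    rw [hval, h3, h1] at h2
    exact (smul_left_injective ℂ hu₀' h2).symm
  · refine hns (χ ⟨a₀, ha₀⟩) (LinearMap.ext fun v => ?_)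
    have := (hmem χ v).1 (ht ▸ Submodule.mem_top) ⟨a₀, ha₀⟩
    simpa [Module.algebraMap_end_apply] using this
  · have := hmap h χ u hu
    rwa [show tw h χ = χ from hh] at this
  · have := Fintype.ofFinite (H ⧸ S)
    -- Distinct cosets of S give distinct weights, so there are |H : S| independent weight spaces,
    -- each of dimension at least that of E χ.
    have hinj : Function.Injective fun q : H ⧸ S => tw q.out χ := by
      intro q r hqr
      rw [← q.out_eq', ← r.out_eq']
      refine QuotientGroup.eq.2 ?_
      change tw _ χ = χ
      have : tw q.out χ = tw r.out χ := hqr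
      rw [htwm, ← this, ← htwm, inv_mul_cancel, htw1]
    refine le_trans ?_ (sum_finrank_le_of_iSupIndep (hind.comp hinj))
    rw [Subgroup.index_eq_card, Nat.card_eq_fintype_card, ← smul_eq_mul, ← Finset.card_univ,
      ← Finset.sum_const]
    refine Finset.sum_le_sum fun q _ => ?_
    have hi : Function.Injective (σ q.out) := by
      refine Function.LeftInverse.injective (g := σ q.out⁻¹) fun v => ?_
      rw [← Module.End.mul_apply, ← map_mul, inv_mul_cancel, map_one, Module.End.one_apply]
    rw [(Submodule.equivMapOfInjective _ hi (E χ)).finrank_eq]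
    exact Submodule.finrank_mono (Submodule.map_le_iff_le_comap.2 fun u hu => hmap _ _ _ hu)

end MonomialClasses

namespace MonomialClasses

open Module
open scoped DirectSum

/-! ### `Ab-by-Nil` groups are subnormally monomial -/

lemma eq_bot_or_eq_top_of_isIrreducible {G V : Type*} [Group G] [AddCommGroup V] [Module ℂ V]
    {ρ : Representation ℂ G V} (hρ : ρ.IsIrreducible) (U : Submodule ℂ V)
    (hU : ∀ g, ∀ u ∈ U, ρ g u ∈ U) : U = ⊥ ∨ U = ⊤ := by
  rcases hρ.eq_bot_or_eq_top ⟨U, fun g u hu => hU g u hu⟩ with h | h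
  · exact Or.inl (congrArg Subrepresentation.toSubmodule h)
  · exact Or.inr (congrArg Subrepresentation.toSubmodule h)

lemma nontrivial_of_isIrreducible {G V : Type*} [Group G] [AddCommGroup V] [Module ℂ V]
    {ρ : Representation ℂ G V} (hρ : ρ.IsIrreducible) : Nontrivial V := by
  by_contra hc
  rw [not_nontrivial_iff_subsingleton] at hc
  obtain ⟨a, b, hab⟩ := hρ.toNontrivial
  exact hab (Subrepresentation.toSubmodule_injective (Subsingleton.elim _ _))

/-- The restriction of a representation to a subgroup and a stable subspace. -/
def restrictRep {G V : Type*} [Group G] [AddCommGroup V] [Module ℂ V]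
    (ρ : Representation ℂ G V) (H : Subgroup G) (U : Submodule ℂ V)
    (hU : ∀ h ∈ H, ∀ u ∈ U, ρ h u ∈ U) : Representation ℂ H U where
  toFun h := (ρ h).restrict (hU h h.2)
  map_one' := by ext; simp
  map_mul' a b := by ext; simp

lemma restrictRep_apply {G V : Type*} [Group G] [AddCommGroup V] [Module ℂ V]
    (ρ : Representation ℂ G V) (H : Subgroup G) (U : Submodule ℂ V)
    (hU : ∀ h ∈ H, ∀ u ∈ U, ρ h u ∈ U) (h : H) (u : U) :
    (restrictRep ρ H U hU h u : V) = ρ h u := rfl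

lemma isNilpotent_quotient_of_le {G : Type*} [Group G] (A : Subgroup G) [A.Normal]
    (hn : Group.IsNilpotent (G ⧸ A)) (H : Subgroup G) (Z : Subgroup H) [Z.Normal]
    (hZ : A.subgroupOf H ≤ Z) : Group.IsNilpotent (H ⧸ Z) := by
  let f : H ⧸ A.subgroupOf H →* G ⧸ A := QuotientGroup.map _ _ H.subtype le_rfl
  have hf : f.ker = ⊥ := by
    refine (Subgroup.eq_bot_iff_forall _).2 fun q hq => ?_
    induction q using QuotientGroup.induction_on with
    | H x => exact (QuotientGroup.eq_one_iff x).2 ((QuotientGroup.eq_one_iff (x : G)).1 hq)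
  have : Group.IsNilpotent (H ⧸ A.subgroupOf H) :=
    Subgroup.isNilpotent_of_ker_le_center f (hf ▸ bot_le)
  exact Group.nilpotent_of_surjective (QuotientGroup.map _ Z (MonoidHom.id H) hZ)
    (QuotientGroup.map_surjective_of_surjective (A.subgroupOf H) Z (MonoidHom.id H)
      (QuotientGroup.mk'_surjective _) hZ)

/-- A representation of dimension at least two without proper stable subspaces has a normal
subgroup acting by commuting operators which are not all scalar, provided that the group is
abelian-by-nilpotent; moreover the abelian normal subgroup commutes with these operators. -/
lemma exists_normal_commuting_nonscalar {H V : Type*} [Group H] [AddCommGroup V]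
    [Module ℂ V] (σ : Representation ℂ H V) (A : Subgroup H) [A.Normal]
    (hA : ∀ a ∈ A, ∀ b ∈ A, a * b = b * a)
    (hn : ∀ (Z : Subgroup H) [Z.Normal], A ≤ Z → Group.IsNilpotent (H ⧸ Z))
    (hns : ∃ h, ∀ c : ℂ, σ h ≠ algebraMap ℂ (End ℂ V) c) :
    ∃ B : Subgroup H, B.Normal ∧ (∀ a ∈ B, ∀ b ∈ B, Commute (σ a) (σ b)) ∧
      (∃ a ∈ B, ∀ c : ℂ, σ a ≠ algebraMap ℂ (End ℂ V) c) ∧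
      ∀ a ∈ A, ∀ b ∈ B, Commute (σ a) (σ b) := by
  have hAc : ∀ a ∈ A, ∀ b ∈ A, Commute (σ a) (σ b) := fun a ha b hb => by
    rw [Commute, SemiconjBy, ← map_mul, hA a ha b hb, map_mul]
  by_cases hsc : ∃ a ∈ A, ∀ c : ℂ, σ a ≠ algebraMap ℂ (End ℂ V) c
  · exact ⟨A, inferInstance, hAc, hsc, hAc⟩
  push Not at hsc
  -- Here A acts by scalars. Z collects all elements acting by scalars; H/Z is nilpotent, and the
  -- preimage of the subgroup generated by a nontrivial central element of it is the required B.
  let Z : Subgroup H :=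
    { carrier := {h | ∃ c : ℂ, σ h = algebraMap ℂ (End ℂ V) c}
      one_mem' := ⟨1, by simp⟩
      mul_mem' := by
        rintro a b ⟨c, hc⟩ ⟨d, hd⟩
        exact ⟨c * d, by rw [map_mul, hc, hd, map_mul]⟩
      inv_mem' := by
        rintro a ⟨c, hc⟩
        have h1 : σ a⁻¹ * σ a = 1 := by rw [← map_mul, inv_mul_cancel, map_one]
        rcases eq_or_ne c 0 with rfl | h0
        -- A zero scalar makes 0 = 1 among the operators, so this degenerate case is harmless.
        · rw [hc, map_zero, mul_zero] at h1
          refine ⟨0, ?_⟩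
          rw [← mul_one (σ a⁻¹), ← h1, mul_zero, map_zero]
        · refine ⟨c⁻¹, ?_⟩
          rw [hc] at h1
          rw [← mul_one (σ a⁻¹), ← map_one (algebraMap ℂ (End ℂ V)), ← mul_inv_cancel₀ h0, map_mul,
            ← mul_assoc, h1, one_mul] }
  have hZc : ∀ z ∈ Z, ∀ h, Commute (σ z) (σ h) := by
    rintro z ⟨c, hc⟩ h
    rw [hc]
    exact Algebra.commutes c _
  have hZ : Z.Normal := ⟨fun z hz g => by
    obtain ⟨c, hc⟩ := hz
    refine ⟨c, ?_⟩
    rw [map_mul, map_mul, hc, ← Algebra.commutes, mul_assoc, ← map_mul, mul_inv_cancel, map_one,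
      mul_one]⟩
  have hAZ : A ≤ Z := fun a ha => hsc a ha
  have hnil := hn Z hAZ
  have hnt : Nontrivial (H ⧸ Z) := by
    rw [QuotientGroup.nontrivial_iff]
    intro ht
    obtain ⟨h, hh⟩ := hns
    obtain ⟨c, hc⟩ : h ∈ Z := ht ▸ Subgroup.mem_top h
    exact hh c hc
  obtain ⟨⟨q, hqc⟩, hq1⟩ := Subgroup.ne_bot_iff_exists_ne_one.1
    (Group.IsNilpotent.center_ne_bot (G := H ⧸ Z))
  obtain ⟨y, rfl⟩ := QuotientGroup.mk_surjective q
  have hy : y ∉ Z := fun h => hq1 (Subtype.ext ((QuotientGroup.eq_one_iff y).2 h))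
  have hB : (Subgroup.zpowers (y : H ⧸ Z)).Normal := ⟨by
    rintro _ ⟨k, rfl⟩ g
    have := Subgroup.mem_center_iff.1 (zpow_mem hqc k) g
    simp only [this, mul_inv_cancel_right]
    exact Subgroup.zpow_mem_zpowers _ k⟩
  have hform : ∀ b ∈ (Subgroup.zpowers (y : H ⧸ Z)).comap (QuotientGroup.mk' Z),
      ∃ k : ℤ, ∃ z ∈ Z, b = y ^ k * z := by
    rintro b ⟨k, hk⟩
    refine ⟨k, (y ^ k)⁻¹ * b, QuotientGroup.eq.1 ?_, by group⟩
    simpa using hk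
  refine ⟨(Subgroup.zpowers (y : H ⧸ Z)).comap (QuotientGroup.mk' Z), hB.comap _, ?_, ?_, ?_⟩
  · intro a ha b hb
    obtain ⟨k, z, hz, rfl⟩ := hform a ha
    obtain ⟨l, w, hw, rfl⟩ := hform b hb
    rw [map_mul]
    refine Commute.mul_left ?_ (hZc z hz _)
    rw [map_mul]
    refine Commute.mul_right ?_ (hZc w hw _).symm
    rw [Commute, SemiconjBy, ← map_mul, ← map_mul, ← zpow_add, ← zpow_add, add_comm]
  · exact ⟨y, Subgroup.mem_zpowers (y : H ⧸ Z), fun c hc => hy ⟨c, hc⟩⟩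
  · exact fun a ha b _ => hZc a (hAZ ha) _

/-- Choose (H, U) with A ≤ H, U stable and |G : H| dim U ≤ dim V, minimizing dim U. Minimality makes
U irreducible. If H acted with a nonscalar operator, a proper weight space and its stabilizer would
be a smaller pair; the stabilizer still contains A because A commutes with the operators used. So H
acts by scalars and dim U = 1. -/
theorem exists_eigenvector_of_abByNil {G V : Type*} [Group G] [Finite G] [AddCommGroup V]
    [Module ℂ V] [FiniteDimensional ℂ V] {ρ : Representation ℂ G V} (hρ : ρ.IsIrreducible)
    (A : Subgroup G) [A.Normal] (hA : ∀ a ∈ A, ∀ b ∈ A, a * b = b * a)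
    (hn : Group.IsNilpotent (G ⧸ A)) :
    ∃ (H : Subgroup G) (v : V), A ≤ H ∧ v ≠ 0 ∧ (∀ h ∈ H, ∃ c : ℂ, ρ h v = c • v) ∧
      H.index ≤ finrank ℂ V := by
  classical
  let good : ℕ → Prop := fun d => ∃ (H : Subgroup G) (U : Submodule ℂ V), A ≤ H ∧ U ≠ ⊥ ∧
    (∀ h ∈ H, ∀ u ∈ U, ρ h u ∈ U) ∧ H.index * finrank ℂ U ≤ finrank ℂ V ∧ finrank ℂ U = d
  have hV := nontrivial_of_isIrreducible hρ
  have hex : ∃ d, good d := ⟨_, ⊤, ⊤, le_top, top_ne_bot, fun _ _ _ _ => Submodule.mem_top,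
    by simp, rfl⟩
  obtain ⟨H, U, hAH, hU0, hU, hle, hd⟩ := Nat.find_spec hex
  have hmin : ∀ (H' : Subgroup G) (U' : Submodule ℂ V), A ≤ H' → U' ≠ ⊥ →
      (∀ h ∈ H', ∀ u ∈ U', ρ h u ∈ U') → H'.index * finrank ℂ U' ≤ finrank ℂ V →
      finrank ℂ U ≤ finrank ℂ U' := by
    intro H' U' h1 h2 h3 h4
    rw [hd]
    exact Nat.find_min' hex ⟨H', U', h1, h2, h3, h4, rfl⟩
  have hirr : ∀ U' ≤ U, U' ≠ ⊥ → (∀ h ∈ H, ∀ u ∈ U', ρ h u ∈ U') → U' = U := by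
    intro U' hle' h0 hs
    refine Submodule.eq_of_le_of_finrank_le hle' (hmin H U' hAH h0 hs (le_trans ?_ hle))
    exact Nat.mul_le_mul_left _ (Submodule.finrank_mono hle')
  let σ := restrictRep ρ H U hU
  by_cases hns : ∃ h, ∀ c : ℂ, σ h ≠ algebraMap ℂ (End ℂ U) c
  · exfalso
    obtain ⟨B, hB, hBc, hBns, hBA⟩ := exists_normal_commuting_nonscalar σ (A.subgroupOf H)
      (fun a ha b hb => Subtype.ext (hA a ha b hb))
      (fun Z _ hZ => isNilpotent_quotient_of_le A hn H Z hZ) hns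
    obtain ⟨S, W, hS, hW0, hW1, hSW, hind⟩ := exists_weight_space_stabilizer σ B hBc hBns
    have hWlt : finrank ℂ W < finrank ℂ U := Submodule.finrank_lt hW1
    have hfr : finrank ℂ (W.map U.subtype) = finrank ℂ W :=
      (Submodule.equivMapOfInjective _ U.subtype_injective W).finrank_eq.symm
    refine hWlt.not_ge (hfr ▸ hmin (S.map H.subtype) (W.map U.subtype) ?_ ?_ ?_ ?_)
    · intro a ha
      exact ⟨⟨a, hAH ha⟩, hS _ (hBA ⟨a, hAH ha⟩ ha), rfl⟩
    · intro h0
      rw [h0, finrank_bot] at hfr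
      exact hW0 (Submodule.finrank_eq_zero.1 hfr.symm)
    · rintro _ ⟨s, hs, rfl⟩ _ ⟨w, hw, rfl⟩
      exact ⟨σ s w, hSW s hs w hw, rfl⟩
    · rw [Subgroup.index_map_subtype, hfr]
      calc S.index * H.index * finrank ℂ W = H.index * (S.index * finrank ℂ W) := by ring
        _ ≤ H.index * finrank ℂ U := Nat.mul_le_mul_left _ hind
        _ ≤ _ := hle
  · push Not at hns
    obtain ⟨v, hv, hv0⟩ := Submodule.exists_mem_ne_zero_of_ne_bot hU0
    have hsc : ∀ h ∈ H, ∃ c : ℂ, ρ h v = c • v := by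
      intro h hh
      obtain ⟨c, hc⟩ := hns ⟨h, hh⟩
      have := congrArg Subtype.val (LinearMap.congr_fun hc ⟨v, hv⟩)
      exact ⟨c, by simpa [Module.algebraMap_end_apply, σ, restrictRep_apply] using this⟩
    have hspan : ℂ ∙ v = U := by
      refine hirr _ ((Submodule.span_singleton_le_iff_mem _ _).2 hv)
        (by simpa [Submodule.span_singleton_eq_bot] using hv0) fun h hh u hu => ?_
      obtain ⟨c, hc⟩ := hsc h hh
      obtain ⟨d, rfl⟩ := Submodule.mem_span_singleton.1 hu
      rw [map_smul, hc]
      exact Submodule.smul_mem _ _ (Submodule.smul_mem _ _ (Submodule.mem_span_singleton_self v))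
    have h1 : finrank ℂ U = 1 := by rw [← hspan, finrank_span_singleton hv0]
    refine ⟨H, v, hAH, hv0, hsc, ?_⟩
    rwa [h1, mul_one] at hle

/-- The character of an irreducible representation with an eigenvector of a subgroup whose index
is at most the dimension is induced. -/
theorem character_eq_inducedChar {G : Type u} {V : Type*} [Group G] [Finite G] [AddCommGroup V]
    [Module ℂ V] [FiniteDimensional ℂ V] {ρ : Representation ℂ G V} (hρ : ρ.IsIrreducible)
    (H : Subgroup G) (v : V) (hv : v ≠ 0) (hH : ∀ h ∈ H, ∃ c : ℂ, ρ h v = c • v)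
    (hle : H.index ≤ finrank ℂ V) :
    ∃ ψ : H →* ℂˣ, ρ.character = inducedChar H ψ := by
  classical
  have := Fintype.ofFinite (G ⧸ H)
  choose c hc using fun h : H => hH h h.2
  have hc1 : c 1 = 1 := by
    have := hc 1
    rw [Subgroup.coe_one, map_one, Module.End.one_apply] at this
    exact (smul_left_injective ℂ hv (by simpa using this)).symm
  have hcm : ∀ a b, c (a * b) = c a * c b := by
    intro a b
    apply smul_left_injective ℂ hv
    change c (a * b) • v = (c a * c b) • v
    rw [← hc, Subgroup.coe_mul, map_mul, Module.End.mul_apply, hc b, map_smul, hc a, smul_smul,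
      mul_comm]
  let ψ : H →* ℂˣ := (⟨⟨c, hc1⟩, hcm⟩ : H →* ℂ).toHomUnits
  have hψ : ∀ h : H, ((ψ h : ℂˣ) : ℂ) = c h := fun h => rfl
  refine ⟨ψ, ?_⟩
  -- The translates of v span by irreducibility, and there are at most dim V of them, so they form a
  -- basis permuted by G up to scalars; the trace in it is the formula for the induced character.
  let b : G ⧸ H → V := fun q => ρ q.out v
  have hb : ∀ x : G, ∃ d : ℂ, ρ x v = d • b x := by
    intro x
    obtain ⟨h, hh⟩ := QuotientGroup.mk_out_eq_mul H x
    refine ⟨(c h)⁻¹, ?_⟩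
    have hch : c h ≠ 0 := by rw [← hψ]; exact Units.ne_zero _
    change _ = _ • ρ (x : G ⧸ H).out v
    rw [hh, map_mul, Module.End.mul_apply, hc, map_smul, inv_smul_smul₀ hch]
  have hspan : ⊤ ≤ Submodule.span ℂ (Set.range b) := by
    have hs : ∀ g, ∀ u ∈ Submodule.span ℂ (Set.range b), ρ g u ∈ Submodule.span ℂ (Set.range b) := by
      intro g u hu
      induction hu using Submodule.span_induction with
      | mem u hu =>
        obtain ⟨q, rfl⟩ := hu
        obtain ⟨d, hd⟩ := hb (g * q.out)
        change ρ g (ρ q.out v) ∈ _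
        rw [← Module.End.mul_apply, ← map_mul, hd]
        exact Submodule.smul_mem _ _ (Submodule.subset_span ⟨_, rfl⟩)
      | zero => simp
      | add x y _ _ hx hy => rw [map_add]; exact Submodule.add_mem _ hx hy
      | smul a x _ hx => rw [map_smul]; exact Submodule.smul_mem _ _ hx
    rcases eq_bot_or_eq_top_of_isIrreducible hρ _ hs with h | h
    · exfalso
      obtain ⟨d, hd⟩ := hb 1
      rw [map_one, Module.End.one_apply] at hd
      refine hv (hd.trans ?_)
      have : b (1 : G) ∈ Submodule.span ℂ (Set.range b) := Submodule.subset_span ⟨_, rfl⟩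
      rw [h, Submodule.mem_bot] at this
      rw [this, smul_zero]
    · exact h.ge
  have hcard : Fintype.card (G ⧸ H) = finrank ℂ V := by
    refine le_antisymm ?_ ?_
    · rwa [← Nat.card_eq_fintype_card, ← Subgroup.index_eq_card]
    · have := finrank_range_le_card (R := ℂ) b
      rwa [Set.finrank, eq_top_iff.2 hspan, finrank_top] at this
  let B := basisOfTopLeSpanOfCardEqFinrank b hspan hcard
  have hB : ∀ q, B q = b q := fun q => by simp [B]
  funext g
  rw [inducedChar_eq_sum_quotient, Representation.character,
    LinearMap.trace_eq_matrix_trace ℂ B, Matrix.trace]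
  refine Finset.sum_congr rfl fun q _ => ?_
  rw [Matrix.diag_apply, LinearMap.toMatrix_apply, hB]
  unfold inducedTerm
  have hbq : ρ g (b q) = ρ (g * q.out) v := by
    rw [map_mul, Module.End.mul_apply]
  split_ifs with h
  · have : ρ g (b q) = ψ ⟨_, h⟩ • B q := by
      rw [hbq, hB]
      have e : g * q.out = q.out * (q.out⁻¹ * g * q.out) := by group
      rw [e, map_mul, Module.End.mul_apply, hc ⟨_, h⟩, map_smul, Units.smul_def, hψ]
    rw [this, Units.smul_def, map_smul, B.repr_self]
    simp
  · obtain ⟨d, hd⟩ := hb (g * q.out)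
    rw [hbq, hd, ← hB, map_smul, B.repr_self, Finsupp.smul_apply, Finsupp.single_apply, if_neg,
      smul_zero]
    intro he
    refine h ?_
    have : ((g * q.out : G) : G ⧸ H) = (q.out : G) := by rw [he, QuotientGroup.out_eq']
    rw [eq_comm, QuotientGroup.eq, ← mul_assoc] at this
    exact this

/-- In a nilpotent group normalizers strictly grow, so climbing through them reaches the whole
group. -/
lemma isSubnormal_of_isNilpotent {G : Type*} [Group G] [Finite G] (hn : Group.IsNilpotent G)
    (H : Subgroup G) : H.IsSubnormal := by
  induction H using WellFoundedGT.induction with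
  | ind H ih =>
    rcases eq_or_ne H ⊤ with rfl | hH
    · exact .top
    · have hlt := Group.normalizerCondition_of_isNilpotent H hH.lt_top
      exact .step H _ hlt.le (ih _ hlt)
        ((Subgroup.normal_subgroupOf_iff_le_normalizer hlt.le).2 le_rfl)

theorem AbByNil.subnormallyMonomial : Contained AbByNil.{u} SubnormallyMonomial := by
  rintro G _ _ ⟨A, hA, hab, hn⟩ χ ⟨n, ρ, hρ, rfl⟩
  obtain ⟨H, v, hAH, hv, hH, hle⟩ := exists_eigenvector_of_abByNil hρ A
    (fun a ha b hb => congrArg Subtype.val (hab.is_comm.comm ⟨a, ha⟩ ⟨b, hb⟩)) hn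
  obtain ⟨ψ, hψ⟩ := character_eq_inducedChar hρ H v hv hH hle
  refine ⟨H, ψ, ?_, hψ⟩
  have := (isSubnormal_of_isNilpotent hn (H.map (QuotientGroup.mk' A))).comap (QuotientGroup.mk' A)
  rwa [Subgroup.comap_map_eq_self (by rwa [QuotientGroup.ker_mk'])] at this

theorem NormallyMonomial.subnormallyMonomial :
    Contained NormallyMonomial.{u} SubnormallyMonomial := by
  intro G _ _ h χ hχ
  obtain ⟨H, ψ, hH, hψ⟩ := h χ hχ
  exact ⟨H, ψ, hH.isSubnormal, hψ⟩

end MonomialClasses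

namespace MonomialClasses

open Module
open scoped MonoidAlgebra commutatorElement

/-! ### Decomposition of representations -/

section

variable {G V : Type*} [Group G] [AddCommGroup V] [Module ℂ V]

/-- The representation on a stable subspace. -/
def subRep (ρ : Representation ℂ G V) (U : Submodule ℂ V) (hU : ∀ g, ∀ u ∈ U, ρ g u ∈ U) :
    Representation ℂ G U where
  toFun g := (ρ g).restrict (hU g)
  map_one' := by ext; simp
  map_mul' a b := by ext; simp

/-- Maschke's theorem, transported from submodules over the group algebra. -/
lemma exists_stable_isCompl [Finite G] (ρ : Representation ℂ G V) (U : Submodule ℂ V)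
    (hU : ∀ g, ∀ u ∈ U, ρ g u ∈ U) :
    ∃ W : Submodule ℂ V, (∀ g, ∀ u ∈ W, ρ g u ∈ W) ∧ IsCompl U W := by
  have : NeZero (Nat.card G : ℂ) := ⟨by exact_mod_cast Nat.card_pos.ne'⟩
  have : ComplementedLattice (Subrepresentation ρ) :=
    (OrderIso.complementedLattice_iff Subrepresentation.subrepresentationSubmoduleOrderIso).2
      (inferInstance : ComplementedLattice (Submodule ℂ[G] ρ.asModule))
  obtain ⟨W, hW⟩ := exists_isCompl (⟨U, fun g u hu => hU g u hu⟩ : Subrepresentation ρ)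
  refine ⟨W.toSubmodule, fun g u hu => W.apply_mem_toSubmodule g hu, ?_⟩
  rw [isCompl_iff, disjoint_iff, codisjoint_iff] at hW ⊢
  exact ⟨congrArg Subrepresentation.toSubmodule hW.1,
    congrArg Subrepresentation.toSubmodule hW.2⟩

lemma isIrreducible_subRep {ρ : Representation ℂ G V} {U : Submodule ℂ V}
    {hU : ∀ g, ∀ u ∈ U, ρ g u ∈ U} (h0 : U ≠ ⊥)
    (hmin : ∀ W ≤ U, W ≠ ⊥ → (∀ g, ∀ u ∈ W, ρ g u ∈ W) → W = U) :
    (subRep ρ U hU).IsIrreducible := by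
  have hnt : Nontrivial U := (Submodule.nontrivial_iff_ne_bot).2 h0
  refine { exists_pair_ne := ⟨⊥, ⊤, fun h => ?_⟩, eq_bot_or_eq_top := fun W => ?_ }
  · exact bot_ne_top (α := Submodule ℂ U) (congrArg Subrepresentation.toSubmodule h)
  · by_cases hW : W.toSubmodule = ⊥
    · exact Or.inl (Subrepresentation.toSubmodule_injective hW)
    · refine Or.inr (Subrepresentation.toSubmodule_injective ?_)
      have h1 : W.toSubmodule.map U.subtype = U := by
        refine hmin _ (Submodule.map_subtype_le U _) (fun h => hW ?_) ?_
        · rw [eq_bot_iff]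
          intro w hw
          have : (w : V) ∈ W.toSubmodule.map U.subtype := Submodule.mem_map_of_mem hw
          rw [h, Submodule.mem_bot] at this
          exact Subtype.ext this
        · rintro g _ ⟨w, hw, rfl⟩
          exact ⟨subRep ρ U hU g w, W.apply_mem_toSubmodule g hw, rfl⟩
      change W.toSubmodule = ⊤
      rw [eq_top_iff]
      intro w _
      have : (w : V) ∈ W.toSubmodule.map U.subtype := h1.symm ▸ w.2
      obtain ⟨w', hw', he⟩ := this
      rwa [← Subtype.ext he]

/-- A property of stable subspaces which holds for the irreducible ones and for direct sums holds
for all. -/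
lemma stable_induction [Finite G] [FiniteDimensional ℂ V] (ρ : Representation ℂ G V)
    (p : Submodule ℂ V → Prop) (hbot : p ⊥)
    (hirr : ∀ (U : Submodule ℂ V) (hU : ∀ g, ∀ u ∈ U, ρ g u ∈ U),
      (subRep ρ U hU).IsIrreducible → p U)
    (hsup : ∀ U W : Submodule ℂ V, (∀ g, ∀ u ∈ U, ρ g u ∈ U) → (∀ g, ∀ u ∈ W, ρ g u ∈ W) →
      Disjoint U W → p U → p W → p (U ⊔ W)) (U : Submodule ℂ V)
    (hU : ∀ g, ∀ u ∈ U, ρ g u ∈ U) : p U := by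
  induction hd : finrank ℂ U using Nat.strong_induction_on generalizing U with
  | _ d ih =>
    subst hd
    rcases eq_or_ne U ⊥ with rfl | h0
    · exact hbot
    by_cases hmin : ∀ W ≤ U, W ≠ ⊥ → (∀ g, ∀ u ∈ W, ρ g u ∈ W) → W = U
    · exact hirr U hU (isIrreducible_subRep h0 hmin)
    push Not at hmin
    obtain ⟨W, hWU, hW0, hW, hne⟩ := hmin
    obtain ⟨W', hW', hc⟩ := exists_stable_isCompl ρ W hW
    -- The modular law cuts the complement of W in V down to a complement in U.
    have hsum : W ⊔ W' ⊓ U = U := by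
      rw [← sup_inf_assoc_of_le _ hWU, hc.sup_eq_top, top_inf_eq]
    have hst : ∀ g, ∀ u ∈ W' ⊓ U, ρ g u ∈ W' ⊓ U := fun g u hu => ⟨hW' g u hu.1, hU g u hu.2⟩
    have hdis : Disjoint W (W' ⊓ U) := hc.disjoint.mono_right inf_le_left
    have hlt : W' ⊓ U < U := by
      refine lt_of_le_of_ne inf_le_right fun h => hW0 ?_
      rw [h] at hdis
      exact hdis.eq_bot_of_le hWU
    rw [← hsum]
    exact hsup _ _ hW hst hdis
      (ih _ (Submodule.finrank_lt_finrank_of_lt (lt_of_le_of_ne hWU hne)) W hW rfl)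
      (ih _ (Submodule.finrank_lt_finrank_of_lt hlt) _ hst rfl)

end

/-- `IsIrrChar` only admits coordinate spaces, so coordinates in a basis transport the
representation and its lattice of subrepresentations. -/
lemma isIrrChar_character {G : Type u} {V : Type*} [Group G] [AddCommGroup V] [Module ℂ V]
    [FiniteDimensional ℂ V] (ρ : Representation ℂ G V) (hρ : ρ.IsIrreducible) :
    IsIrrChar ρ.character := by
  let e : V ≃ₗ[ℂ] (Fin (finrank ℂ V) → ℂ) := (finBasis ℂ V).equivFun
  let σ : Representation ℂ G (Fin (finrank ℂ V) → ℂ) :=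
    { toFun := fun g => e.conj (ρ g)
      map_one' := by ext; simp [LinearEquiv.conj_apply]
      map_mul' := fun a b => by ext; simp [LinearEquiv.conj_apply] }
  have hσ : ∀ g v, σ g (e v) = e (ρ g v) := fun g v => by simp [σ, LinearEquiv.conj_apply]
  refine ⟨finrank ℂ V, σ, ?_, ?_⟩
  · let F : Subrepresentation σ ≃o Subrepresentation ρ :=
      { toFun := fun W => ⟨W.toSubmodule.comap e.toLinearMap, fun g v hv => by
          have := W.apply_mem_toSubmodule g hv
          change e (ρ g v) ∈ W.toSubmodule
          rw [← hσ]
          exact this⟩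
        invFun := fun W => ⟨W.toSubmodule.map e.toLinearMap, by
          rintro g _ ⟨v, hv, rfl⟩
          exact ⟨ρ g v, W.apply_mem_toSubmodule g hv, (hσ g v).symm⟩⟩
        left_inv := fun W => Subrepresentation.toSubmodule_injective
          (Submodule.map_comap_eq_of_surjective e.surjective _)
        right_inv := fun W => Subrepresentation.toSubmodule_injective
          (Submodule.comap_map_eq_of_injective e.injective _)
        map_rel_iff' := fun {W W'} => by
          change W.toSubmodule.comap e.toLinearMap ≤ W'.toSubmodule.comap e.toLinearMap ↔
            W.toSubmodule ≤ W'.toSubmodule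
          constructor
          · intro h w hw
            obtain ⟨v, rfl⟩ := e.surjective w
            exact h hw
          · exact fun h => Submodule.comap_mono h }
    exact (OrderIso.isSimpleOrder_iff F).2 hρ
  · funext g
    exact (LinearMap.trace_conj' (ρ g) e).symm

/-- The permutation representation on the functions on a set with an action. -/
def permRep {G X : Type*} [Group G] [MulAction G X] : Representation ℂ G (X → ℂ) where
  toFun g := LinearMap.funLeft ℂ ℂ fun x => g⁻¹ • x
  map_one' := by ext; simp [LinearMap.funLeft]
  map_mul' a b := by
    ext
    simp [LinearMap.funLeft, mul_smul]

lemma permRep_apply {G X : Type*} [Group G] [MulAction G X] (g : G) (f : X → ℂ) (x : X) :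
    permRep g f x = f (g⁻¹ • x) := rfl

/-! ### Subnormally monomial groups are solvable -/

lemma inducedChar_one {G : Type u} [Group G] [Finite G] (H : Subgroup G) (ψ : H →* ℂˣ) :
    inducedChar H ψ 1 = H.index := by
  have := Fintype.ofFinite (G ⧸ H)
  rw [inducedChar_eq_sum_quotient, Subgroup.index_eq_card, Nat.card_eq_fintype_card]
  have : ∀ q : G ⧸ H, inducedTerm H ψ 1 q.out = 1 := by
    intro q
    have h : q.out⁻¹ * 1 * q.out = 1 := by group
    unfold inducedTerm
    have hm : q.out⁻¹ * 1 * q.out ∈ H := by rw [h]; exact H.one_mem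
    rw [dif_pos hm]
    have : (⟨q.out⁻¹ * 1 * q.out, hm⟩ : H) = 1 := Subtype.ext h
    rw [this, map_one, Units.val_one]
  simp [this]

lemma map_eq_one_of_perfect {G M : Type*} [Group G] [CommGroup M] {D : Subgroup G}
    (hD : ⁅D, D⁆ = D) (f : D →* M) (d : D) : f d = 1 := by
  have h1 : commutator D = ⊤ := by
    apply Subgroup.map_injective D.subtype_injective
    rw [commutator_def, Subgroup.map_commutator, ← MonoidHom.range_eq_map, Subgroup.range_subtype,
      hD]
  exact Abelianization.commutator_subset_ker f (h1 ▸ Subgroup.mem_top d)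

/-- A subgroup of `G` acts trivially if the sum of its character values is as large as possible. -/
lemma acts_trivially_of_character_eq {G V : Type*} [Group G] [Finite G] [AddCommGroup V]
    [Module ℂ V] [FiniteDimensional ℂ V] (ρ : Representation ℂ G V) (D : Subgroup G)
    (h : ∀ d ∈ D, ρ.character d = finrank ℂ V) (d : G) (hd : d ∈ D) (v : V) : ρ d v = v := by
  have := Fintype.ofFinite D
  have hc : (Nat.card D : ℂ) ≠ 0 := by exact_mod_cast Nat.card_pos.ne'
  have := invertibleOfNonzero hc
  let τ : Representation ℂ D V := ρ.comp D.subtype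
  have h1 := Representation.card_inv_mul_sum_char_eq_finrank τ
  have h2 : ∑ g : D, τ.character g = Nat.card D * finrank ℂ V := by
    rw [Finset.sum_congr rfl fun g _ => show τ.character g = finrank ℂ V from
      h g g.2, Finset.sum_const, Finset.card_univ, Nat.card_eq_fintype_card, nsmul_eq_mul]
  rw [h2, inv_mul_cancel_left₀ hc] at h1
  have h3 := Submodule.eq_top_of_finrank_eq (Nat.cast_injective h1).symm
  have h4 : v ∈ Representation.invariants τ := h3 ▸ Submodule.mem_top
  exact h4 ⟨d, hd⟩

/-- Taketa's argument. Take an irreducible representation of least degree n on which D acts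
nontrivially; its character is induced from some ψ on H of index n. On functions on G/H with sum
zero, a space of dimension below n, D acts trivially, and this forces D ≤ H. As D is perfect and
normal, ψ is trivial on it, so the character is constantly n on D, a contradiction. -/
lemma SubnormallyMonomial.eq_bot_of_perfect {G : Type u} [Group G] [Finite G]
    (hG : SubnormallyMonomial G) (D : Subgroup G) [D.Normal] (hD : ⁅D, D⁆ = D) : D = ⊥ := by
  classical
  by_contra hne
  let good : ℕ → Prop := fun n => ∃ ρ : Representation ℂ G (Fin n → ℂ), ρ.IsIrreducible ∧
    ¬ ∀ d ∈ D, ρ.character d = n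
  have key : ∀ {V : Type u} [AddCommGroup V] [Module ℂ V] [FiniteDimensional ℂ V]
      (ρ : Representation ℂ G V) (m : ℕ), (∀ n < m, ¬ good n) → ∀ U : Submodule ℂ V,
      (∀ g, ∀ u ∈ U, ρ g u ∈ U) → finrank ℂ U < m → ∀ d ∈ D, ∀ u ∈ U, ρ d u = u := by
    intro V _ _ _ ρ m hm U hU
    refine stable_induction ρ (fun U => finrank ℂ U < m → ∀ d ∈ D, ∀ u ∈ U, ρ d u = u) ?_ ?_ ?_ U hU
    · intro _ d _ u hu
      rw [Submodule.mem_bot] at hu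
      rw [hu, map_zero]
    · intro U hU hirr hlt d hd u hu
      obtain ⟨n, τ, hτ, he⟩ := isIrrChar_character _ hirr
      have hn : (n : ℂ) = finrank ℂ U := by
        rw [← Representation.char_one (subRep ρ U hU), he, Representation.char_one,
          finrank_fin_fun]
      have hn' : n = finrank ℂ U := by exact_mod_cast hn
      have := hm n (hn' ▸ hlt)
      simp only [good, not_exists, not_and, not_not] at this
      have h1 := this τ hτ
      exact congrArg Subtype.val (acts_trivially_of_character_eq (subRep ρ U hU) D
        (fun d hd => by rw [he, h1 d hd, hn]) d hd ⟨u, hu⟩)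
    · intro U W _ _ _ h1 h2 hlt d hd u hu
      obtain ⟨a, ha, b, hb, rfl⟩ := Submodule.mem_sup.1 hu
      rw [map_add, h1 ((Submodule.finrank_mono le_sup_left).trans_lt hlt) d hd a ha,
        h2 ((Submodule.finrank_mono le_sup_right).trans_lt hlt) d hd b hb]
  -- Otherwise D would act trivially on the regular representation, which is faithful.
  have hex : ∃ n, good n := by
    by_contra! hc
    obtain ⟨⟨d, hd⟩, hd1⟩ := Subgroup.ne_bot_iff_exists_ne_one.1 hne
    have hd1 : d ≠ 1 := fun h => hd1 (Subtype.ext h)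
    have := Fintype.ofFinite G
    have h1 := key (permRep (G := G) (X := G)) _ (fun n _ => hc n) ⊤
      (fun _ _ _ => Submodule.mem_top) (Nat.lt_succ_self _) d hd (Pi.single 1 1) Submodule.mem_top
    have h2 := congrFun h1 d
    rw [permRep_apply, smul_eq_mul, inv_mul_cancel, Pi.single_eq_same,
      Pi.single_eq_of_ne hd1] at h2
    exact one_ne_zero h2
  obtain ⟨ρ, hρ, hρD⟩ := Nat.find_spec hex
  have hmin := fun k => Nat.find_min hex (m := k)
  generalize Nat.find hex = n at ρ hρ hρD hmin
  obtain ⟨H, ψ, -, hψ⟩ := hG _ ⟨n, ρ, hρ, rfl⟩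
  have hidx : H.index = n := by
    have := inducedChar_one H ψ
    rw [← hψ, Representation.char_one, finrank_fin_fun] at this
    exact_mod_cast this.symm
  have := Fintype.ofFinite (G ⧸ H)
  have hDH : D ≤ H := by
    intro d hd
    let s : (G ⧸ H → ℂ) →ₗ[ℂ] ℂ := ∑ i, LinearMap.proj i
    have hs : ∀ f, s f = ∑ i, f i := fun f => by simp [s]
    let U : Submodule ℂ (G ⧸ H → ℂ) := LinearMap.ker s
    have hmemU : ∀ f, f ∈ U ↔ ∑ i, f i = 0 := fun f => by rw [LinearMap.mem_ker, hs]
    have hU : ∀ g, ∀ u ∈ U, permRep (G := G) g u ∈ U := by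
      intro g u hu
      rw [hmemU] at hu ⊢
      rw [← hu]
      exact Equiv.sum_comp (MulAction.toPerm g⁻¹ : Equiv.Perm (G ⧸ H)) u
    have hfr : finrank ℂ U < n := by
      have hlt : U < ⊤ := by
        refine lt_top_iff_ne_top.2 fun h => ?_
        have h1 : (Pi.single ((1 : G) : G ⧸ H) 1 : G ⧸ H → ℂ) ∈ U := h ▸ Submodule.mem_top
        rw [hmemU] at h1
        simp at h1
      have := Submodule.finrank_lt hlt.ne
      rwa [finrank_fintype_fun_eq_card, ← Nat.card_eq_fintype_card, ← Subgroup.index_eq_card,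
        hidx] at this
    have htriv := key (permRep (G := G) (X := G ⧸ H)) n
      (fun k hk => hmin k hk) U hU hfr d hd
    by_contra hdH
    have hne1 : (d : G ⧸ H) ≠ ((1 : G) : G ⧸ H) := by
      rw [Ne, eq_comm, QuotientGroup.eq]
      simpa using hdH
    -- The difference of the point masses at H and dH has sum zero; if dH ≠ H, applying d changes
    -- its value at dH from -1 to 1.
    have hmem : (Pi.single ((1 : G) : G ⧸ H) 1 - Pi.single (d : G ⧸ H) 1 : G ⧸ H → ℂ) ∈ U := by
      rw [hmemU]
      simp
    have h1 := congrFun (htriv _ hmem) (d : G ⧸ H)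
    have h2 : d⁻¹ • (d : G ⧸ H) = ((1 : G) : G ⧸ H) := by
      change ((d⁻¹ * d : G) : G ⧸ H) = _
      rw [inv_mul_cancel]
    rw [permRep_apply, h2] at h1
    simp [hne1, hne1.symm] at h1
    norm_num [eq_neg_iff_add_eq_zero] at h1
  apply hρD
  intro d hd
  rw [hψ, inducedChar_eq_sum_quotient, ← hidx, Subgroup.index_eq_card, Nat.card_eq_fintype_card]
  have h1 : ∀ q : G ⧸ H, inducedTerm H ψ d q.out = 1 := by
    intro q
    have hq : q.out⁻¹ * d * q.out ∈ D := by
      have := (inferInstance : D.Normal).conj_mem d hd q.out⁻¹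
      rwa [inv_inv] at this
    unfold inducedTerm
    rw [dif_pos (hDH hq)]
    have := map_eq_one_of_perfect hD (ψ.comp (Subgroup.inclusion hDH)) ⟨_, hq⟩
    exact congrArg Units.val this
  simp [h1]

/-- The normal closure of a perfect subgroup is perfect, so the normal case excludes all nontrivial
perfect subgroups. -/
theorem SubnormallyMonomial.isSolvable {G : Type u} [Group G] [Finite G]
    (hG : SubnormallyMonomial G) : Group.IsSolvable G := by
  rw [Group.isSolvable_iff_commutator_lt]
  intro H hH
  refine lt_of_le_of_ne (Subgroup.commutator_le_self H) fun h => hH ?_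
  have hperf : ⁅Subgroup.normalClosure (H : Set G), Subgroup.normalClosure (H : Set G)⁆ =
      Subgroup.normalClosure (H : Set G) := by
    refine le_antisymm (Subgroup.commutator_le_self _) (Subgroup.normalClosure_le_normal ?_)
    intro x hx
    have hx' : x ∈ ⁅H, H⁆ := h.symm ▸ hx
    exact Subgroup.commutator_mono Subgroup.le_normalClosure Subgroup.le_normalClosure hx'
  have := hG.eq_bot_of_perfect _ hperf
  rw [eq_bot_iff, ← this]
  exact Subgroup.le_normalClosure

end MonomialClasses

namespace MonomialClasses

open Module

/-! ### Linear characters of coprime subgroups of subnormally monomial groups -/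

section WeightSpace

variable {G V : Type*} [Group G] [AddCommGroup V] [Module ℂ V]

/-- The space of vectors on which `K` acts by the linear character `μ`. -/
def weightSpace (ρ : Representation ℂ G V) (K : Subgroup G) (μ : K →* ℂˣ) : Submodule ℂ V where
  carrier := {v | ∀ k : K, ρ k v = (μ k : ℂ) • v}
  zero_mem' := fun k => by simp
  add_mem' := fun {a b} ha hb k => by rw [map_add, ha k, hb k, smul_add]
  smul_mem' := fun c v hv k => by rw [map_smul, hv k, smul_comm]

/-- Stability and directness force both components of a weight vector to be weight vectors. -/
lemma weightSpace_inf_sup {ρ : Representation ℂ G V} {K : Subgroup G} {μ : K →* ℂˣ}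
    {U W : Submodule ℂ V} (hU : ∀ g, ∀ u ∈ U, ρ g u ∈ U) (hW : ∀ g, ∀ u ∈ W, ρ g u ∈ W)
    (hd : Disjoint U W) :
    (U ⊔ W) ⊓ weightSpace ρ K μ = U ⊓ weightSpace ρ K μ ⊔ W ⊓ weightSpace ρ K μ := by
  refine le_antisymm ?_ (sup_le (inf_le_inf_right _ le_sup_left) (inf_le_inf_right _ le_sup_right))
  rintro v ⟨hv, hv'⟩
  obtain ⟨u, hu, w, hw, rfl⟩ := Submodule.mem_sup.1 hv
  have key : ∀ k : K, ρ k u - (μ k : ℂ) • u = 0 ∧ (μ k : ℂ) • w - ρ k w = 0 := by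
    intro k
    have h1 := hv' k
    rw [map_add, smul_add] at h1
    have h2 : ρ k u - (μ k : ℂ) • u = (μ k : ℂ) • w - ρ k w := by
      rw [sub_eq_sub_iff_add_eq_add, h1, add_comm]
    have hu' : ρ k u - (μ k : ℂ) • u ∈ U := U.sub_mem (hU _ u hu) (U.smul_mem _ hu)
    have hw' : (μ k : ℂ) • w - ρ k w ∈ W := W.sub_mem (W.smul_mem _ hw) (hW _ w hw)
    have h3 := (Submodule.disjoint_def.1 hd) _ hu' (h2 ▸ hw')
    exact ⟨h3, h2 ▸ h3⟩
  exact Submodule.add_mem_sup ⟨hu, fun k => sub_eq_zero.1 (key k).1⟩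
    ⟨hw, fun k => (sub_eq_zero.1 (key k).2).symm⟩

/-- Twisting by the inverse of μ turns the weight space into the space of invariants, whose
dimension is the average of the character. -/
lemma sum_character_eq_card_mul_finrank_weightSpace [FiniteDimensional ℂ V]
    (ρ : Representation ℂ G V) (K : Subgroup G) [Finite K] [Fintype K] (μ : K →* ℂˣ) :
    ∑ k : K, ((μ k)⁻¹ : ℂˣ) * ρ.character k = Nat.card K * finrank ℂ (weightSpace ρ K μ) := by
  have hc : (Nat.card K : ℂ) ≠ 0 := by exact_mod_cast Nat.card_pos.ne'
  have := invertibleOfNonzero hc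
  let τ : Representation ℂ K V :=
    { toFun := fun k => (((μ k)⁻¹ : ℂˣ) : ℂ) • ρ k
      map_one' := by simp
      map_mul' := fun a b => by
        rw [map_mul, mul_inv, Subgroup.coe_mul, map_mul, Units.val_mul, smul_mul_smul_comm] }
  have hτ : ∀ k v, τ k v = (((μ k)⁻¹ : ℂˣ) : ℂ) • ρ k v := fun k v => rfl
  have h1 := Representation.card_inv_mul_sum_char_eq_finrank τ
  have h2 : Representation.invariants τ = weightSpace ρ K μ := by
    ext v
    refine forall_congr' fun k => ?_
    rw [hτ]
    exact inv_smul_eq_iff (g := μ k) (a := ρ k v) (b := v)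
  rw [h2] at h1
  rw [← h1, mul_inv_cancel_left₀ hc]
  refine Finset.sum_congr rfl fun k _ => ?_
  change _ = LinearMap.trace ℂ V ((((μ k)⁻¹ : ℂˣ) : ℂ) • ρ k)
  rw [map_smul]
  rfl

end WeightSpace

/-- If `q` does not divide the order of `K`, then some irreducible representation contains the
linear character `μ` of `K` with a multiplicity which is prime to `q`. -/
lemma exists_isIrrChar_multiplicity {G : Type u} [Group G] [Finite G] {q : ℕ} (hq : q.Prime)
    (K : Subgroup G) [Fintype K] (hK : ¬ q ∣ Nat.card K) (μ : K →* ℂˣ) :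
    ∃ (χ : G → ℂ) (d : ℕ), IsIrrChar χ ∧ ¬ q ∣ d ∧
      ∑ k : K, ((μ k)⁻¹ : ℂˣ) * χ k = Nat.card K * d := by
  classical
  have : Fact q.Prime := ⟨hq⟩
  by_contra! hc
  obtain ⟨Q⟩ : Nonempty (Sylow q G) := inferInstance
  have := Fintype.ofFinite (G ⧸ (Q : Subgroup G))
  -- With Q a Sylow q-subgroup, K acts freely on G/Q, so μ has multiplicity |G : Q| / |K| in ρ. This
  -- is prime to q, hence so is the multiplicity in some irreducible constituent.
  let ρ : Representation ℂ G (G ⧸ (Q : Subgroup G) → ℂ) := permRep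
  have h1 : q ∣ finrank ℂ (⊤ ⊓ weightSpace ρ K μ : Submodule ℂ _) := by
    refine stable_induction ρ (fun U => q ∣ finrank ℂ (U ⊓ weightSpace ρ K μ : Submodule ℂ _))
      ?_ ?_ ?_ ⊤ (fun _ _ _ => Submodule.mem_top)
    · rw [bot_inf_eq, finrank_bot]
      exact dvd_zero q
    · intro U hU hirr
      by_contra hnd
      refine hc _ (finrank ℂ (weightSpace (subRep ρ U hU) K μ)) (isIrrChar_character _ hirr) ?_
        (sum_character_eq_card_mul_finrank_weightSpace _ K μ)
      have h2 : (weightSpace (subRep ρ U hU) K μ).map U.subtype = U ⊓ weightSpace ρ K μ := by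
        ext v
        constructor
        · rintro ⟨w, hw, rfl⟩
          exact ⟨w.2, fun k => congrArg Subtype.val (hw k)⟩
        · rintro ⟨hv, hv'⟩
          exact ⟨⟨v, hv⟩, fun k => Subtype.ext (hv' k), rfl⟩
      rwa [(Submodule.equivMapOfInjective _ U.subtype_injective _).finrank_eq, h2]
    · intro U W hU hW hd hu hw
      rw [weightSpace_inf_sup hU hW hd]
      have := Submodule.finrank_sup_add_finrank_inf_eq (U ⊓ weightSpace ρ K μ)
        (W ⊓ weightSpace ρ K μ)
      rw [(hd.mono inf_le_left inf_le_left).eq_bot, finrank_bot, add_zero] at this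
      rw [this]
      exact dvd_add hu hw
  rw [top_inf_eq] at h1
  have h2 := sum_character_eq_card_mul_finrank_weightSpace ρ K μ
  -- An element of K fixing a coset of Q is conjugate to an element of Q, while its order is prime
  -- to q.
  have h3 : ∀ k : K, k ≠ 1 → ρ.character k = 0 := by
    intro k hk
    rw [Representation.character, LinearMap.trace_eq_matrix_trace ℂ (Pi.basisFun ℂ _), Matrix.trace]
    refine Finset.sum_eq_zero fun c _ => ?_
    rw [Matrix.diag_apply, LinearMap.toMatrix_apply, Pi.basisFun_apply, Pi.basisFun_repr,
      permRep_apply]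
    refine Pi.single_eq_of_ne (fun he => hk ?_) _
    have hmem : c.out⁻¹ * (k : G)⁻¹ * c.out ∈ (Q : Subgroup G) := by
      have h4 : (((k : G)⁻¹ * c.out : G) : G ⧸ (Q : Subgroup G)) = (c.out : G) := by
        rw [QuotientGroup.out_eq']
        conv_rhs => rw [← he]
        conv_rhs => rw [← QuotientGroup.out_eq' c]
        rfl
      rw [eq_comm, QuotientGroup.eq, ← mul_assoc] at h4
      exact h4
    obtain ⟨n, hn⟩ := Q.2 ⟨_, hmem⟩
    have hn : (c.out⁻¹ * (k : G)⁻¹ * c.out) ^ q ^ n = 1 := congrArg Subtype.val hn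
    have h5 : c.out⁻¹ * (k : G)⁻¹ * c.out = c.out⁻¹ * (k : G)⁻¹ * c.out⁻¹⁻¹ := by rw [inv_inv]
    rw [h5, conj_pow, mul_inv_eq_one, mul_eq_left, inv_pow, inv_eq_one] at hn
    have h6 : orderOf (k : G) ∣ q ^ n := orderOf_dvd_of_pow_eq_one hn
    rw [Subgroup.orderOf_coe] at h6
    have h7 : Nat.Coprime (orderOf k) (q ^ n) :=
      (Nat.Coprime.pow_right n ((Nat.Prime.coprime_iff_not_dvd hq).2 fun h =>
        hK (h.trans (orderOf_dvd_natCard k))).symm)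
    exact orderOf_eq_one_iff.1 (Nat.Coprime.eq_one_of_dvd h7 h6)
  have h4 : ρ.character ((1 : K) : G) = (Q : Subgroup G).index := by
    rw [Subgroup.coe_one, Representation.char_one, finrank_fintype_fun_eq_card,
      Subgroup.index_eq_card, Nat.card_eq_fintype_card]
  rw [Fintype.sum_eq_single 1 fun k hk => by rw [h3 k hk, mul_zero], h4, map_one, inv_one,
    Units.val_one, one_mul] at h2
  have h5 : (Q : Subgroup G).index = Nat.card K * finrank ℂ (weightSpace ρ K μ) := by
    exact_mod_cast h2
  exact Sylow.not_dvd_index Q (h5 ▸ h1.mul_left _)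

lemma inducedTerm_ne_zero_iff {G : Type u} [Group G] {H : Subgroup G} {ψ : H →* ℂˣ} {g x : G} :
    inducedTerm H ψ g x ≠ 0 ↔ x⁻¹ * g * x ∈ H := by
  unfold inducedTerm
  split_ifs with h
  · simp [h]
  · simp [h]

lemma inducedTerm_conj {G : Type u} [Group G] (H : Subgroup G) (ψ : H →* ℂˣ) (g x y : G) :
    inducedTerm H ψ (y * g * y⁻¹) (y * x) = inducedTerm H ψ g x := by
  have e : (y * x)⁻¹ * (y * g * y⁻¹) * (y * x) = x⁻¹ * g * x := by group
  have e' : (y * x)⁻¹ * (y * g * y⁻¹) * (y * x) ∈ H ↔ x⁻¹ * g * x ∈ H := by rw [e]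
  unfold inducedTerm
  by_cases h : x⁻¹ * g * x ∈ H
  · rw [dif_pos h, dif_pos (e'.2 h)]
    congr 3
  · rw [dif_neg h, dif_neg (fun h' => h (e'.1 h'))]

open scoped Classical in
/-- A sum over `K` of one term of an induced character counts, if it does not vanish. -/
lemma sum_inducedTerm {G : Type u} [Group G] [Finite G] (H K : Subgroup G) [Fintype K]
    (ψ : H →* ℂˣ) (μ : K →* ℂˣ) (x : G) :
    ∑ k : K, ((μ k)⁻¹ : ℂˣ) * inducedTerm H ψ k x =
      if ∀ k : K, inducedTerm H ψ k x ≠ 0 → inducedTerm H ψ k x = μ k then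
        (Nat.card {k : K // inducedTerm H ψ k x ≠ 0} : ℂ) else 0 := by
  have := Fintype.ofFinite H
  -- S is the intersection of K with xHx⁻¹. The nonzero summands are values of a linear character of
  -- S, whose sum is |S| or 0 by orthogonality.
  let S : Subgroup K := (H.comap (MulAut.conj x⁻¹).toMonoidHom).subgroupOf K
  have hS : ∀ k : K, inducedTerm H ψ k x ≠ 0 ↔ k ∈ S := by
    intro k
    rw [inducedTerm_ne_zero_iff]
    change _ ↔ x⁻¹ * (k : G) * x⁻¹⁻¹ ∈ H
    rw [inv_inv]
  have hS' : ∀ k : S, x⁻¹ * ((k : K) : G) * x ∈ H := fun k =>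
    inducedTerm_ne_zero_iff.1 ((hS k).2 k.2)
  let ξ : S →* ℂ :=
    { toFun := fun k => ((μ k)⁻¹ : ℂˣ) * (ψ ⟨_, hS' k⟩ : ℂˣ)
      map_one' := by
        have : (⟨x⁻¹ * (((1 : S) : K) : G) * x, hS' 1⟩ : H) = 1 := Subtype.ext (by simp)
        rw [this]
        simp
      map_mul' := fun a b => by
        have : (⟨x⁻¹ * (((a * b : S) : K) : G) * x, hS' (a * b)⟩ : H) =
            ⟨_, hS' a⟩ * ⟨_, hS' b⟩ := Subtype.ext (by simp [mul_assoc])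
        rw [this]
        simp only [map_mul, Subgroup.coe_mul, mul_inv, Units.val_mul]
        ring }
  have hξ : ∀ k : S, ((μ k)⁻¹ : ℂˣ) * inducedTerm H ψ (k : K) x = ξ k := by
    intro k
    change _ = (((μ k)⁻¹ : ℂˣ) : ℂ) * ((ψ ⟨_, hS' k⟩ : ℂˣ) : ℂ)
    unfold inducedTerm
    rw [dif_pos (hS' k)]
  have hsum : ∑ k : K, (((μ k)⁻¹ : ℂˣ) : ℂ) * inducedTerm H ψ k x = ∑ k : S, ξ k := by
    rw [← Finset.sum_congr rfl fun k _ => hξ k, ← Finset.sum_filter_of_ne (p := (· ∈ S))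
      fun k _ hk => (hS k).1 (right_ne_zero_of_mul hk)]
    exact Finset.sum_subtype _ (by simp) (fun k : K => (((μ k)⁻¹ : ℂˣ) : ℂ) * inducedTerm H ψ k x)
  have hgood : (∀ k : K, inducedTerm H ψ k x ≠ 0 → inducedTerm H ψ k x = μ k) ↔ ξ = 1 := by
    rw [DFunLike.ext_iff]
    constructor
    · intro h k
      rw [← hξ, h k ((hS k).2 k.2)]
      simp
    · intro h k hk
      have := h ⟨k, (hS k).1 hk⟩
      rw [← hξ, MonoidHom.one_apply, Units.inv_mul_eq_one] at this
      exact this.symm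
  rw [hsum, sum_hom_units ξ]
  simp only [hgood]
  split_ifs
  · rw [← Nat.card_eq_fintype_card, Nat.card_congr (Equiv.subtypeEquivRight hS).symm]
  · exact Nat.cast_zero

/-- In a subnormally monomial group, a `q`-group which stabilizes a linear character of a subgroup
of order prime to `q` lies in a subnormal subgroup with a compatible linear character. -/
lemma SubnormallyMonomial.exists_isSubnormal {G : Type u} [Group G] [Finite G]
    (hG : SubnormallyMonomial G) {q : ℕ} (hq : q.Prime) (K : Subgroup G)
    (hK : ¬ q ∣ Nat.card K) (μ : K →* ℂˣ) (Q : Subgroup G) (hQ : IsPGroup q Q)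
    (hn : ∀ g ∈ Q, ∀ k ∈ K, g * k * g⁻¹ ∈ K)
    (hμ : ∀ g (hg : g ∈ Q) (k : K), μ ⟨g * k * g⁻¹, hn g hg k k.2⟩ = μ k) :
    ∃ (S : Subgroup G) (ψ : S →* ℂˣ), S.IsSubnormal ∧ Q ≤ S ∧
      ∀ (k : G) (hk : k ∈ K) (hs : k ∈ S), ψ ⟨k, hs⟩ = μ ⟨k, hk⟩ := by
  classical
  have := Fintype.ofFinite K
  have : Fact q.Prime := ⟨hq⟩
  obtain ⟨χ, d, hχ, hd, hsum⟩ := exists_isIrrChar_multiplicity hq K hK μ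
  obtain ⟨H, ψ, hH, rfl⟩ := hG χ hχ
  have := Fintype.ofFinite (G ⧸ H)
  let good : G → Prop := fun x => ∀ k : K, inducedTerm H ψ k x ≠ 0 → inducedTerm H ψ k x = μ k
  -- Y consists of the pairs of a coset xH, for which the conjugate of ψ agrees with μ on K ∩ xHx⁻¹,
  -- and an element of that intersection. Computing the multiplicity d coset by coset gives |Y| =
  -- |K| d, which is prime to q.
  let Y : Type _ := {y : (G ⧸ H) × K // good y.1.out ∧ inducedTerm H ψ y.2 y.1.out ≠ 0}
  have hY : Nat.card Y = Nat.card K * d := by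
    have h1 : (Nat.card K * d : ℂ) = ∑ c : G ⧸ H,
        if good c.out then (Nat.card {k : K // inducedTerm H ψ k c.out ≠ 0} : ℂ) else 0 := by
      rw [← hsum]
      simp_rw [inducedChar_eq_sum_quotient, Finset.mul_sum]
      rw [Finset.sum_comm]
      exact Finset.sum_congr rfl fun c _ => sum_inducedTerm H K ψ μ c.out
    have h2 : Nat.card Y = ∑ c : G ⧸ H,
        if good c.out then Nat.card {k : K // inducedTerm H ψ k c.out ≠ 0} else 0 := by
      rw [Nat.card_congr (Equiv.subtypeProdEquivSigmaSubtype
        (fun (c : G ⧸ H) (k : K) => good c.out ∧ inducedTerm H ψ k c.out ≠ 0)), Nat.card_sigma]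
      refine Finset.sum_congr rfl fun c _ => ?_
      split_ifs with h
      · simp [h]
      · simp [h]
    have h3 : (Nat.card Y : ℂ) = Nat.card K * d := by
      rw [h1, h2]
      push_cast
      rfl
    exact_mod_cast h3
  have hout : ∀ (g : G) (c : G ⧸ H) (k : G),
      inducedTerm H ψ (g * k * g⁻¹) (g • c).out = inducedTerm H ψ k c.out := by
    intro g c k
    rw [← inducedTerm_conj H ψ k c.out g, ← inducedTerm_out H ψ _ (g * c.out)]
    conv_lhs => rw [← QuotientGroup.out_eq' c]
    rfl
  have hstab : ∀ (g : Q) (y : Y), good ((g : G) • y.1.1).out := by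
    intro g y k hk
    have h1 := hn (g : G)⁻¹ (Q.inv_mem g.2) k k.2
    have h2 := hout g y.1.1 ((g : G)⁻¹ * k * (g : G)⁻¹⁻¹)
    have h3 : (g : G) * ((g : G)⁻¹ * k * (g : G)⁻¹⁻¹) * (g : G)⁻¹ = k := by group
    rw [h3] at h2
    rw [h2] at hk ⊢
    rw [y.2.1 ⟨_, h1⟩ hk, hμ _ (Q.inv_mem g.2)]
  let act : MulAction Q Y :=
    { smul := fun g y => ⟨((g : G) • y.1.1, ⟨g * y.1.2 * (g : G)⁻¹, hn g g.2 _ y.1.2.2⟩),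
        hstab g y, by rw [hout]; exact y.2.2⟩
      one_smul := fun y => Subtype.ext (Prod.ext (one_smul _ _) (Subtype.ext (by
        change (1 : G) * _ * (1 : G)⁻¹ = _
        simp)))
      mul_smul := fun g h y => Subtype.ext (Prod.ext (mul_smul (g : G) h _) (Subtype.ext (by
        change ((g * h : Q) : G) * _ * ((g * h : Q) : G)⁻¹ = g * (h * _ * (h : G)⁻¹) * (g : G)⁻¹
        simp [mul_assoc]))) }
  -- Q permutes Y because it stabilizes K and μ. A fixed pair has a fixed coset xH, so Q lies in
  -- xHx⁻¹, the subnormal subgroup sought.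
  obtain ⟨y, hy⟩ := hQ.nonempty_fixed_point_of_prime_not_dvd_card Y
    (by rw [hY]; exact fun h => ((Nat.Prime.dvd_mul hq).1 h).elim hK hd)
  set x := y.1.1.out with hx
  refine ⟨H.comap (MulAut.conj x⁻¹).toMonoidHom,
    ψ.comp ((MulAut.conj x⁻¹).toMonoidHom.subgroupComap H), hH.comap _, ?_, ?_⟩
  · intro g hg
    have h1 : g • y.1.1 = y.1.1 := congrArg (fun y : Y => y.1.1) (hy ⟨g, hg⟩)
    change x⁻¹ * g * x⁻¹⁻¹ ∈ H
    rw [inv_inv, mul_assoc, ← QuotientGroup.eq, hx, QuotientGroup.out_eq']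
    conv_lhs => rw [← h1, ← QuotientGroup.out_eq' y.1.1]
    rfl
  · intro k hk hs
    have hs' : x⁻¹ * k * x ∈ H := by simpa using hs
    have h1 := y.2.1 ⟨k, hk⟩ (inducedTerm_ne_zero_iff.2 hs')
    rw [inducedTerm, dif_pos hs'] at h1
    rw [← Units.ext h1]
    change ψ _ = ψ _
    congr 1
    refine Subtype.ext ?_
    change x⁻¹ * k * x⁻¹⁻¹ = _
    rw [inv_inv]

end MonomialClasses

namespace MonomialClasses

open Subgroup

open scoped commutatorElement

/-! ### Subnormally monomial groups have no central `p`-factors -/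

lemma mem_of_pow_mem_of_coprime {G : Type*} [Group G] {H : Subgroup G} {g : G} {m n : ℕ}
    (h : Nat.Coprime m n) (hm : g ^ m ∈ H) (hn : g ^ n ∈ H) : g ∈ H := by
  have h1 : g ^ (1 : ℤ) = (g ^ m) ^ (Nat.gcdA m n) * (g ^ n) ^ (Nat.gcdB m n) := by
    rw [← zpow_natCast, ← zpow_natCast, ← zpow_mul, ← zpow_mul, ← zpow_add, ← Nat.gcd_eq_gcd_ab,
      h.gcd_eq_one, Nat.cast_one]
  rw [zpow_one] at h1
  rw [h1]
  exact H.mul_mem (H.zpow_mem hm _) (H.zpow_mem hn _)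

lemma exists_normal_index_prime {G : Type u} [Group G] [Finite G] [Nontrivial G]
    (hs : Group.IsSolvable G) : ∃ M : Subgroup G, M.Normal ∧ M.index.Prime := by
  have h1 : commutator G ≠ ⊤ := (Group.IsSolvable.commutator_lt_top_of_nontrivial G).ne
  obtain h2 | ⟨M, hM, hle⟩ := eq_top_or_exists_le_coatom (commutator G)
  · exact absurd h2 h1
  have hn : M.Normal := Normal.of_commutator_le G hle
  refine ⟨M, hn, ?_⟩
  let _ : CommGroup (G ⧸ M) :=
    { (inferInstance : Group (G ⧸ M)) with
      mul_comm := fun a b => by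
        induction a using QuotientGroup.induction_on with
        | H a =>
        induction b using QuotientGroup.induction_on with
        | H b =>
          rw [← QuotientGroup.mk_mul, ← QuotientGroup.mk_mul, QuotientGroup.eq]
          have := hle (commutator_mem_commutator (mem_top b⁻¹) (mem_top a⁻¹))
          rw [commutatorElement_def] at this
          convert this using 1
          group }
  have : Nontrivial (G ⧸ M) := QuotientGroup.nontrivial_iff.2 hM.1
  rw [index_eq_card, ← CommGroup.is_simple_iff_prime_card]
  refine ⟨fun H _ => ?_⟩
  have hM' : M ≤ H.comap (QuotientGroup.mk' M) := fun m hm => by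
    rw [mem_comap, QuotientGroup.mk'_apply, (QuotientGroup.eq_one_iff m).2 hm]
    exact H.one_mem
  have hsur := QuotientGroup.mk'_surjective M
  rcases hM'.eq_or_lt with h | h
  · left
    rw [← map_comap_eq_self_of_surjective hsur H, ← h, QuotientGroup.map_mk'_self]
  · right
    rw [← map_comap_eq_self_of_surjective hsur H, hM.2 _ h, map_top_of_surjective _ hsur]

/-- An element outside of a normal subgroup `M` of prime index `q` has a power of `q`-power order
outside of `M`. -/
lemma exists_pow_not_mem {G : Type u} [Group G] [Finite G] {M : Subgroup G} [M.Normal] {q : ℕ}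
    (hq : q.Prime) (hM : M.index = q) {g : G} (hg : g ∉ M) :
    ∃ n s : ℕ, g ^ n ∉ M ∧ (g ^ n) ^ q ^ s = 1 := by
  have h0 : orderOf g ≠ 0 := (orderOf_pos g).ne'
  refine ⟨orderOf g / q ^ (orderOf g).factorization q, (orderOf g).factorization q, fun h => ?_, ?_⟩
  · have hqm : g ^ q ∈ M := hM ▸ pow_index_mem M g
    exact hg (mem_of_pow_mem_of_coprime (Nat.coprime_ordCompl hq h0) hqm h)
  · rw [← pow_mul, mul_comm, Nat.ordProj_mul_ordCompl_eq_self, pow_orderOf_eq_one]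

lemma pResidual_characteristic (p : ℕ) (A : Type u) [Group A] [Finite A] :
    (pResidual p A).Characteristic :=
  characteristic_iff_map_eq.2 fun φ => map_pResidual φ.toMonoidHom φ.surjective

/-- O^p(O^p(A)) is characteristic in O^p(A), hence normal in A, and the quotient of A by it is still
a p-group. -/
lemma pResidual_pResidual (p : ℕ) (A : Type u) [Group A] [Finite A] :
    pResidual p (pResidual p A) = ⊤ := by
  have := pResidual_normal p A
  have := pResidual_characteristic p (pResidual p A)
  have h : pResidual p A ≤ (pResidual p (pResidual p A)).map (pResidual p A).subtype := by
    refine pResidual_le inferInstance fun a => ?_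
    obtain ⟨n, hn⟩ := exists_pow_mem_pResidual p a
    obtain ⟨m, hm⟩ := exists_pow_mem_pResidual p (⟨_, hn⟩ : pResidual p A)
    exact ⟨n + m, ⟨_, hm, by simp [pow_add, pow_mul]⟩⟩
  rw [eq_top_iff]
  intro a _
  obtain ⟨b, hb, hab⟩ := h a.2
  rwa [← Subtype.ext (a1 := b) (a2 := a) hab]

/-- If `M / R` is a `p`-group, then `M = P R` for a Sylow `p`-subgroup `P`. -/
lemma sylow_sup_eq_top {p : ℕ} [Fact p.Prime] {M : Type u} [Group M] [Finite M] (P : Sylow p M)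
    {R : Subgroup M} [R.Normal] (hR : ∀ m : M, ∃ n : ℕ, m ^ p ^ n ∈ R) :
    (P : Subgroup M) ⊔ R = ⊤ := by
  have h1 : IsPGroup p (M ⧸ R) := by
    intro m
    induction m using QuotientGroup.induction_on with
    | H m =>
      obtain ⟨n, hn⟩ := hR m
      exact ⟨n, (QuotientGroup.eq_one_iff _).2 hn⟩
  obtain ⟨n, hn⟩ := IsPGroup.iff_card.1 h1
  have h2 : ((P : Subgroup M) ⊔ R).index ∣ p ^ n := by
    rw [← hn, ← index_eq_card]
    exact index_dvd_of_le le_sup_right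
  have h3 : Nat.Coprime ((P : Subgroup M) ⊔ R).index (p ^ n) := by
    refine Nat.Coprime.pow_right n ((Nat.Prime.coprime_iff_not_dvd Fact.out).2 fun h => ?_).symm
    exact P.not_dvd_index (h.trans (index_dvd_of_le le_sup_left))
  exact index_eq_one.1 (h3.eq_one_of_dvd h2)

/-- The configuration `Γ = P ⟨x⟩` of a minimal counterexample is impossible. -/
lemma mem_of_sup_zpowers {G : Type u} [Group G] [Finite G] (hG : SubnormallyMonomial G) {p q : ℕ}
    (hp : p.Prime) (hq : q.Prime) (hpq : p ≠ q) {Γ : Type u} [Group Γ] [Finite Γ] {f : Γ →* G}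
    (hf : Function.Injective f) (hr : pResidual p Γ = ⊤) {P : Subgroup Γ} [P.Normal]
    (hP : IsPGroup p P) {x : Γ} {s : ℕ} (hx : x ^ q ^ s = 1) (hΓ : P ⊔ zpowers x = ⊤)
    {L : Subgroup Γ} [L.Normal] {y : Γ} (hy : y ∈ P) (hyL : ∀ b, ⁅y, b⁆ ∈ L) : y ∈ L := by
  -- Modulo a normal subgroup containing x the group is an image of P, hence a p-group, and Γ has no
  -- nontrivial p-quotient.
  have hgen : ∀ N : Subgroup Γ, N.Normal → x ∈ N → N = ⊤ := by
    intro N hN hxN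
    rw [eq_top_iff, ← hr]
    refine pResidual_le hN fun a => ?_
    obtain ⟨u, hu, v, hv, rfl⟩ := mem_sup_of_normal_left.1 (hΓ ▸ mem_top a)
    obtain ⟨n, hn⟩ := hP ⟨u, hu⟩
    have hn : u ^ p ^ n = 1 := congrArg Subtype.val hn
    refine ⟨n, ?_⟩
    rw [← QuotientGroup.eq_one_iff, QuotientGroup.mk_pow, QuotientGroup.mk_mul,
      (QuotientGroup.eq_one_iff v).2 (zpowers_le.2 hxN hv), mul_one, ← QuotientGroup.mk_pow, hn,
      QuotientGroup.mk_one]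
  by_contra hyn
  let π := QuotientGroup.mk' L
  let Z := center (Γ ⧸ L)
  let _ : CommGroup Z := { (inferInstance : Group Z) with mul_comm := fun a b => Subtype.ext (mem_center_iff.1 b.2 a) }
  have hyZ : π y ∈ Z := by
    rw [mem_center_iff]
    intro b
    obtain ⟨b, rfl⟩ := QuotientGroup.mk'_surjective L b
    have h1 : π ⁅y, b⁆ = 1 := (QuotientGroup.eq_one_iff _).2 (hyL b)
    rw [map_commutatorElement, commutatorElement_eq_one_iff_mul_comm] at h1
    exact h1.symm
  obtain ⟨χ, hχ⟩ := CommGroup.exists_apply_ne_one_of_hasEnoughRootsOfUnity Z ℂ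
    (a := ⟨π y, hyZ⟩) fun h => hyn (by
      have h : π y = 1 := congrArg Subtype.val h
      exact (QuotientGroup.eq_one_iff y).1 h)
  -- K is central modulo L, so the character of K obtained from χ is invariant under x; it does not
  -- vanish to 1 at y by the choice of χ.
  let K : Subgroup Γ := P ⊓ Z.comap π
  let τ : K →* Z := (π.comp K.subtype).codRestrict Z fun k => k.2.2
  let ε := K.equivMapOfInjective f hf
  let μ : K.map f →* ℂˣ := (χ.comp τ).comp ε.symm.toMonoidHom
  have hμ : ∀ k : K, μ ⟨f k, mem_map_of_mem f k.2⟩ = χ (τ k) := by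
    intro k
    have : ε.symm ⟨f k, mem_map_of_mem f k.2⟩ = k := by
      rw [MulEquiv.symm_apply_eq]
      rfl
    change χ (τ (ε.symm _)) = _
    rw [this]
  have hcard : ¬ q ∣ Nat.card (K.map f) := by
    have : Fact p.Prime := ⟨hp⟩
    rw [← Nat.card_congr ε.toEquiv]
    obtain ⟨n, hn⟩ := IsPGroup.iff_card.1 (hP.to_le (inf_le_left : K ≤ P))
    rw [hn]
    exact fun h => hpq ((Nat.prime_dvd_prime_iff_eq hq hp).1 (hq.dvd_of_dvd_pow h)).symm
  have hQ : IsPGroup q (zpowers (f x)) := by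
    rintro ⟨_, i, rfl⟩
    refine ⟨s, Subtype.ext ?_⟩
    change (f x ^ i) ^ q ^ s = 1
    rw [← zpow_natCast, ← zpow_mul, mul_comm, zpow_mul, zpow_natCast, ← map_pow, hx, map_one,
      one_zpow]
  have hKn : ∀ g : Γ, ∀ k ∈ K, g * k * g⁻¹ ∈ K := fun g k hk => Normal.conj_mem inferInstance k hk g
  have hn : ∀ g ∈ zpowers (f x), ∀ k ∈ K.map f, g * k * g⁻¹ ∈ K.map f := by
    rintro _ ⟨i, rfl⟩ _ ⟨k, hk, rfl⟩
    refine ⟨_, hKn (x ^ i) k hk, ?_⟩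
    simp
  obtain ⟨S, ψ, hS, hxS, hψ⟩ := hG.exists_isSubnormal hq (K.map f) hcard μ (zpowers (f x)) hQ hn (by
    rintro _ ⟨i, rfl⟩ ⟨_, k, hk, rfl⟩
    have h1 := hμ ⟨_, hKn (x ^ i) k hk⟩
    have h2 : (⟨(f x ^ i) * f k * (f x ^ i)⁻¹, hn _ ⟨i, rfl⟩ _ (mem_map_of_mem f hk)⟩ : K.map f) =
      ⟨f (x ^ i * k * (x ^ i)⁻¹), mem_map_of_mem f (hKn (x ^ i) k hk)⟩ := Subtype.ext (by simp)
    have h3 := hμ ⟨k, hk⟩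
    change μ (⟨(f x ^ i) * f k * (f x ^ i)⁻¹, _⟩ : K.map f) = _
    rw [h2, h1, h3]
    congr 1
    refine Subtype.ext ?_
    change π (x ^ i * k * (x ^ i)⁻¹) = π k
    rw [map_mul, map_mul, map_inv, mem_center_iff.1 hk.2, mul_inv_cancel_right])
  -- A proper subnormal subgroup lies in a proper normal one, but this one contains x.
  have hT : S.comap f = ⊤ := by
    by_contra hT
    obtain ⟨N, hN, hle, hlt⟩ := (hS.comap f).exists_normal_and_le_and_lt_top_of_ne hT
    exact hlt.ne (hgen N hN (hle (hxS (mem_zpowers _))))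
  have hfS : ∀ b, f b ∈ S := fun b => by
    have : b ∈ S.comap f := hT ▸ mem_top b
    exact this
  let ψ' : Γ →* ℂˣ := ψ.comp (f.codRestrict S hfS)
  -- The q^s-th power of ψ' kills x, hence everything. So ψ'(y) has both q-power and p-power order
  -- and equals 1, although it agrees with χ on the image of y.
  have hker : ((powMonoidHom (q ^ s)).comp ψ').ker = ⊤ := by
    refine hgen _ inferInstance ?_
    rw [MonoidHom.mem_ker]
    change ψ' x ^ q ^ s = 1
    rw [← map_pow, hx, map_one]
  have h1 : ψ' y ^ q ^ s = 1 := by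
    have : y ∈ ((powMonoidHom (q ^ s)).comp ψ').ker := hker ▸ mem_top y
    exact this
  obtain ⟨n, hn⟩ := hP ⟨y, hy⟩
  have h2 : ψ' y ^ p ^ n = 1 := by
    rw [← map_pow, show y ^ p ^ n = 1 from congrArg Subtype.val hn, map_one]
  have h3 : ψ' y ∈ (⊥ : Subgroup ℂˣ) := mem_of_pow_mem_of_coprime
    (Nat.Coprime.pow s n ((Nat.coprime_primes hq hp).2 hpq.symm)) h1 h2
  have hyK : y ∈ K := ⟨hy, hyZ⟩
  have h4 : ψ' y = χ ⟨π y, hyZ⟩ :=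
    (hψ (f y) (mem_map_of_mem f hyK) (hfS y)).trans (hμ ⟨y, hyK⟩)
  exact hχ (h4 ▸ h3)

lemma commutatorElement_mem_of_mul_mem {G : Type*} [Group G] {L : Subgroup G} [L.Normal] {a b : G}
    (h : ∀ g, ⁅a * b, g⁆ ∈ L) (hb : b ∈ L) (g : G) : ⁅a, g⁆ ∈ L := by
  have h1 := (QuotientGroup.eq_one_iff _).2 (h g)
  have h2 := (QuotientGroup.eq_one_iff _).2 hb
  rw [← QuotientGroup.eq_one_iff]
  rw [← QuotientGroup.mk'_apply, map_commutatorElement] at h1 ⊢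
  rwa [map_mul, QuotientGroup.mk'_apply L b, h2, mul_one] at h1

/-- Induction on |Γ|, with Γ merely embedded in G so that it can shrink. Take M normal of prime
index q; q ≠ p since O^p(Γ) = Γ. By induction R = O^p(M) has no central p-factor, so the offending
element survives modulo R, where M becomes a p-group. The Frattini argument supplies a q-element x
normalizing a Sylow p-subgroup P of M; D = P⟨x⟩ covers Γ/R, as does O^p(D). By induction D = Γ,
which is the configuration excluded by `mem_of_sup_zpowers`. -/
lemma SubnormallyMonomial.mem_of_pResidual_eq_top {G : Type u} [Group G] [Finite G]
    (hG : SubnormallyMonomial G) {p : ℕ} (hp : p.Prime) (n : ℕ) :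
    ∀ (Γ : Type u) [Group Γ] [Finite Γ], Nat.card Γ = n → ∀ f : Γ →* G, Function.Injective f →
      pResidual p Γ = ⊤ → ∀ (L : Subgroup Γ) [L.Normal] (k : Γ), (∃ n : ℕ, k ^ p ^ n ∈ L) →
        (∀ b, ⁅k, b⁆ ∈ L) → k ∈ L := by
  have : Fact p.Prime := ⟨hp⟩
  induction n using Nat.strong_induction_on with
  | _ n ih =>
  intro Γ _ _ hn f hf hr L _ k ⟨j, hk⟩ hkb
  subst hn
  rcases subsingleton_or_nontrivial Γ with hΓ | hΓ
  · rw [Subsingleton.elim k 1]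
    exact L.one_mem
  have hsol : Group.IsSolvable G := hG.isSolvable
  obtain ⟨M, hM, hMi⟩ := exists_normal_index_prime (Group.isSolvable_of_isSolvable_injective hf)
  set q := M.index with hq
  have hpq : p ≠ q := by
    intro h
    have : (⊤ : Subgroup Γ) ≤ M := by
      rw [← hr]
      exact pResidual_le hM fun a => ⟨1, by rw [pow_one, h]; exact pow_index_mem M a⟩
    rw [top_le_iff] at this
    rw [hq, this, index_top] at hMi
    exact Nat.not_prime_one hMi
  have hcop : Nat.Coprime p q := (Nat.coprime_primes hp hMi).2 hpq
  let R := (pResidual p M).map M.subtype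
  have := pResidual_characteristic p M
  have hRn : R.Normal := inferInstance
  have hRM : R ≤ M := map_subtype_le _
  -- `R` has no central `p`-factor
  have hMlt : Nat.card M < Nat.card Γ := by
    rw [← M.card_mul_index]
    exact lt_mul_of_one_lt_right Nat.card_pos hMi.one_lt
  have hRfac : ∀ r ∈ R, (∃ n : ℕ, r ^ p ^ n ∈ L) → (∀ b, ⁅r, b⁆ ∈ L) → r ∈ L := by
    rintro _ ⟨r, hr, rfl⟩ ⟨n, h1⟩ h2
    let g : pResidual p M →* Γ := M.subtype.comp (pResidual p M).subtype
    have hg : Function.Injective g := M.subtype_injective.comp (pResidual p M).subtype_injective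
    exact ih _ ((Nat.le_of_dvd Nat.card_pos (card_subgroup_dvd_card _)).trans_lt hMlt)
      (pResidual p M) rfl (f.comp g) (hf.comp hg) (pResidual_pResidual p M) (L.comap g) ⟨r, hr⟩
      ⟨n, h1⟩ (fun b => by
        rw [mem_comap, map_commutatorElement]
        exact h2 _)
  -- pass to an element of `M`
  by_contra hkL
  -- Passing to k^q moves the element into M without losing it: k has p-power order modulo L and q
  -- is prime to p.
  have hkq : k ^ q ∉ L := fun h => hkL (mem_of_pow_mem_of_coprime (hcop.pow_left j) hk h)
  have hkqb : ∀ b, ⁅k ^ q, b⁆ ∈ L := by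
    intro b
    have h1 := (QuotientGroup.eq_one_iff _).2 (hkb b)
    rw [← QuotientGroup.eq_one_iff]
    rw [← QuotientGroup.mk'_apply, map_commutatorElement,
      commutatorElement_eq_one_iff_commute] at h1 ⊢
    rw [map_pow]
    exact h1.pow_left q
  have hkqM : k ^ q ∈ M := pow_index_mem M k
  have hkqj : (k ^ q) ^ p ^ j ∈ L := by
    rw [← pow_mul, mul_comm, pow_mul]
    exact L.pow_mem hk q
  generalize k ^ q = k' at hkq hkqb hkqM hkqj
  have hLR : k' ∉ L ⊔ R := by
    intro h
    obtain ⟨l, hl, r, hr, rfl⟩ := mem_sup_of_normal_right.1 h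
    refine hkq (L.mul_mem hl (hRfac r hr ⟨j, ?_⟩ fun b => ?_))
    · rw [← QuotientGroup.eq_one_iff] at hkqj ⊢
      rwa [QuotientGroup.mk_pow, QuotientGroup.mk_mul, (QuotientGroup.eq_one_iff l).2 hl,
        one_mul, ← QuotientGroup.mk_pow] at hkqj
    · have h1 := (QuotientGroup.eq_one_iff _).2 (hkqb b)
      rw [← QuotientGroup.eq_one_iff]
      rw [← QuotientGroup.mk'_apply, map_commutatorElement] at h1 ⊢
      rwa [map_mul, QuotientGroup.mk'_apply L l, (QuotientGroup.eq_one_iff l).2 hl, one_mul] at h1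
  have hLRn : (L ⊔ R).Normal := inferInstance
  -- a Sylow subgroup of `M`, and an element normalizing it
  obtain ⟨P₀⟩ : Nonempty (Sylow p M) := inferInstance
  let P := (P₀ : Subgroup M).map M.subtype
  have hPp : IsPGroup p P := P₀.2.map _
  have hPR : P ⊔ R = M := by
    rw [← Subgroup.map_sup, sylow_sup_eq_top P₀ (fun m => exists_pow_mem_pResidual p m),
      ← MonoidHom.range_eq_map, range_subtype]
  have hfr := Sylow.normalizer_sup_eq_top P₀
  obtain ⟨a, haM⟩ : ∃ a : Γ, a ∉ M := by
    by_contra! h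
    rw [hq, (eq_top_iff' M).2 h, index_top] at hMi
    exact Nat.not_prime_one hMi
  -- By the Frattini argument an element outside M can be chosen to normalize P; x is a power of it
  -- that has q-power order and stays outside M.
  obtain ⟨x, hxP, hxM, s, hx⟩ : ∃ x ∈ normalizer (P : Set Γ), x ∉ M ∧ ∃ s, x ^ q ^ s = 1 := by
    obtain ⟨c, hc, m, hm, rfl⟩ := mem_sup_of_normal_right.1 (hfr ▸ mem_top a)
    have hcM : c ∉ M := fun h => haM (M.mul_mem h hm)
    obtain ⟨i, s, h1, h2⟩ := exists_pow_not_mem hMi hq.symm hcM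
    exact ⟨c ^ i, Subgroup.pow_mem _ hc i, h1, s, h2⟩
  let D := P ⊔ zpowers x
  have hMD : M ⊔ zpowers x = ⊤ := by
    have h1 : (M ⊔ zpowers x).index ∣ q := index_dvd_of_le le_sup_left
    rcases (Nat.dvd_prime hMi).1 h1 with h2 | h2
    · exact index_eq_one.1 h2
    · exfalso
      have h3 := Subgroup.relIndex_mul_index (le_sup_left : M ≤ M ⊔ zpowers x)
      rw [h2, ← hq, Nat.mul_eq_right hMi.pos.ne', relIndex_eq_one] at h3
      exact hxM (h3 (mem_sup_right (mem_zpowers x)))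
  have hRD : R ⊔ D = ⊤ := by
    rw [← sup_assoc, sup_comm R P, hPR, hMD]
  obtain ⟨y, hyP, r, hrR, rfl⟩ := mem_sup_of_normal_right.1 (hPR ▸ hkqM)
  have hyL : y ∉ L ⊔ R := fun h => hLR (mul_mem h (mem_sup_right hrR))
  have hyb : ∀ b, ⁅y, b⁆ ∈ L ⊔ R :=
    commutatorElement_mem_of_mul_mem (fun b => mem_sup_left (hkqb b)) (mem_sup_right hrR)
  have hyD : y ∈ D := mem_sup_left hyP
  -- the image of `O^p(D)` is everything modulo `R`
  obtain ⟨b, hbD, r', hr', hb⟩ : ∃ b ∈ pResidual p D, ∃ r' ∈ R, (b : Γ) * r' = y := by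
    have hsur : Function.Surjective ((QuotientGroup.mk' R).comp D.subtype) := by
      intro z
      obtain ⟨z, rfl⟩ := QuotientGroup.mk'_surjective R z
      obtain ⟨u, hu, v, hv, rfl⟩ := mem_sup_of_normal_left.1 (hRD ▸ mem_top z)
      refine ⟨⟨v, hv⟩, ?_⟩
      change QuotientGroup.mk' R v = QuotientGroup.mk' R (u * v)
      rw [map_mul, QuotientGroup.mk'_apply R u, (QuotientGroup.eq_one_iff u).2 hu, one_mul]
    have h1 := map_pResidual (p := p) _ hsur
    rw [← map_pResidual (p := p) _ (QuotientGroup.mk'_surjective R), hr,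
      map_top_of_surjective _ (QuotientGroup.mk'_surjective R)] at h1
    obtain ⟨b, hb, hby⟩ : (QuotientGroup.mk' R y) ∈ (pResidual p D).map _ := h1 ▸ mem_top _
    exact ⟨b, hb, (b : Γ)⁻¹ * y, QuotientGroup.eq.1 hby, by group⟩
  have hbL : (b : Γ) ∉ L ⊔ R := fun h => hyL (hb ▸ mul_mem h (mem_sup_right hr'))
  have hbb : ∀ c, ⁅(b : Γ), c⁆ ∈ L ⊔ R :=
    commutatorElement_mem_of_mul_mem (fun c => hb ▸ hyb c) (mem_sup_right hr')
  have hbp : ∃ n : ℕ, (b : Γ) ^ p ^ n ∈ L ⊔ R := by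
    obtain ⟨n, hn⟩ := hPp ⟨y, hyP⟩
    refine ⟨n, ?_⟩
    have hn : y ^ p ^ n = 1 := congrArg Subtype.val hn
    rw [← hb] at hn
    rw [← QuotientGroup.eq_one_iff]
    have h2 : ((r' : Γ) : Γ ⧸ (L ⊔ R)) = 1 := (QuotientGroup.eq_one_iff _).2 (mem_sup_right hr')
    have h3 := congrArg (QuotientGroup.mk' (L ⊔ R)) hn
    rwa [map_pow, map_mul, map_one, QuotientGroup.mk'_apply _ r', h2, mul_one] at h3
  let g : pResidual p D →* Γ := D.subtype.comp (pResidual p D).subtype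
  have hg : Function.Injective g := D.subtype_injective.comp (pResidual p D).subtype_injective
  -- If O^p(D) were smaller than Γ, induction would put b in LR. Hence D is everything and
  -- normalizes P.
  have hcard : ¬ Nat.card (pResidual p D) < Nat.card Γ := by
    intro hlt
    exact hbL (ih _ hlt (pResidual p D) rfl (f.comp g) (hf.comp hg) (pResidual_pResidual p D)
      ((L ⊔ R).comap g) ⟨b, hbD⟩ hbp (fun c => by
        rw [mem_comap, map_commutatorElement]
        exact hbb _))
  have hD : D = ⊤ := by
    refine eq_top_of_le_card _ ((not_lt.1 hcard).trans ?_)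
    exact Nat.le_of_dvd Nat.card_pos (card_subgroup_dvd_card _)
  have hPn : P.Normal := by
    rw [← normalizer_eq_top_iff, eq_top_iff, ← hD]
    exact sup_le le_normalizer (zpowers_le.2 hxP)
  exact hyL (mem_of_sup_zpowers hG hp hMi hpq hf hr hPp hx hD hyP hyb)

theorem SubnormallyMonomial.classX : Contained SubnormallyMonomial.{u} ClassX := by
  intro G _ _ hG
  refine ⟨hG.isSolvable, fun p hp _ A h => ?_⟩
  rw [HasCentralPFactor_iff] at h
  obtain ⟨L, K, hL, -, hlt, h1, h2⟩ := h
  refine hlt.not_ge fun k hk => ?_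
  exact hG.mem_of_pResidual_eq_top hp _ (pResidual p A) rfl
    (A.subtype.comp (pResidual p A).subtype)
    (A.subtype_injective.comp (pResidual p A).subtype_injective) (pResidual_pResidual p A) L k
    (h1 k hk) (h2 k hk)

end MonomialClasses

namespace MonomialClasses

open Subgroup

open scoped commutatorElement

/-! ### The semidirect product of the Heisenberg group and the group of units of a ring -/

/-- The semidirect product of the Heisenberg group of matrices `(1, a, c; 0, 1, b; 0, 0, 1)` over
`R` and `Rˣ`, with `u` acting by `(a, b, c) ↦ (u a, u b, u² c)`. -/
@[ext]
structure HeisenbergUnits (R : Type u) [CommRing R] where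
  unit : Rˣ
  a : R
  b : R
  c : R

namespace HeisenbergUnits

variable {R : Type u} [CommRing R]

instance : Mul (HeisenbergUnits R) :=
  ⟨fun x y => ⟨x.unit * y.unit, x.a + x.unit * y.a, x.b + x.unit * y.b,
    x.c + x.unit ^ 2 * y.c + x.a * x.unit * y.b⟩⟩

instance : One (HeisenbergUnits R) := ⟨⟨1, 0, 0, 0⟩⟩

instance : Inv (HeisenbergUnits R) :=
  ⟨fun x => ⟨x.unit⁻¹, -((x.unit⁻¹ : Rˣ) * x.a), -((x.unit⁻¹ : Rˣ) * x.b),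
    (x.unit⁻¹ : Rˣ) ^ 2 * (x.a * x.b - x.c)⟩⟩

@[simp] lemma mul_unit (x y : HeisenbergUnits R) : (x * y).unit = x.unit * y.unit := rfl
@[simp] lemma mul_a (x y : HeisenbergUnits R) : (x * y).a = x.a + x.unit * y.a := rfl
@[simp] lemma mul_b (x y : HeisenbergUnits R) : (x * y).b = x.b + x.unit * y.b := rfl
@[simp] lemma mul_c (x y : HeisenbergUnits R) :
    (x * y).c = x.c + x.unit ^ 2 * y.c + x.a * x.unit * y.b := rfl
@[simp] lemma one_unit : (1 : HeisenbergUnits R).unit = 1 := rfl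
@[simp] lemma one_a : (1 : HeisenbergUnits R).a = 0 := rfl
@[simp] lemma one_b : (1 : HeisenbergUnits R).b = 0 := rfl
@[simp] lemma one_c : (1 : HeisenbergUnits R).c = 0 := rfl
@[simp] lemma inv_unit (x : HeisenbergUnits R) : x⁻¹.unit = x.unit⁻¹ := rfl
@[simp] lemma inv_a (x : HeisenbergUnits R) : x⁻¹.a = -((x.unit⁻¹ : Rˣ) * x.a) := rfl
@[simp] lemma inv_b (x : HeisenbergUnits R) : x⁻¹.b = -((x.unit⁻¹ : Rˣ) * x.b) := rfl
@[simp] lemma inv_c (x : HeisenbergUnits R) :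
    x⁻¹.c = (x.unit⁻¹ : Rˣ) ^ 2 * (x.a * x.b - x.c) := rfl

instance : Group (HeisenbergUnits R) :=
  Group.ofLeftAxioms
    (fun x y z => by
      ext <;> simp only [mul_unit, mul_a, mul_b, mul_c, Units.val_mul] <;> ring)
    (fun x => by ext <;> simp)
    (fun x => by
      have h : ((x.unit⁻¹ : Rˣ) : R) * x.unit = 1 := x.unit.inv_mul
      ext
      · simp
      · simp
      · simp
      · simp only [mul_c, inv_c, inv_a, inv_unit, one_c]
        ring)

instance [Finite R] : Finite (HeisenbergUnits R) :=
  Finite.of_injective (fun x => (x.unit, x.a, x.b, x.c)) fun x y h => by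
    simp only [Prod.mk.injEq] at h
    exact HeisenbergUnits.ext h.1 h.2.1 h.2.2.1 h.2.2.2

/-- The projection onto the group of units. -/
def toUnit : HeisenbergUnits R →* Rˣ where
  toFun := unit
  map_one' := rfl
  map_mul' _ _ := rfl

@[simp] lemma toUnit_apply (x : HeisenbergUnits R) : toUnit x = x.unit := rfl

lemma sq_of_unit_eq_one {x : HeisenbergUnits R} (hx : x.unit = 1) :
    x ^ 2 = ⟨1, 2 * x.a, 2 * x.b, 2 * x.c + x.a * x.b⟩ := by
  rw [sq]
  ext <;> simp [hx] <;> ring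

lemma pow_four_of_unit_eq_one (hF : (2 : R) = 0) {x : HeisenbergUnits R} (hx : x.unit = 1) :
    x ^ 4 = 1 := by
  have h : x ^ 4 = (x ^ 2) ^ 2 := by rw [← pow_mul]
  rw [h, sq_of_unit_eq_one hx, sq_of_unit_eq_one rfl]
  ext <;> simp [hF]

/-! #### The group of order `54` -/

lemma units_sq (u : (ZMod 3)ˣ) : ((u : ZMod 3)) ^ 2 = 1 := by
  revert u
  decide

lemma pow_of_unit_eq_one {x : HeisenbergUnits R} (hx : x.unit = 1) (ha : x.a * x.b = 0) (n : ℕ) :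
    x ^ n = ⟨1, n * x.a, n * x.b, n * x.c⟩ := by
  induction n with
  | zero => ext <;> simp
  | succ n ih =>
    rw [pow_succ, ih]
    ext
    · simp [hx]
    · simp only [mul_a, Units.val_one, Nat.cast_succ]
      ring
    · simp only [mul_b, Units.val_one, Nat.cast_succ]
      ring
    · simp only [mul_c, Units.val_one, Nat.cast_succ]
      linear_combination n * ha

/-- A normal series with cyclic factors if `R = ZMod 3`. -/
def series (R : Type u) [CommRing R] (i : ℕ) : Subgroup (HeisenbergUnits R) where
  carrier := {x | (i < 4 → x.unit = 1) ∧ (i < 3 → x.a = 0) ∧ (i < 2 → x.b = 0) ∧ (i < 1 → x.c = 0)}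
  one_mem' := by simp
  mul_mem' := by
    rintro x y ⟨h1, h2, h3, h4⟩ ⟨h1', h2', h3', h4'⟩
    refine ⟨fun h => ?_, fun h => ?_, fun h => ?_, fun h => ?_⟩
    · simp [h1 h, h1' h]
    · simp [h2 h, h2' h]
    · simp [h3 h, h3' h]
    · simp [h4 h, h4' h, h2 (by omega)]
  inv_mem' := by
    rintro x ⟨h1, h2, h3, h4⟩
    refine ⟨fun h => ?_, fun h => ?_, fun h => ?_, fun h => ?_⟩
    · simp [h1 h]
    · simp [h2 h]
    · simp [h3 h]
    · simp [h4 h, h2 (by omega)]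

lemma mem_series {i : ℕ} {x : HeisenbergUnits R} : x ∈ series R i ↔
    (i < 4 → x.unit = 1) ∧ (i < 3 → x.a = 0) ∧ (i < 2 → x.b = 0) ∧ (i < 1 → x.c = 0) := Iff.rfl

lemma series_normal (i : ℕ) : (series R i).Normal := by
  refine ⟨?_⟩
  rintro x ⟨h1, h2, h3, h4⟩ g
  have hg : (g.unit : R) * (g.unit⁻¹ : Rˣ) = 1 := g.unit.mul_inv
  refine ⟨fun h => ?_, fun h => ?_, fun h => ?_, fun h => ?_⟩
  · simp [h1 h]
  · simp [h2 h, h1 (by omega)]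
  · simp [h3 h, h1 (by omega)]
  · simp only [mul_c, mul_unit, mul_a, inv_c, inv_b, h1 (by omega), h2 (by omega), h3 (by omega),
      h4 h, mul_one, mul_zero, add_zero]
    linear_combination (g.a * g.b - g.c) * (g.unit * (g.unit⁻¹ : Rˣ) + 1) * hg -
      g.a * g.b * hg

lemma supersolvable_three : Supersolvable (HeisenbergUnits (ZMod 3)) := by
  refine ⟨4, series (ZMod 3), series_normal, ?_, ?_, fun i hi => ⟨?_, ?_⟩⟩
  · ext x
    simp [mem_series, HeisenbergUnits.ext_iff]
  · ext x
    simp [mem_series]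
  · rintro x ⟨h1, h2, h3, h4⟩
    exact ⟨fun h => h1 (by omega), fun h => h2 (by omega), fun h => h3 (by omega),
      fun h => h4 (by omega)⟩
  · have := series_normal (R := ZMod 3) i
    rw [isCyclic_quotient_subgroupOf_iff]
    have key : ∀ y : HeisenbergUnits (ZMod 3), y ∈ series (ZMod 3) (i + 1) → y.unit = 1 →
        y.a * y.b = 0 → (∀ x ∈ series (ZMod 3) (i + 1), ∃ k : ℕ,
          (⟨1, k * y.a, k * y.b, k * y.c⟩ : HeisenbergUnits (ZMod 3))⁻¹ * x ∈ series (ZMod 3) i) →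
        ∃ g ∈ series (ZMod 3) (i + 1), ∀ x ∈ series (ZMod 3) (i + 1),
          ∃ k : ℤ, (g ^ k)⁻¹ * x ∈ series (ZMod 3) i := by
      intro y hy hu hab h
      refine ⟨y, hy, fun x hx => ?_⟩
      obtain ⟨k, hk⟩ := h x hx
      exact ⟨k, by rwa [zpow_natCast, pow_of_unit_eq_one hu hab]⟩
    interval_cases i
    · refine key ⟨1, 0, 0, 1⟩ (by simp [mem_series]) rfl (by simp) fun x hx => ⟨x.c.val, ?_⟩
      simp only [mem_series] at hx
      simp [mem_series, hx]
    · refine key ⟨1, 0, 1, 0⟩ (by simp [mem_series]) rfl (by simp) fun x hx => ⟨x.b.val, ?_⟩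
      simp only [mem_series] at hx
      simp [mem_series, hx]
    · refine key ⟨1, 1, 0, 0⟩ (by simp [mem_series]) rfl (by simp) fun x hx => ⟨x.a.val, ?_⟩
      simp only [mem_series] at hx
      simp [mem_series, hx]
    -- The top factor is the group of units, generated by -1.
    · refine ⟨⟨-1, 0, 0, 0⟩, by simp [mem_series], fun x _ => ?_⟩
      have hu : x.unit = 1 ∨ x.unit = -1 := by
        generalize x.unit = u
        revert u
        decide
      rcases hu with hu | hu
      · exact ⟨0, by simp [mem_series, hu]⟩
      · exact ⟨1, by simp [mem_series, hu]⟩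

/-- Involutions lie in every normal subgroup with 3-group quotient, and here their products give the
whole group. -/
lemma pResidual_three : pResidual 3 (HeisenbergUnits (ZMod 3)) = ⊤ := by
  have := pResidual_normal 3 (HeisenbergUnits (ZMod 3))
  set N := pResidual 3 (HeisenbergUnits (ZMod 3))
  -- The last coordinate of the square of (-1, a, b, c) is 2c - ab, which for c = -ab is -3ab = 0.
  have hinv : ∀ a b, (⟨-1, a, b, -(a * b)⟩ : HeisenbergUnits (ZMod 3)) ∈ N := by
    intro a b
    obtain ⟨n, hn⟩ := exists_pow_mem_pResidual 3 (⟨-1, a, b, -(a * b)⟩ : HeisenbergUnits (ZMod 3))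
    refine mem_of_pow_mem_of_coprime (m := 3 ^ n) (n := 2) (Nat.Coprime.pow_left _ (by norm_num))
      hn ?_
    have : (⟨-1, a, b, -(a * b)⟩ : HeisenbergUnits (ZMod 3)) ^ 2 = 1 := by
      rw [sq]
      ext <;> simp
      have : (3 : ZMod 3) = 0 := rfl
      linear_combination (-a * b) * this
    rw [this]
    exact N.one_mem
  have h1 : ∀ a b, (⟨1, a, b, -(a * b)⟩ : HeisenbergUnits (ZMod 3)) ∈ N := by
    intro a b
    have h := N.mul_mem (hinv a b) (hinv 0 0)
    convert h using 1
    ext <;> simp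
  have hz : ∀ c, (⟨1, 0, 0, c⟩ : HeisenbergUnits (ZMod 3)) ∈ N := by
    intro c
    have h := N.mul_mem (N.mul_mem (h1 1 0) (h1 0 (2 * c))) (N.inv_mem (h1 1 (2 * c)))
    convert h using 1
    have : (3 : ZMod 3) = 0 := rfl
    ext <;> simp
    linear_combination (-c) * this
  rw [eq_top_iff]
  rintro x -
  have hu : x.unit = 1 ∨ x.unit = -1 := by
    generalize x.unit = u
    revert u
    decide
  have h2 := N.mul_mem (h1 x.a x.b) (hz (x.c + x.a * x.b))
  rcases hu with hu | hu
  · convert h2 using 1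
    ext <;> simp [hu]
  · convert N.mul_mem h2 (hinv 0 0) using 1
    ext <;> simp [hu]

/-- Units act on the last coordinate through their squares, which are 1 here, so that coordinate is
central. -/
lemma hasCentralPFactor_three : HasCentralPFactor 3 (HeisenbergUnits (ZMod 3)) := by
  have hc : ∀ c (b : HeisenbergUnits (ZMod 3)), Commute ⟨1, 0, 0, c⟩ b := by
    intro c b
    have := units_sq b.unit
    ext <;> simp [this, add_comm]
  have hn : (zpowers (⟨1, 0, 0, 1⟩ : HeisenbergUnits (ZMod 3))).Normal := by
    refine ⟨?_⟩
    rintro _ ⟨i, rfl⟩ g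
    have h := ((hc 1 g).zpow_left i).eq
    simp only
    rw [← h, mul_inv_cancel_right]
    exact ⟨i, rfl⟩
  refine HasCentralPFactor_iff.2 ⟨⊥, zpowers ⟨1, 0, 0, 1⟩, inferInstance, hn, ?_, ?_, ?_⟩
  · rw [bot_lt_iff_ne_bot, Ne, zpowers_eq_bot]
    intro h
    exact absurd (congrArg c h) (by decide)
  · rintro _ ⟨i, rfl⟩
    refine ⟨1, ?_⟩
    have h3 : (⟨1, 0, 0, 1⟩ : HeisenbergUnits (ZMod 3)) ^ 3 = 1 := by
      rw [pow_succ, sq_of_unit_eq_one rfl]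
      ext <;> simp <;> rfl
    rw [mem_bot, pow_one]
    simp only
    rw [← zpow_natCast, ← zpow_mul, mul_comm, zpow_mul, zpow_natCast, h3, one_zpow]
  · rintro _ ⟨i, rfl⟩ b
    rw [mem_bot, commutatorElement_eq_one_iff_commute]
    exact (hc 1 b).zpow_left i

end HeisenbergUnits

open HeisenbergUnits in
theorem not_aBySup_le_classX : ¬ Contained ABySup.{0} ClassX := by
  intro h
  let G := HeisenbergUnits (ZMod 3)
  have h1 : ABySup G := by
    refine ⟨⊥, inferInstance, ⟨inferInstance, fun p _ P => ⟨⟨fun a b => ?_⟩⟩⟩,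
      supersolvable_three.of_surjective _ (QuotientGroup.mk'_surjective _)⟩
    exact Subtype.ext (Subsingleton.elim _ _)
  have h3 : 3 ∣ Nat.card G := by
    have h : orderOf (⟨1, 0, 0, 1⟩ : G) = 3 := by
      have : Fact (Nat.Prime 3) := ⟨Nat.prime_three⟩
      refine orderOf_eq_prime ?_ (fun h => absurd (congrArg HeisenbergUnits.c h) (by decide))
      rw [pow_succ, sq_of_unit_eq_one rfl]
      ext <;> simp <;> rfl
    exact h ▸ orderOf_dvd_natCard _
  refine (h G h1).2 3 Nat.prime_three h3 ⊤ ?_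
  let f : pResidual 3 (⊤ : Subgroup G) →* G :=
    (⊤ : Subgroup G).subtype.comp (pResidual 3 (⊤ : Subgroup G)).subtype
  refine hasCentralPFactor_three.of_surjective (f := f) fun g => ?_
  have h4 := map_pResidual (p := 3) (topEquiv (G := G)).toMonoidHom topEquiv.surjective
  rw [pResidual_three] at h4
  obtain ⟨x, hx, hxg⟩ : g ∈ (pResidual 3 (⊤ : Subgroup G)).map _ := h4 ▸ mem_top g
  exact ⟨⟨x, hx⟩, hxg⟩

/-! #### The group of order `192` -/

namespace HeisenbergUnits

section Four

variable {F : Type u} [Field F] [Finite F]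

lemma one_add_unit_add_sq (hF : Nat.card F = 4) {u : Fˣ} (hu : u ≠ 1) :
    1 + (u : F) + (u : F) ^ 2 = 0 := by
  have := Fintype.ofFinite F
  have h1 := FiniteField.pow_card_sub_one_eq_one (u : F) u.ne_zero
  rw [← Nat.card_eq_fintype_card, hF] at h1
  have h2 : (u : F) - 1 ≠ 0 := fun h => hu (Units.ext (by simpa using sub_eq_zero.1 h))
  have h3 : ((u : F) - 1) * (1 + (u : F) + (u : F) ^ 2) = 0 := by
    linear_combination h1
  exact (mul_eq_zero.1 h3).resolve_left h2

/-- The unit is a primitive cube root of unity, so 1 + u + u² = 0 annihilates every coordinate of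
the cube. -/
lemma pow_three_of_unit_ne_one (hF : Nat.card F = 4) {x : HeisenbergUnits F} (hx : x.unit ≠ 1) :
    x ^ 3 = 1 := by
  have h := one_add_unit_add_sq hF hx
  rw [pow_succ, sq]
  ext
  · simp only [mul_unit, one_unit, Units.val_mul, Units.val_one]
    linear_combination ((x.unit : F) - 1) * h
  · simp only [mul_a, mul_unit, one_a, Units.val_mul]
    linear_combination x.a * h
  · simp only [mul_b, mul_unit, one_b, Units.val_mul]
    linear_combination x.b * h
  · simp only [mul_c, mul_a, mul_unit, one_c, Units.val_mul]
    linear_combination (x.c * (1 - x.unit + (x.unit : F) ^ 2) + x.a * x.b * x.unit) * h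

lemma two_eq_zero (hF : Nat.card F = 4) : (2 : F) = 0 := by
  have := Fintype.ofFinite F
  have h : ((Fintype.card F : ℕ) : F) = 0 := Nat.cast_card_eq_zero F
  rw [← Nat.card_eq_fintype_card, hF] at h
  have h2 : (2 : F) * 2 = 0 := by
    norm_num
    exact_mod_cast h
  exact mul_self_eq_zero.1 h2

/-- An element of `2`-power order modulo `L` that commutes modulo `L` with an element outside of
the Heisenberg group is trivial modulo `L`. -/
lemma mem_of_commute (hF : Nat.card F = 4) {B : Type u} [Group B]
    {φ : B →* HeisenbergUnits F} (hφ : Function.Injective φ) {L : Subgroup B} [L.Normal] {k t : B}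
    (ht : (φ t).unit ≠ 1) {n : ℕ} (hk : k ^ 2 ^ n ∈ L)
    (hkt : ⁅k, t⁆ ∈ L) : k ∈ L := by
  refine mem_of_pow_mem_of_coprime (m := 2 ^ n) (n := 3) (Nat.Coprime.pow_left _ (by norm_num))
    hk ?_
  by_cases hu : (φ k).unit = 1
  · have h1 : (k * t) ^ 3 = 1 := hφ (by
      rw [map_pow, map_one, pow_three_of_unit_ne_one hF (by simpa [hu])])
    have h2 : t ^ 3 = 1 := hφ (by rw [map_pow, map_one, pow_three_of_unit_ne_one hF ht])
    have h3 : Commute (QuotientGroup.mk' L k) (QuotientGroup.mk' L t) := by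
      rw [← commutatorElement_eq_one_iff_commute, ← map_commutatorElement]
      exact (QuotientGroup.eq_one_iff _).2 hkt
    have h4 := congrArg (QuotientGroup.mk' L) h1
    rw [map_pow, map_mul, h3.mul_pow, ← map_pow, ← map_pow, h2, map_one, mul_one] at h4
    exact (QuotientGroup.eq_one_iff _).1 h4
  · have : k ^ 3 = 1 := hφ (by rw [map_pow, map_one, pow_three_of_unit_ne_one hF hu])
    rw [this]
    exact L.one_mem

lemma isPGroup_ker_toUnit (hF : Nat.card F = 4) : IsPGroup 2 (toUnit (R := F)).ker := by
  rintro ⟨x, hx⟩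
  exact ⟨2, Subtype.ext (pow_four_of_unit_eq_one (two_eq_zero hF) hx)⟩

/-- For p = 2, either A is a 2-group with trivial O^2, or O^2(A) contains an element acting without
fixed points and `mem_of_commute` applies. For p = 3, O^3(A) lies in the Heisenberg 2-group. For
other p all orders divide 12. -/
lemma classX_of_card_eq_four (hF : Nat.card F = 4) : ClassX (HeisenbergUnits F) := by
  have h2 := two_eq_zero hF
  have hP := isPGroup_ker_toUnit hF
  have : Fact (Nat.Prime 2) := ⟨Nat.prime_two⟩
  refine ⟨?_, fun p hp _ A h => ?_⟩
  · have : Group.IsSolvable (toUnit (R := F)).ker := by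
      have := hP.isNilpotent
      infer_instance
    exact Group.isSolvable_of_ker_le_range (toUnit (R := F)).ker.subtype (toUnit (R := F))
      (by rw [range_subtype])
  · rw [HasCentralPFactor_iff] at h
    obtain ⟨L, K, hL, hK, hlt, h1, h3⟩ := h
    have := pResidual_normal p A
    obtain ⟨k, hk, hkL⟩ := SetLike.exists_of_lt hlt
    obtain ⟨n, hn⟩ := h1 k hk
    by_cases hp2 : p = 2
    · subst hp2
      by_cases hA : ∃ a : A, (a : HeisenbergUnits F).unit ≠ 1
      · obtain ⟨t, ht⟩ := hA
        have ht3 : t ^ 3 = 1 := Subtype.ext (pow_three_of_unit_ne_one hF ht)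
        obtain ⟨m, hm⟩ := exists_pow_mem_pResidual 2 t
        have htB : t ∈ pResidual 2 A :=
          mem_of_pow_mem_of_coprime (m := 2 ^ m) (n := 3) (Nat.Coprime.pow_left _ (by norm_num))
            hm (ht3 ▸ one_mem _)
        exact hkL (mem_of_commute hF (φ := A.subtype.comp (pResidual 2 A).subtype)
          (A.subtype_injective.comp (pResidual 2 A).subtype_injective) (t := ⟨t, htB⟩) ht hn
          (h3 k hk _))
      · push Not at hA
        have : pResidual 2 A ≤ ⊥ := pResidual_le inferInstance fun a =>
          ⟨2, Subtype.ext (pow_four_of_unit_eq_one h2 (hA a))⟩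
        have hk1 : k = 1 := Subtype.ext (this k.2)
        exact hkL (hk1 ▸ L.one_mem)
    · by_cases hp3 : p = 3
      · subst hp3
        have hle : pResidual 3 A ≤ (toUnit.comp A.subtype).ker := pResidual_le inferInstance
          fun a => ⟨1, by
            by_cases ha : (a : HeisenbergUnits F).unit = 1
            · exact Subgroup.pow_mem _ ha _
            · have : a ^ 3 ^ 1 = 1 := Subtype.ext (pow_three_of_unit_ne_one hF ha)
              rw [this]
              exact one_mem _⟩
        have hk4 : k ^ 4 = 1 := Subtype.ext (Subtype.ext
          (pow_four_of_unit_eq_one h2 (hle k.2)))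
        exact hkL (mem_of_pow_mem_of_coprime (m := 3 ^ n) (n := 4)
          (Nat.Coprime.pow_left _ (by norm_num)) hn (hk4 ▸ L.one_mem))
      · have hk12 : k ^ 12 = 1 := by
          refine Subtype.ext (Subtype.ext ?_)
          change ((k : A) : HeisenbergUnits F) ^ 12 = 1
          by_cases hu : ((k : A) : HeisenbergUnits F).unit = 1
          · rw [show 12 = 4 * 3 from rfl, pow_mul, pow_four_of_unit_eq_one h2 hu, one_pow]
          · rw [show 12 = 3 * 4 from rfl, pow_mul, pow_three_of_unit_ne_one hF hu, one_pow]
        have hcop : Nat.Coprime p 12 := by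
          rw [show 12 = 2 ^ 2 * 3 from rfl]
          exact ((Nat.coprime_primes hp Nat.prime_two).2 hp2).pow_right 2 |>.mul_right
            ((Nat.coprime_primes hp Nat.prime_three).2 hp3)
        exact hkL (mem_of_pow_mem_of_coprime (m := p ^ n) (n := 12)
          (Nat.Coprime.pow_left _ hcop) hn (hk12 ▸ L.one_mem))

lemma eq_of_sq_eq_one_of_mem_zpowers {G : Type*} [Group G] [Finite G] {y a b : G}
    (ha : a ∈ zpowers y) (hb : b ∈ zpowers y) (ha2 : a ^ 2 = 1) (hb2 : b ^ 2 = 1) (ha1 : a ≠ 1)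
    (hb1 : b ≠ 1) : a = b := by
  classical
  have := Fintype.ofFinite (zpowers y)
  by_contra hab
  have h := IsCyclic.card_pow_eq_one_le (α := zpowers y) (n := 2) (by norm_num)
  have h1 : ({1, ⟨a, ha⟩, ⟨b, hb⟩} : Finset (zpowers y)).card = 3 := by
    rw [Finset.card_eq_three]
    exact ⟨_, _, _, fun h => ha1 (congrArg Subtype.val h).symm,
      fun h => hb1 (congrArg Subtype.val h).symm, fun h => hab (congrArg Subtype.val h), rfl⟩
  have h2 : ({1, ⟨a, ha⟩, ⟨b, hb⟩} : Finset (zpowers y)) ⊆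
      Finset.univ.filter (fun z => z ^ 2 = 1) := by
    intro z hz
    simp only [Finset.mem_insert, Finset.mem_singleton] at hz
    rw [Finset.mem_filter]
    refine ⟨Finset.mem_univ _, ?_⟩
    rcases hz with rfl | rfl | rfl
    · exact one_pow 2
    · exact Subtype.ext ha2
    · exact Subtype.ext hb2
  have := Finset.card_le_card h2
  omega

/-- Induction on the index. A cyclic normal subgroup of the quotient pulls back to M > N, and by
induction M contains the Heisenberg group P. The cyclic image of P has at most one involution, which
t must then fix; but t acts without fixed points, so P maps trivially. The argument is applied twice
because P has exponent dividing 4. -/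
lemma ker_toUnit_le_of_supersolvable (hF : Nat.card F = 4) (n : ℕ) :
    ∀ (N : Subgroup (HeisenbergUnits F)) [N.Normal], N.index = n →
      Supersolvable (HeisenbergUnits F ⧸ N) → (toUnit (R := F)).ker ≤ N := by
  have h2 := two_eq_zero hF
  obtain ⟨u, hu⟩ : ∃ u : Fˣ, u ≠ 1 := by
    have h : Nat.card Fˣ = 3 := by rw [Nat.card_units, hF]
    have : Nontrivial Fˣ := (Finite.one_lt_card_iff_nontrivial).1 (by omega)
    exact exists_ne 1
  let t : HeisenbergUnits F := ⟨u, 0, 0, 0⟩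
  induction n using Nat.strong_induction_on with
  | _ n ih =>
  intro N _ hn hs
  let π := QuotientGroup.mk' N
  have hπ : Function.Surjective π := QuotientGroup.mk'_surjective N
  have hmem : ∀ x, π x = 1 ↔ x ∈ N := fun x => QuotientGroup.eq_one_iff x
  rcases subsingleton_or_nontrivial (HeisenbergUnits F ⧸ N) with h | h
  · exact fun x _ => (hmem x).1 (Subsingleton.elim _ _)
  obtain ⟨y, hy, hyn⟩ := hs.exists_normal_zpowers
  let M := (zpowers y).comap π
  have hM : M.Normal := hyn.comap π
  have hNM : N < M := by
    refine lt_of_le_of_ne (fun x hx => ?_) fun h => ?_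
    · rw [mem_comap, (hmem x).2 hx]
      exact one_mem _
    · obtain ⟨x, rfl⟩ := hπ y
      have : x ∈ M := mem_zpowers (π x)
      exact hy ((hmem x).2 (h ▸ this))
  have hPM : (toUnit (R := F)).ker ≤ M := by
    refine ih M.index (hn ▸ index_strictAnti hNM) M rfl ?_
    exact hs.of_surjective (QuotientGroup.map N M (MonoidHom.id _) hNM.le)
      (fun z => by
        obtain ⟨z, rfl⟩ := QuotientGroup.mk'_surjective M z
        exact ⟨π z, rfl⟩)
  -- in the cyclic image there is at most one involution
  have key : ∀ k ∈ (toUnit (R := F)).ker, k ^ 2 ∈ N → k ∈ N := by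
    intro k hk hk2
    by_contra hkN
    have hconj : ∀ x, π (t * x * t⁻¹) = 1 ↔ π x = 1 := by
      intro x
      rw [map_mul, map_mul, map_inv, conj_eq_one_iff]
    have hkP' : t * k * t⁻¹ ∈ (toUnit (R := F)).ker := Normal.conj_mem inferInstance k hk t
    have heq : π (t * k * t⁻¹) = π k := by
      by_contra hne
      refine hne (eq_of_sq_eq_one_of_mem_zpowers (hPM hkP') (hPM hk) ?_ ?_
        (fun h => hkN ((hmem k).1 ((hconj k).1 h))) fun h => hkN ((hmem k).1 h))
      · rw [← map_pow, conj_pow, hconj, hmem]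
        exact hk2
      · rw [← map_pow, hmem]
        exact hk2
    refine hkN (mem_of_commute hF (φ := MonoidHom.id _) Function.injective_id (t := t) hu
      (n := 1) (by rwa [pow_one]) ?_)
    rw [← hmem, map_commutatorElement, commutatorElement_eq_one_iff_mul_comm]
    rw [map_mul, map_mul, map_inv, mul_inv_eq_iff_eq_mul] at heq
    exact heq.symm
  intro x hx
  refine key x hx (key _ (Subgroup.pow_mem _ hx 2) ?_)
  rw [← pow_mul, show 2 * 2 = 4 from rfl, pow_four_of_unit_eq_one h2 hx]
  exact one_mem _

lemma not_aBySup_of_card_eq_four (hF : Nat.card F = 4) : ¬ ABySup (HeisenbergUnits F) := by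
  rintro ⟨N, _, ⟨-, hN⟩, hs⟩
  have hle := ker_toUnit_le_of_supersolvable hF _ N rfl hs
  have hP : IsPGroup 2 ((toUnit (R := F)).ker.subgroupOf N) :=
    (isPGroup_ker_toUnit hF).comap_of_injective N.subtype N.subtype_injective
  obtain ⟨Q, hQ⟩ := hP.exists_le_sylow
  let x : N := ⟨⟨1, 1, 0, 0⟩, hle (by simp [MonoidHom.mem_ker])⟩
  let y : N := ⟨⟨1, 0, 1, 0⟩, hle (by simp [MonoidHom.mem_ker])⟩
  have hx : x ∈ Q := hQ (by simp [x, mem_subgroupOf, MonoidHom.mem_ker])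
  have hy : y ∈ Q := hQ (by simp [y, mem_subgroupOf, MonoidHom.mem_ker])
  have h := (hN 2 Nat.prime_two Q).is_comm.comm ⟨x, hx⟩ ⟨y, hy⟩
  have h' := congrArg (fun z : Q => ((z : N) : HeisenbergUnits F).c) h
  simp [x, y] at h'

end Four

end HeisenbergUnits

open HeisenbergUnits in
theorem not_classX_le_aBySup : ¬ Contained ClassX.{0} ABySup := by
  intro h
  have : Fact (Nat.Prime 2) := ⟨Nat.prime_two⟩
  have hF : Nat.card (GaloisField 2 2) = 4 := by
    rw [GaloisField.card 2 2 (by norm_num)]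
    norm_num
  exact not_aBySup_of_card_eq_four hF (h _ (classX_of_card_eq_four hF))

end MonomialClasses

namespace MonomialClasses

open Subgroup

open scoped commutatorElement

/-! ### A model of the group of order `1000` -/

/-- The semidirect product of the extraspecial group of order `125` and exponent `5` (vectors
`(a, b)` and a central coordinate `c`) with a cyclic group of order `8`. -/
@[ext]
structure Model where
  k : ZMod 8
  a : ZMod 5
  b : ZMod 5
  c : ZMod 5

namespace Model

/-- The diagonal entries of the `k`-th power of the matrix `(0, 4; 2, 0)`. -/
def diag (k : ZMod 8) : ZMod 5 := if k.val % 2 = 0 then 3 ^ (k.val / 2) else 0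

/-- The off-diagonal entries of the `k`-th power of the matrix `(0, 4; 2, 0)` are twice and four
times this number. -/
def off (k : ZMod 8) : ZMod 5 := if k.val % 2 = 0 then 0 else 3 ^ (k.val / 2)

/-- The determinant of the `k`-th power of the matrix `(0, 4; 2, 0)`. -/
def det (k : ZMod 8) : ZMod 5 := diag k ^ 2 - 4 * 2 * off k ^ 2

/-- The square of the matrix is the scalar 8 = 3, of order 4 modulo 5. So its powers have period 8,
and `diag`, `off` are coordinates with respect to the identity and the matrix. -/
lemma diag_add (k l : ZMod 8) : diag (k + l) = diag k * diag l + 4 * 2 * off k * off l := by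
  revert k l
  decide

lemma off_add (k l : ZMod 8) : off (k + l) = diag k * off l + off k * diag l := by
  revert k l
  decide

@[simp] lemma diag_zero : diag 0 = 1 := rfl
@[simp] lemma off_zero : off 0 = 0 := rfl
@[simp] lemma det_zero : det 0 = 1 := rfl

/-- The cocycle is the alternating form on the plane, which a matrix multiplies by its determinant.
Hence powers in the extraspecial part are computed coordinatewise, and commutators are twice the
form. -/
instance : Mul Model :=
  ⟨fun x y => ⟨x.k + y.k, x.a + (diag x.k * y.a + 4 * off x.k * y.b),
    x.b + (2 * off x.k * y.a + diag x.k * y.b),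
    x.c + det x.k * y.c + (x.a * (2 * off x.k * y.a + diag x.k * y.b) -
      x.b * (diag x.k * y.a + 4 * off x.k * y.b))⟩⟩

instance : One Model := ⟨⟨0, 0, 0, 0⟩⟩

instance : Inv Model :=
  ⟨fun x => ⟨-x.k, -(diag (-x.k) * x.a + 4 * off (-x.k) * x.b),
    -(2 * off (-x.k) * x.a + diag (-x.k) * x.b), -(det (-x.k) * x.c)⟩⟩

@[simp] lemma mul_k (x y : Model) : (x * y).k = x.k + y.k := rfl
@[simp] lemma mul_a (x y : Model) :
    (x * y).a = x.a + (diag x.k * y.a + 4 * off x.k * y.b) := rfl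
@[simp] lemma mul_b (x y : Model) :
    (x * y).b = x.b + (2 * off x.k * y.a + diag x.k * y.b) := rfl
@[simp] lemma mul_c (x y : Model) :
    (x * y).c = x.c + det x.k * y.c + (x.a * (2 * off x.k * y.a + diag x.k * y.b) -
      x.b * (diag x.k * y.a + 4 * off x.k * y.b)) := rfl
@[simp] lemma one_k : (1 : Model).k = 0 := rfl
@[simp] lemma one_a : (1 : Model).a = 0 := rfl
@[simp] lemma one_b : (1 : Model).b = 0 := rfl
@[simp] lemma one_c : (1 : Model).c = 0 := rfl
@[simp] lemma inv_k (x : Model) : x⁻¹.k = -x.k := rfl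
@[simp] lemma inv_a (x : Model) :
    x⁻¹.a = -(diag (-x.k) * x.a + 4 * off (-x.k) * x.b) := rfl
@[simp] lemma inv_b (x : Model) :
    x⁻¹.b = -(2 * off (-x.k) * x.a + diag (-x.k) * x.b) := rfl
@[simp] lemma inv_c (x : Model) : x⁻¹.c = -(det (-x.k) * x.c) := rfl

instance : Group Model :=
  Group.ofLeftAxioms
    (fun x y z => by
      ext
      · simp [add_assoc]
      · simp only [mul_a, mul_b, mul_k, diag_add, off_add]
        ring
      · simp only [mul_a, mul_b, mul_k, diag_add, off_add]
        ring
      · simp only [mul_a, mul_b, mul_c, mul_k, det, diag_add, off_add]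
        ring)
    (fun x => by ext <;> simp)
    (fun x => by
      ext
      · simp
      · simp
      · simp
      · simp only [mul_c, inv_k, inv_a, inv_b, inv_c, one_c]
        ring)


lemma card : Nat.card Model = 1000 := by
  let e : Model ≃ ZMod 8 × ZMod 5 × ZMod 5 × ZMod 5 :=
    { toFun := fun x => (x.k, x.a, x.b, x.c)
      invFun := fun x => ⟨x.1, x.2.1, x.2.2.1, x.2.2.2⟩
      left_inv := fun _ => rfl
      right_inv := fun _ => rfl }
  rw [Nat.card_congr e]
  simp

lemma pow_of_k_eq_zero {x : Model} (hx : x.k = 0) (n : ℕ) :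
    x ^ n = ⟨0, n * x.a, n * x.b, n * x.c⟩ := by
  induction n with
  | zero => ext <;> simp
  | succ n ih =>
    rw [pow_succ, ih]
    ext
    · simp [hx]
    · simp
      ring
    · simp
      ring
    · simp
      ring

/-- The images of the generators of the presentation. -/
def gen : Fin 6 → Model :=
  ![⟨1, 0, 0, 0⟩, ⟨2, 0, 0, 0⟩, ⟨4, 0, 0, 0⟩, ⟨0, 0, 1, 2⟩, ⟨0, 1, 4, 2⟩, ⟨0, 0, 0, 2⟩]

lemma lift_gen_eq_one (r : FreeGroup (Fin 6)) (hr : r ∈ relators1000) :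
    FreeGroup.lift gen r = 1 := by
  simp only [relators1000, Set.mem_insert_iff, Set.mem_singleton_iff] at hr
  rcases hr with rfl | rfl | rfl | rfl | rfl | rfl | rfl | rfl | rfl | rfl | rfl | rfl | rfl | rfl |
    rfl | rfl | rfl | rfl | rfl | rfl | rfl
  all_goals
    simp only [comm, x, map_mul, map_inv, map_pow, FreeGroup.lift_apply_of]
    ext <;> decide

end Model

/-- The homomorphism from the presented group to the model. -/
def toModel : SmallGroup1000 →* Model := PresentedGroup.toGroup Model.lift_gen_eq_one


/-! ### Normal forms and the order of the presented group -/

namespace SmallGroup1000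

/-- The generators. -/
def y (i : Fin 6) : SmallGroup1000 := PresentedGroup.of i

lemma mk_eq_one {r : FreeGroup (Fin 6)} (hr : r ∈ relators1000) :
    PresentedGroup.mk relators1000 r = 1 := PresentedGroup.one_of_mem hr

/-- These relations suffice for collecting words, since the second and third generators are powers
of the first. -/
lemma relations : y 0 ^ 2 = y 1 ∧ y 1 ^ 2 = y 2 ∧ y 2 ^ 2 = 1 ∧ y 3 ^ 5 = 1 ∧ y 4 ^ 5 = 1 ∧
    y 5 ^ 5 = 1 ∧ Commute (y 5) (y 3) ∧ Commute (y 5) (y 4) ∧ y 4 * y 3 = y 3 * y 4 * y 5 ∧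
    (y 0)⁻¹ * y 4 * y 0 = y 4 * (y 3 * y 4) ∧ (y 0)⁻¹ * y 5 * y 0 = y 5 ^ 3 ∧
    (y 0)⁻¹ * y 3 * y 0 = y 3 * (y 3 ^ 2 * y 4 ^ 3 * y 5 ^ 4) := by
  have hc : ∀ a b c : SmallGroup1000, a⁻¹ * b⁻¹ * a * b * c⁻¹ = 1 → b⁻¹ * a * b = a * c := by
    intro a b c h
    rw [mul_inv_eq_one] at h
    rw [← h]
    group
  have hy : ∀ i, PresentedGroup.mk relators1000 (x i) = y i := fun _ => rfl
  obtain ⟨F, hF⟩ : ∃ F : FreeGroup (Fin 6) → Prop,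
      ∀ r, F r ↔ PresentedGroup.mk relators1000 r = 1 := ⟨_, fun _ => Iff.rfl⟩
  have h : ∀ r ∈ relators1000, F r := fun r hr => (hF r).2 (mk_eq_one hr)
  simp only [relators1000, Set.mem_insert_iff, Set.mem_singleton_iff, forall_eq_or_imp, forall_eq,
    comm] at h
  simp only [hF, map_mul, map_inv, map_pow, hy] at h
  obtain ⟨h1, h2, h3, h4, h5, h6, h7, h8, h9, h10, h11, h12, h13, h14, h15, h16, h17, h18, h19,
    h20, h21⟩ := h
  have hcomm : ∀ a b : SmallGroup1000, a⁻¹ * b⁻¹ * a * b = 1 → Commute a b := by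
    intro a b h
    calc a * b = b * a * (a⁻¹ * b⁻¹ * a * b) := by group
      _ = b * a := by rw [h, mul_one]
  refine ⟨mul_inv_eq_one.1 h1, mul_inv_eq_one.1 h2, h4, h3, h5, h6, hcomm _ _ h11, hcomm _ _ h12,
    ?_, hc _ _ _ h14, ?_, hc _ _ _ h21⟩
  · have := hc _ _ _ h13
    rw [mul_assoc, inv_mul_eq_iff_eq_mul] at this
    rw [this, mul_assoc]
  · rw [hc _ _ _ h15, ← pow_succ']

/-- The submonoid of the normal forms in the last three generators. -/
def normalForms : Submonoid SmallGroup1000 where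
  carrier := {g | ∃ a b c : ℕ, g = y 3 ^ a * y 4 ^ b * y 5 ^ c}
  one_mem' := ⟨0, 0, 0, by simp⟩
  mul_mem' := by
    obtain ⟨-, -, -, -, -, -, h53, h54, h43, -⟩ := relations
    rintro _ _ ⟨a, b, c, rfl⟩ ⟨a', b', c', rfl⟩
    -- Moving `y 4 ^ b` past `y 3 ^ a'` creates one factor `y 5` per crossing, whence b * a'.
    refine ⟨a + a', b + b', c + c' + b * a', ?_⟩
    have h1 : ∀ b : ℕ, y 4 ^ b * y 3 = y 3 * y 4 ^ b * y 5 ^ b := by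
      intro b
      induction b with
      | zero => simp
      | succ b ih =>
        rw [pow_succ' (y 4), mul_assoc, ih, ← mul_assoc, ← mul_assoc, h43, pow_succ' (y 5)]
        simp only [mul_assoc]
        rw [← mul_assoc (y 5) (y 4 ^ b), (h54.pow_right b).eq]
        simp only [mul_assoc]
    have h2 : ∀ a : ℕ, y 4 ^ b * y 3 ^ a = y 3 ^ a * y 4 ^ b * y 5 ^ (b * a) := by
      intro a
      induction a with
      | zero => simp
      | succ a ih =>
        rw [pow_succ (y 3), ← mul_assoc, ih, mul_assoc _ _ (y 3), (h53.pow_left (b * a)).eq,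
          ← mul_assoc, mul_assoc _ (y 4 ^ b), h1, mul_add, mul_one, pow_add, pow_mul_comm (y 5)]
        simp only [mul_assoc]
    have h3 : Commute (y 5 ^ c) (y 3 ^ a' * y 4 ^ b') :=
      ((h53.pow_pow c a').mul_right (h54.pow_pow c b'))
    calc y 3 ^ a * y 4 ^ b * y 5 ^ c * (y 3 ^ a' * y 4 ^ b' * y 5 ^ c')
        = y 3 ^ a * y 4 ^ b * (y 5 ^ c * (y 3 ^ a' * y 4 ^ b')) * y 5 ^ c' := by
          simp only [mul_assoc]
      _ = y 3 ^ a * (y 4 ^ b * y 3 ^ a') * y 4 ^ b' * (y 5 ^ c * y 5 ^ c') := by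
          rw [h3.eq]
          simp only [mul_assoc]
      _ = y 3 ^ a * (y 3 ^ a' * y 4 ^ b) * (y 5 ^ (b * a') * y 4 ^ b') * (y 5 ^ c * y 5 ^ c') := by
          rw [h2]
          simp only [mul_assoc]
      _ = _ := by
          rw [(h54.pow_pow (b * a') b').eq, add_comm (c + c'), pow_add, pow_add, pow_add, pow_add]
          simp only [mul_assoc]

lemma exists_normal_form (g : SmallGroup1000) :
    ∃ i a b c : ℕ, g = y 0 ^ i * (y 3 ^ a * y 4 ^ b * y 5 ^ c) := by
  obtain ⟨h01, h12, h2, h3, h4, h5, h53, h54, h43, c4, c5, c3⟩ := relations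
  have m3 : y 3 ∈ normalForms := ⟨1, 0, 0, by simp⟩
  have m4 : y 4 ∈ normalForms := ⟨0, 1, 0, by simp⟩
  have m5 : y 5 ∈ normalForms := ⟨0, 0, 1, by simp⟩
  have hconj : ∀ g ∈ normalForms, (y 0)⁻¹ * g * y 0 ∈ normalForms := by
    have hm : ∀ g h : SmallGroup1000, (y 0)⁻¹ * (g * h) * y 0 =
      ((y 0)⁻¹ * g * y 0) * ((y 0)⁻¹ * h * y 0) := fun g h => by group
    have hp : ∀ (g : SmallGroup1000) (n : ℕ), (y 0)⁻¹ * g ^ n * y 0 = ((y 0)⁻¹ * g * y 0) ^ n := by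
      intro g n
      have := conj_pow (i := n) (a := (y 0)⁻¹) (b := g)
      rw [inv_inv] at this
      exact this.symm
    rintro _ ⟨a, b, c, rfl⟩
    rw [hm, hm, hp, hp, hp, c3, c4, c5]
    have hh := normalForms.mul_mem m3 (normalForms.mul_mem (normalForms.mul_mem
      (normalForms.pow_mem m3 2) (normalForms.pow_mem m4 3)) (normalForms.pow_mem m5 4))
    have hh' := normalForms.mul_mem m4 (normalForms.mul_mem m3 m4)
    exact normalForms.mul_mem (normalForms.mul_mem (normalForms.pow_mem hh a)
      (normalForms.pow_mem hh' b)) (normalForms.pow_mem (normalForms.pow_mem m5 3) c)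
  have hconj' : ∀ j : ℕ, ∀ g ∈ normalForms, ∃ h ∈ normalForms, g * y 0 ^ j = y 0 ^ j * h := by
    intro j
    induction j with
    | zero => exact fun g hg => ⟨g, hg, by simp⟩
    | succ j ih =>
      intro g hg
      obtain ⟨h, hh, he⟩ := ih g hg
      exact ⟨_, hconj h hh, by rw [pow_succ, ← mul_assoc, he]; group⟩
  let S : Submonoid SmallGroup1000 :=
    { carrier := {g | ∃ i : ℕ, ∃ h ∈ normalForms, g = y 0 ^ i * h}
      one_mem' := ⟨0, 1, one_mem _, by simp⟩
      mul_mem' := by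
        rintro _ _ ⟨i, h, hh, rfl⟩ ⟨j, h', hh', rfl⟩
        obtain ⟨k, hk, he⟩ := hconj' j h hh
        refine ⟨i + j, k * h', mul_mem hk hh', ?_⟩
        rw [mul_assoc, ← mul_assoc h, he, pow_add]
        simp only [mul_assoc] }
  have hN : normalForms ≤ S := fun g hg => ⟨0, g, hg, by simp⟩
  have s0 : y 0 ∈ S := ⟨1, 1, one_mem _, by simp⟩
  have hS : ∀ i, y i ∈ S := by
    intro i
    fin_cases i
    · exact s0
    · exact h01 ▸ S.pow_mem s0 2
    · exact h12 ▸ h01 ▸ S.pow_mem (S.pow_mem s0 2) 2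
    · exact hN m3
    · exact hN m4
    · exact hN m5
  -- The generators have orders dividing 8 or 5, so inverses are 39th powers and a submonoid
  -- containing the generators is everything.
  have hpow : ∀ i, y i ^ 40 = 1 := by
    have h1 : y 1 ^ 4 = 1 := by rw [show 4 = 2 * 2 from rfl, pow_mul, h12, h2]
    intro i
    fin_cases i
    · change y 0 ^ 40 = 1
      rw [show 40 = 2 * 4 * 5 from rfl, pow_mul, pow_mul, h01, h1, one_pow]
    · change y 1 ^ 40 = 1
      rw [show 40 = 4 * 10 from rfl, pow_mul, h1, one_pow]
    · change y 2 ^ 40 = 1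
      rw [show 40 = 2 * 20 from rfl, pow_mul, h2, one_pow]
    · change y 3 ^ 40 = 1
      rw [show 40 = 5 * 8 from rfl, pow_mul, h3, one_pow]
    · change y 4 ^ 40 = 1
      rw [show 40 = 5 * 8 from rfl, pow_mul, h4, one_pow]
    · change y 5 ^ 40 = 1
      rw [show 40 = 5 * 8 from rfl, pow_mul, h5, one_pow]
  have hg : g ∈ S := by
    have hcl : g ∈ closure (Set.range (PresentedGroup.of : Fin 6 → SmallGroup1000)) :=
      PresentedGroup.closure_range_of relators1000 ▸ mem_top g
    induction hcl using closure_induction'' with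
    | one => exact one_mem S
    | mem g hg =>
      obtain ⟨i, rfl⟩ := hg
      exact hS i
    | inv_mem g hg =>
      obtain ⟨i, rfl⟩ := hg
      have : (y i)⁻¹ = y i ^ 39 := by rw [inv_eq_iff_mul_eq_one, ← pow_succ', hpow]
      change (y i)⁻¹ ∈ S
      rw [this]
      exact S.pow_mem (hS i) 39
    | mul g h _ _ hg hh => exact S.mul_mem hg hh
  obtain ⟨i, _, ⟨a, b, c, rfl⟩, rfl⟩ := hg
  exact ⟨i, a, b, c, rfl⟩

lemma exists_surjective : ∃ f : Fin 8 × Fin 5 × Fin 5 × Fin 5 → SmallGroup1000,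
    Function.Surjective f := by
  obtain ⟨h01, h12, h2, h3, h4, h5, -⟩ := relations
  have h0 : y 0 ^ 8 = 1 := by
    rw [show 8 = 2 * 2 * 2 from rfl, pow_mul, pow_mul, h01, h12, h2]
  refine ⟨fun t => y 0 ^ (t.1 : ℕ) * (y 3 ^ (t.2.1 : ℕ) * y 4 ^ (t.2.2.1 : ℕ) *
    y 5 ^ (t.2.2.2 : ℕ)), fun g => ?_⟩
  obtain ⟨i, a, b, c, rfl⟩ := exists_normal_form g
  refine ⟨(⟨i % 8, Nat.mod_lt _ (by norm_num)⟩, ⟨a % 5, Nat.mod_lt _ (by norm_num)⟩,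
    ⟨b % 5, Nat.mod_lt _ (by norm_num)⟩, ⟨c % 5, Nat.mod_lt _ (by norm_num)⟩), ?_⟩
  simp only
  rw [← pow_eq_pow_mod i h0, ← pow_eq_pow_mod a h3, ← pow_eq_pow_mod b h4, ← pow_eq_pow_mod c h5]

instance : Finite SmallGroup1000 :=
  let ⟨_, hf⟩ := exists_surjective
  Finite.of_surjective _ hf

lemma card_le : Nat.card SmallGroup1000 ≤ 1000 := by
  obtain ⟨f, hf⟩ := exists_surjective
  have := Nat.card_le_card_of_surjective f hf
  simpa [Nat.card_prod] using this

lemma toModel_y (i : Fin 6) : toModel (y i) = Model.gen i :=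
  PresentedGroup.toGroup.of Model.lift_gen_eq_one

lemma toModel_surjective : Function.Surjective toModel := by
  intro g
  -- The exponents solve a triangular system: `gen 4` supplies the coordinate a together with 4a in
  -- b, `gen 3` corrects b, and `gen 5`, whose entry is 2, corrects c after multiplication by 3, the
  -- inverse of 2.
  refine ⟨y 5 ^ (3 * (g.c - 2 * g.a - 2 * (g.b - 4 * g.a) - g.a * (g.b - 4 * g.a))).val *
    y 4 ^ g.a.val * y 3 ^ (g.b - 4 * g.a).val * y 0 ^ g.k.val, ?_⟩
  have h0 : ∀ n : ℕ, Model.gen 0 ^ n = ⟨n, 0, 0, 0⟩ := by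
    intro n
    induction n with
    | zero => rfl
    | succ n ih =>
      rw [pow_succ, ih]
      ext <;> simp [Model.gen]
  simp only [map_mul, map_pow, toModel_y, h0]
  rw [Model.pow_of_k_eq_zero (x := Model.gen 5) rfl, Model.pow_of_k_eq_zero (x := Model.gen 4) rfl,
    Model.pow_of_k_eq_zero (x := Model.gen 3) rfl]
  have h5 : (5 : ZMod 5) = 0 := rfl
  simp only [ZMod.natCast_val, ZMod.cast_id', id_eq]
  ext
  · simp [Model.gen]
  · simp [Model.gen]
  · simp [Model.gen]
    ring
  · simp [Model.gen]
    linear_combination (g.c - 2 * g.a - 2 * (g.b - 4 * g.a) - g.a * (g.b - 4 * g.a)) * h5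

lemma card : Nat.card SmallGroup1000 = 1000 :=
  le_antisymm card_le (Model.card ▸ Nat.card_le_card_of_surjective _ toModel_surjective)

lemma toModel_bijective : Function.Bijective toModel :=
  toModel_surjective.bijective_of_nat_card_le (by rw [card, Model.card])

end SmallGroup1000

end MonomialClasses

namespace MonomialClasses

open Subgroup

open scoped commutatorElement

/-- The properties of the group of order `1000` that are used: `P` is its extraspecial Sylow
`5`-subgroup, `Z` the centre of `P`, and `t` an involution. -/
structure ExtraspecialByC8 {G : Type u} [Group G] (P Z : Subgroup G) (t : G) : Prop where
  card_G : Nat.card G = 1000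
  card_P : Nat.card P = 125
  card_Z : Nat.card Z = 5
  normal_P : P.Normal
  normal_Z : Z.Normal
  Z_le : Z ≤ P
  central : ∀ a ∈ P, ∀ z ∈ Z, a * z = z * a
  quot_comm : ∀ g h, g * h * g⁻¹ * h⁻¹ ∈ P
  comm_P : ∀ a ∈ P, ∀ b ∈ P, a * b * a⁻¹ * b⁻¹ ∈ Z
  pow_five : ∀ a ∈ P, a ^ 5 = 1
  conj_P : ∀ a ∈ P, a ∉ Z → ∀ z ∈ Z, ∃ b ∈ P, b * a * b⁻¹ = a * z
  centralizer_in_P : ∀ a ∈ P, a ∉ Z → ∀ b ∈ P, a * b = b * a → ∃ n : ℕ, ∃ z ∈ Z, b = a ^ n * z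
  card_centralizer : Nat.card (centralizer (Z : Set G)) = 250
  line : ∀ g, (∀ z ∈ Z, g * z = z * g) → ∀ a ∈ P, ∃ n : ℕ, ∃ z ∈ Z, g * a * g⁻¹ = a ^ n * z
  fixed_free : ∀ g ∉ P, ∀ a ∈ P, g * a = a * g → a ∈ Z
  irred : ∀ W : Subgroup G, W.Normal → W ≤ P → ¬ W ≤ Z → W = P
  t_not_mem : t ∉ P
  t_sq : t ^ 2 = 1
  card_invol : Nat.card {g : G // g ^ 2 = 1 ∧ g ≠ 1} = 25
  invol_mul : ∀ g h : G, g ^ 2 = 1 → g ≠ 1 → h ^ 2 = 1 → h ≠ 1 → g * h ∈ P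
  invol_central : ∀ g : G, g ^ 2 = 1 → ∀ z ∈ Z, g * z = z * g
  conj_out : ∀ g ∉ P, t⁻¹ * g ∉ P → ∀ z ∈ Z, ∃ h, h * g * h⁻¹ = g * z
  conj_t : ∀ g, t⁻¹ * g ∈ P → ∃ h, ∃ z ∈ Z, h * g * h⁻¹ = t * z
  trans : ∀ z ∈ Z, z ≠ 1 → ∀ z' ∈ Z, z' ≠ 1 → ∃ g, g * t = t * g ∧ g * z * g⁻¹ = z'

/-- Transport of the properties along an isomorphism. -/
lemma ExtraspecialByC8.of_equiv {G H : Type u} [Group G] [Group H] {P Z : Subgroup H} {t : H}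
    (h : ExtraspecialByC8 P Z t) (e : G ≃* H) :
    ExtraspecialByC8 (P.comap e.toMonoidHom) (Z.comap e.toMonoidHom) (e.symm t) := by
  have hs : ∀ h : H, e (e.symm h) = h := e.apply_symm_apply
  have hmem : ∀ (Q : Subgroup H) (g : G), g ∈ Q.comap e.toMonoidHom ↔ e g ∈ Q :=
    fun _ _ => Iff.rfl
  have hcard : ∀ Q : Subgroup H, Nat.card (Q.comap e.toMonoidHom) = Nat.card Q := by
    intro Q
    refine Nat.card_congr (e.toEquiv.subtypeEquiv fun g => Iff.rfl)
  refine
    { card_G := (Nat.card_congr e.toEquiv).trans h.card_G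
      card_P := (hcard P).trans h.card_P
      card_Z := (hcard Z).trans h.card_Z
      normal_P := h.normal_P.comap _
      normal_Z := h.normal_Z.comap _
      Z_le := comap_mono h.Z_le
      central := fun a ha z hz => e.injective (by simpa using h.central _ ha _ hz)
      quot_comm := fun a b => by
        rw [hmem]
        simpa using h.quot_comm (e a) (e b)
      comm_P := fun a ha b hb => by
        rw [hmem]
        simpa using h.comm_P (e a) ha (e b) hb
      pow_five := fun a ha => e.injective (by simpa using h.pow_five _ ha)
      conj_P := fun a ha haZ z hz => by
        obtain ⟨b, hb, hb'⟩ := h.conj_P (e a) ha haZ (e z) hz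
        exact ⟨e.symm b, by simpa [hmem] using hb, e.injective (by simpa using hb')⟩
      centralizer_in_P := fun a ha haZ b hb hab => by
        obtain ⟨n, z, hz, hn⟩ := h.centralizer_in_P (e a) ha haZ (e b) hb
          (by rw [← map_mul, hab, map_mul])
        exact ⟨n, e.symm z, by simpa [hmem] using hz, e.injective (by simpa using hn)⟩
      card_centralizer := ?_
      line := fun g hg a ha => by
        obtain ⟨n, z, hz, hn⟩ := h.line (e g) (fun z hz => by
          have := congrArg e (hg (e.symm z) (by simpa [hmem] using hz))
          simpa using this) (e a) ha
        exact ⟨n, e.symm z, by simpa [hmem] using hz, e.injective (by simpa using hn)⟩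
      fixed_free := fun g hg a ha hga => h.fixed_free (e g) hg (e a) ha
        (by rw [← map_mul, hga, map_mul])
      irred := fun W hW hWP hWZ => ?_
      t_not_mem := fun ht => h.t_not_mem (by simpa [hmem] using ht)
      t_sq := e.injective (by simpa using h.t_sq)
      card_invol := ?_
      invol_mul := fun g k hg hg' hk hk' => by
        rw [hmem, map_mul]
        exact h.invol_mul _ _ (by rw [← map_pow, hg, map_one]) (by simpa using hg')
          (by rw [← map_pow, hk, map_one]) (by simpa using hk')
      invol_central := fun g hg z hz => e.injective (by
        simpa using h.invol_central (e g) (by rw [← map_pow, hg, map_one]) (e z) hz)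
      conj_out := fun g hg hgt z hz => by
        obtain ⟨b, hb⟩ := h.conj_out (e g) hg (by simpa [hmem] using hgt) (e z) hz
        exact ⟨e.symm b, e.injective (by simpa using hb)⟩
      conj_t := fun g hg => by
        obtain ⟨b, z, hz, hb⟩ := h.conj_t (e g) (by simpa [hmem] using hg)
        exact ⟨e.symm b, e.symm z, by simpa [hmem] using hz, e.injective (by simpa using hb)⟩
      trans := fun z hz hz1 z' hz' hz1' => by
        obtain ⟨g, hg, hg'⟩ := h.trans (e z) hz (by simpa using hz1) (e z') hz' (by simpa using hz1')
        exact ⟨e.symm g, e.injective (by simpa using hg), e.injective (by simpa using hg')⟩ }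
  · rw [← h.card_centralizer]
    refine Nat.card_congr (e.toEquiv.subtypeEquiv fun g => ?_)
    rw [mem_centralizer_iff, mem_centralizer_iff]
    constructor
    · intro hg z hz
      have := congrArg e (hg (e.symm z) (by simpa using hz))
      simpa using this
    · intro hg z hz
      have := hg (e z) hz
      exact e.injective (by simpa using this)
  · have h1 := h.irred (W.map e.toMonoidHom) (hW.map _ e.surjective) (map_le_iff_le_comap.2 hWP)
      (fun hle => hWZ (map_le_iff_le_comap.1 hle))
    rw [← h1, comap_map_eq_self_of_injective e.injective]
  · rw [← h.card_invol]
    refine Nat.card_congr (e.toEquiv.subtypeEquiv fun g => ?_)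
    change _ ↔ e g ^ 2 = 1 ∧ e g ≠ 1
    rw [← map_pow, Ne, Ne, map_eq_one_iff e e.injective, map_eq_one_iff e e.injective]

/-! ### Group-theoretic properties of the model -/

namespace Model

/-- The extraspecial normal subgroup of the model. -/
def heisenberg : Subgroup Model where
  carrier := {x | x.k = 0}
  one_mem' := rfl
  mul_mem' {x y} (hx : x.k = 0) (hy : y.k = 0) := by simp [hx, hy]
  inv_mem' {x} (hx : x.k = 0) := by simp [hx]

/-- The centre of the extraspecial normal subgroup of the model. -/
def middle : Subgroup Model where
  carrier := {x | x.k = 0 ∧ x.a = 0 ∧ x.b = 0}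
  one_mem' := ⟨rfl, rfl, rfl⟩
  mul_mem' := by
    rintro x y ⟨h1, h2, h3⟩ ⟨h1', h2', h3'⟩
    simp [h1, h2, h3, h1', h2', h3']
  inv_mem' := by
    rintro x ⟨h1, h2, h3⟩
    simp [h1, h2, h3]

lemma mem_heisenberg {x : Model} : x ∈ heisenberg ↔ x.k = 0 := Iff.rfl

lemma mem_middle {x : Model} : x ∈ middle ↔ x.k = 0 ∧ x.a = 0 ∧ x.b = 0 := Iff.rfl

/-- No nontrivial power of the matrix has eigenvalue 1: even powers are scalars other than 1, and
odd ones are multiples of a matrix with square 3, a nonsquare modulo 5. -/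
lemma eq_zero_of_fixed : ∀ k : ZMod 8, k ≠ 0 → ∀ a b : ZMod 5, diag k * a + 4 * off k * b = a →
    2 * off k * a + diag k * b = b → a = 0 ∧ b = 0 := by
  decide

lemma det_ne_one : ∀ k : ZMod 8, k ≠ 0 → k ≠ 4 → det k ≠ 1 := by
  decide

lemma eq_or_eq_of_add_self : ∀ k : ZMod 8, k + k = 0 → k = 0 ∨ k = 4 := by
  decide

/-- This form is the determinant of a vector v and its image under the matrix. It is anisotropic
because 2 is not a square modulo 5, so v and its image form a basis. -/
lemma norm_ne_zero : ∀ a b : ZMod 5, ¬ (a = 0 ∧ b = 0) → 2 * a ^ 2 - 4 * b ^ 2 ≠ 0 := by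
  decide

instance : Fact (Nat.Prime 5) := ⟨by norm_num⟩

/-- The involution. -/
def t : Model := ⟨4, 0, 0, 0⟩

lemma inv_t_mul_mem {x : Model} : t⁻¹ * x ∈ heisenberg ↔ x.k = 4 := by
  rw [mem_heisenberg, mul_k, inv_k, neg_add_eq_zero]
  exact eq_comm

/-- The element 4 of the cyclic group acts as -1 on the plane and trivially on the centre, so the
square of (4, a, b, c) is (0, 0, 0, 2c). -/
lemma sq_eq_one_iff {x : Model} : x ^ 2 = 1 ∧ x ≠ 1 ↔ x.k = 4 ∧ x.c = 0 := by
  have h4 : diag 4 = -1 := rfl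
  have h4' : off 4 = 0 := rfl
  have h4'' : det 4 = 1 := rfl
  have h2 : (2 : ZMod 5) ≠ 0 := by decide
  constructor
  · rintro ⟨h, h1⟩
    rw [sq] at h
    have hk := congrArg Model.k h
    rcases eq_or_eq_of_add_self x.k hk with hk | hk
    · exfalso
      have ha := congrArg Model.a h
      have hb := congrArg Model.b h
      have hc := congrArg Model.c h
      simp [hk, ← two_mul, h2] at ha hb
      simp [hk, ha, hb, ← two_mul, h2] at hc
      exact h1 (Model.ext hk ha hb hc)
    · refine ⟨hk, ?_⟩
      have hc := congrArg Model.c h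
      simp only [mul_c, hk, h4, h4', h4'', one_c] at hc
      have : 2 * x.c = 0 := by linear_combination hc
      exact (mul_eq_zero.1 this).resolve_left h2
  · rintro ⟨hk, hc⟩
    refine ⟨?_, fun h => absurd (hk.symm.trans (congrArg Model.k h)) (by decide)⟩
    rw [sq]
    ext
    · rw [mul_k, hk]
      rfl
    · simp [hk, h4, h4']
    · simp [hk, h4, h4']
    · simp only [mul_c, hk, hc, h4, h4', h4'', one_c]
      ring

lemma card_heisenberg : Nat.card heisenberg = 125 := by
  let e : heisenberg ≃ ZMod 5 × ZMod 5 × ZMod 5 :=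
    { toFun := fun x => (x.1.a, x.1.b, x.1.c)
      invFun := fun x => ⟨⟨0, x.1, x.2.1, x.2.2⟩, rfl⟩
      left_inv := fun x => Subtype.ext (Model.ext (Eq.symm x.2) rfl rfl rfl)
      right_inv := fun _ => rfl }
  rw [Nat.card_congr e]
  simp

lemma card_middle : Nat.card middle = 5 := by
  let e : middle ≃ ZMod 5 :=
    { toFun := fun x => x.1.c
      invFun := fun c => ⟨⟨0, 0, 0, c⟩, rfl, rfl, rfl⟩
      left_inv := fun x => Subtype.ext (Model.ext (Eq.symm x.2.1) (Eq.symm x.2.2.1)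
        (Eq.symm x.2.2.2) rfl)
      right_inv := fun _ => rfl }
  rw [Nat.card_congr e]
  simp

lemma card_involutions : Nat.card {g : Model // g ^ 2 = 1 ∧ g ≠ 1} = 25 := by
  let e : {g : Model // g ^ 2 = 1 ∧ g ≠ 1} ≃ ZMod 5 × ZMod 5 :=
    { toFun := fun x => (x.1.a, x.1.b)
      invFun := fun x => ⟨⟨4, x.1, x.2, 0⟩, sq_eq_one_iff.2 ⟨rfl, rfl⟩⟩
      left_inv := fun x => Subtype.ext (Model.ext (Eq.symm (sq_eq_one_iff.1 x.2).1) rfl rfl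
        (Eq.symm (sq_eq_one_iff.1 x.2).2))
      right_inv := fun _ => rfl }
  rw [Nat.card_congr e]
  simp

lemma mul_middle {x : Model} (hx : x ∈ middle) (g : Model) :
    x * g = ⟨g.k, g.a, g.b, g.c + x.c⟩ := by
  obtain ⟨h1, h2, h3⟩ := hx
  ext <;> simp [h1, h2, h3, add_comm]

lemma middle_mul {x : Model} (hx : x ∈ middle) (g : Model) :
    g * x = ⟨g.k, g.a, g.b, g.c + det g.k * x.c⟩ := by
  obtain ⟨h1, h2, h3⟩ := hx
  ext <;> simp [h1, h2, h3]

/-- The elements that centralize the centre of the Heisenberg group. -/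
lemma forall_commute_iff {g : Model} : (∀ z ∈ middle, g * z = z * g) ↔ g.k = 0 ∨ g.k = 4 := by
  constructor
  · intro h
    have h1 := h ⟨0, 0, 0, 1⟩ ⟨rfl, rfl, rfl⟩
    have h2 := congrArg Model.c h1
    rw [middle_mul ⟨rfl, rfl, rfl⟩, mul_middle ⟨rfl, rfl, rfl⟩] at h2
    simp only [mul_one, add_right_inj] at h2
    by_contra! h3
    exact det_ne_one _ h3.1 h3.2 h2
  · intro h z hz
    rw [mul_middle hz, middle_mul hz]
    have : det g.k = 1 := by
      rcases h with h | h <;> rw [h] <;> rfl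
    rw [this, one_mul]

lemma card_centralizer_middle : Nat.card (centralizer (middle : Set Model)) = 250 := by
  have hmem : ∀ g : Model, g ∈ centralizer (middle : Set Model) ↔ g.k = 0 ∨ g.k = 4 := by
    intro g
    rw [← forall_commute_iff, mem_centralizer_iff]
    exact forall₂_congr fun _ _ => eq_comm
  let e : centralizer (middle : Set Model) ≃
      {k : ZMod 8 // k = 0 ∨ k = 4} × ZMod 5 × ZMod 5 × ZMod 5 :=
    { toFun := fun x => (⟨x.1.k, (hmem _).1 x.2⟩, x.1.a, x.1.b, x.1.c)
      invFun := fun x => ⟨⟨x.1, x.2.1, x.2.2.1, x.2.2.2⟩, (hmem _).2 x.1.2⟩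
      left_inv := fun x => rfl
      right_inv := fun _ => rfl }
  have h2 : Nat.card {k : ZMod 8 // k = 0 ∨ k = 4} = 2 := by
    rw [Nat.card_eq_fintype_card]
    rfl
  rw [Nat.card_congr e]
  rw [Nat.card_prod, h2]
  simp

lemma heisenberg_normal : heisenberg.Normal :=
  ⟨fun x (hx : x.k = 0) g => by simp [mem_heisenberg, hx]⟩

lemma conj_eq_iff {a b c : Model} : b * a * b⁻¹ = c ↔ b * a = c * b := mul_inv_eq_iff_eq_mul

lemma middle_normal : middle.Normal := by
  refine ⟨fun x hx g => ?_⟩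
  have : g * x * g⁻¹ = ⟨0, 0, 0, det g.k * x.c⟩ := by
    rw [conj_eq_iff, middle_mul hx, mul_middle ⟨rfl, rfl, rfl⟩]
  rw [this]
  exact ⟨rfl, rfl, rfl⟩

lemma exists_conj {x : Model} (hx : x ∈ heisenberg) (hxZ : x ∉ middle) {z : Model}
    (hz : z ∈ middle) : ∃ b ∈ heisenberg, b * x * b⁻¹ = x * z := by
  have hx : x.k = 0 := hx
  have h2 : (2 : ZMod 5) ≠ 0 := by decide
  have hab : x.a ≠ 0 ∨ x.b ≠ 0 := by
    by_contra! h
    exact hxZ ⟨hx, h⟩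
  -- Conjugating by the vector (p, q) changes only c, by twice the alternating form.
  have key : ∀ p q : ZMod 5, 2 * (p * x.b - q * x.a) = z.c →
      ∃ b ∈ heisenberg, b * x * b⁻¹ = x * z := by
    intro p q h
    refine ⟨⟨0, p, q, 0⟩, rfl, ?_⟩
    rw [conj_eq_iff, middle_mul hz]
    ext
    · simp [hx]
    · simp [hx, add_comm]
    · simp [hx, add_comm]
    · simp [hx]
      linear_combination h
  rcases hab with h | h
  · exact key 0 (-(z.c / (2 * x.a))) (by field_simp; ring)
  · exact key (z.c / (2 * x.b)) 0 (by field_simp; ring)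

lemma exists_eq_pow_mul {x : Model} (hx : x ∈ heisenberg) {y : Model} (hy : y ∈ heisenberg)
    (r : ZMod 5) (ha : y.a = r * x.a) (hb : y.b = r * x.b) :
    ∃ n : ℕ, ∃ z ∈ middle, y = x ^ n * z := by
  have hx : x.k = 0 := hx
  have hy : y.k = 0 := hy
  refine ⟨r.val, ⟨0, 0, 0, y.c - r * x.c⟩, ⟨rfl, rfl, rfl⟩, ?_⟩
  rw [pow_of_k_eq_zero hx]
  ext <;> simp [hy, ha, hb]

lemma commute_in_heisenberg {x : Model} (hx : x ∈ heisenberg) (hxZ : x ∉ middle) {y : Model}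
    (hy : y ∈ heisenberg) (hxy : x * y = y * x) : ∃ n : ℕ, ∃ z ∈ middle, y = x ^ n * z := by
  have hx' : x.k = 0 := hx
  have hy' : y.k = 0 := hy
  have h2 : (2 : ZMod 5) ≠ 0 := by decide
  have hc := congrArg Model.c hxy
  simp [hx', hy'] at hc
  have h : x.a * y.b = x.b * y.a := by
    refine mul_left_cancel₀ h2 ?_
    linear_combination hc
  have hab : x.a ≠ 0 ∨ x.b ≠ 0 := by
    by_contra! h
    exact hxZ ⟨hx, h⟩
  rcases hab with h' | h'
  · exact exists_eq_pow_mul hx hy (y.a / x.a) (by field_simp) (by field_simp; linear_combination h)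
  · exact exists_eq_pow_mul hx hy (y.b / x.b) (by field_simp; linear_combination -h) (by field_simp)

lemma irreducible {W : Subgroup Model} (hW : W.Normal) (hle : W ≤ heisenberg)
    (hn : ¬ W ≤ middle) : W = heisenberg := by
  obtain ⟨x, hxW, hxZ⟩ := SetLike.not_le_iff_exists.1 hn
  have hx : x.k = 0 := hle hxW
  have hZ : middle ≤ W := by
    intro z hz
    obtain ⟨b, -, hb⟩ := exists_conj (hle hxW) hxZ hz
    have := W.mul_mem (W.inv_mem hxW) (hW.conj_mem x hxW b)
    rwa [hb, inv_mul_cancel_left] at this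
  refine le_antisymm hle fun y hy => ?_
  have hy : y.k = 0 := hy
  have hnorm := norm_ne_zero x.a x.b (fun h => hxZ ⟨hx, h⟩)
  let g : Model := ⟨1, 0, 0, 0⟩
  have hg : g * x * g⁻¹ = ⟨0, 4 * x.b, 2 * x.a, 2 * x.c⟩ := by
    have h1 : diag 1 = 0 := rfl
    have h2 : off 1 = 1 := rfl
    have h3 : det 1 = 2 := rfl
    rw [conj_eq_iff]
    ext <;> simp [g, hx, h1, h2, h3]
  have h1 := hW.conj_mem x hxW g
  rw [hg] at h1
  -- Cramer's rule for the plane part of y in the basis formed by that of x and its image under the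
  -- matrix.
  let i : ZMod 5 := (y.a * (2 * x.a) - 4 * x.b * y.b) / (2 * x.a ^ 2 - 4 * x.b ^ 2)
  let j : ZMod 5 := (x.a * y.b - x.b * y.a) / (2 * x.a ^ 2 - 4 * x.b ^ 2)
  have ha : y.a = i * x.a + j * (4 * x.b) := by
    simp only [i, j]
    field_simp
    ring
  have hb : y.b = i * x.b + j * (2 * x.a) := by
    simp only [i, j]
    field_simp
    ring
  have h2 := W.mul_mem (W.pow_mem hxW i.val) (W.pow_mem h1 j.val)
  set w := x ^ i.val * (⟨0, 4 * x.b, 2 * x.a, 2 * x.c⟩ : Model) ^ j.val with hw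
  have hwk : w.k = 0 ∧ w.a = y.a ∧ w.b = y.b := by
    rw [hw, pow_of_k_eq_zero hx, pow_of_k_eq_zero rfl, ha, hb]
    simp
  have h3 : w * ⟨0, 0, 0, y.c - w.c⟩ = y := by
    rw [middle_mul ⟨rfl, rfl, rfl⟩]
    ext <;> simp [hwk, hy]
  rw [← h3]
  exact W.mul_mem h2 (hZ ⟨rfl, rfl, rfl⟩)

lemma conj_of_k_ne {x z : Model} (h0 : x.k ≠ 0) (h4 : x.k ≠ 4) (hz : z ∈ middle) :
    ∃ h, h * x * h⁻¹ = x * z := by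
  have h1 : 1 - det x.k ≠ 0 := fun h => det_ne_one _ h0 h4 (sub_eq_zero.1 h).symm
  refine ⟨⟨0, 0, 0, det x.k * z.c / (1 - det x.k)⟩, ?_⟩
  rw [conj_eq_iff, middle_mul hz]
  ext <;> simp
  field_simp
  ring

lemma conj_t {x : Model} (hx : x.k = 4) : ∃ h, ∃ z ∈ middle, h * x * h⁻¹ = t * z := by
  have h1 : diag 4 = -1 := rfl
  have h2 : off 4 = 0 := rfl
  have h3 : (5 : ZMod 5) = 0 := rfl
  have h4 : det 4 = 1 := rfl
  -- Since 4 acts as -1, conjugating by a vector v adds 2v to the plane part; v = 2(a, b) clears it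
  -- because 1 + 2 · 2 = 0 modulo 5.
  refine ⟨⟨0, 2 * x.a, 2 * x.b, 0⟩, ⟨0, 0, 0, x.c⟩, ⟨rfl, rfl, rfl⟩, ?_⟩
  rw [conj_eq_iff, middle_mul (x := ⟨0, 0, 0, x.c⟩) ⟨rfl, rfl, rfl⟩]
  ext
  · simp [hx, t]
  · simp [t, h1, h2]
    linear_combination x.a * h3
  · simp [t, h1, h2]
    linear_combination x.b * h3
  · simp [t, h4]
    ring

lemma exists_conj_middle {z z' : Model} (hz : z ∈ middle) (hz1 : z ≠ 1) (hz' : z' ∈ middle)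
    (hz1' : z' ≠ 1) : ∃ g, g * t = t * g ∧ g * z * g⁻¹ = z' := by
  have hdet : ∀ c c' : ZMod 5, c ≠ 0 → c' ≠ 0 → ∃ k : ZMod 8, det k * c = c' := by decide
  obtain ⟨k, hk⟩ := hdet z.c z'.c (fun h => hz1 (Model.ext hz.1 hz.2.1 hz.2.2 h))
    (fun h => hz1' (Model.ext hz'.1 hz'.2.1 hz'.2.2 h))
  refine ⟨⟨k, 0, 0, 0⟩, ?_, ?_⟩
  · ext <;> simp [t, add_comm]
  · rw [conj_eq_iff, middle_mul hz, mul_middle hz']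
    simp [hk]

theorem extraspecialByC8 : ExtraspecialByC8 heisenberg middle t where
  card_G := card
  card_P := card_heisenberg
  card_Z := card_middle
  normal_P := heisenberg_normal
  normal_Z := middle_normal
  Z_le := fun _ hx => hx.1
  central := fun a (ha : a.k = 0) z hz => forall_commute_iff.2 (Or.inl ha) z hz
  quot_comm := fun g h => by
    rw [mem_heisenberg]
    simp
  comm_P := fun a (ha : a.k = 0) b (hb : b.k = 0) => by
    rw [mem_middle]
    simp [ha, hb]
  pow_five := fun a (ha : a.k = 0) => by
    have h5 : (5 : ZMod 5) = 0 := rfl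
    rw [pow_of_k_eq_zero ha]
    ext <;> simp [h5]
  conj_P := fun _ ha haZ _ hz => exists_conj ha haZ hz
  centralizer_in_P := fun _ ha haZ _ hb hab => commute_in_heisenberg ha haZ hb hab
  card_centralizer := card_centralizer_middle
  line := fun g hg a (ha : a.k = 0) => by
    have hn : g * a * g⁻¹ ∈ heisenberg := heisenberg_normal.conj_mem a ha g
    have hn' : (g * a * g⁻¹).k = 0 := hn
    have h1 := conj_eq_iff.1 (rfl : g * a * g⁻¹ = g * a * g⁻¹)
    generalize g * a * g⁻¹ = w at hn h1 hn'
    have h2 := congrArg Model.a h1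
    have h3 := congrArg Model.b h1
    simp only [mul_a, mul_b, hn', diag_zero, off_zero, one_mul, mul_zero, zero_mul, zero_add,
      add_zero] at h2 h3
    rcases forall_commute_iff.1 hg with hk | hk
    · exact exists_eq_pow_mul ha hn 1
        (by simp [hk] at h2; linear_combination -h2) (by simp [hk] at h3; linear_combination -h3)
    · have h4 : diag 4 = -1 := rfl
      have h5 : off 4 = 0 := rfl
      exact exists_eq_pow_mul ha hn (-1) (by simp [hk, h4, h5] at h2; linear_combination -h2)
        (by simp [hk, h4, h5] at h3; linear_combination -h3)
  fixed_free := fun g hg a (ha : a.k = 0) h => by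
    refine ⟨ha, ?_⟩
    have h2 := congrArg Model.a h
    have h3 := congrArg Model.b h
    simp [ha] at h2 h3
    exact eq_zero_of_fixed g.k hg a.a a.b (by linear_combination h2) (by linear_combination h3)
  irred := fun _ hW hle hn => irreducible hW hle hn
  t_not_mem := fun h => absurd (show (4 : ZMod 8) = 0 from h) (by decide)
  t_sq := (sq_eq_one_iff.2 ⟨rfl, rfl⟩).1
  card_invol := card_involutions
  invol_mul := fun g h hg hg' hh hh' => by
    rw [mem_heisenberg, mul_k, (sq_eq_one_iff.1 ⟨hg, hg'⟩).1, (sq_eq_one_iff.1 ⟨hh, hh'⟩).1]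
    rfl
  invol_central := fun g hg => by
    rw [forall_commute_iff]
    have hk := congrArg Model.k hg
    rw [sq] at hk
    exact eq_or_eq_of_add_self _ hk
  conj_out := fun g hg hgt z hz => conj_of_k_ne hg (fun h => hgt (inv_t_mul_mem.2 h)) hz
  conj_t := fun g hg => conj_t (inv_t_mul_mem.1 hg)
  trans := fun _ hz hz1 _ hz' hz1' => exists_conj_middle hz hz1 hz' hz1'

end Model

end MonomialClasses

namespace MonomialClasses

open Subgroup

open scoped commutatorElement

/-! ### Membership of the group of order 1000 in the class 𝒞 -/

namespace ExtraspecialByC8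

variable {G : Type u} [Group G] {P Z : Subgroup G} {t : G}

lemma index_P (h : ExtraspecialByC8 P Z t) : P.index = 8 := by
  have := P.card_mul_index
  rw [h.card_P, h.card_G] at this
  omega

lemma isPGroup_P (h : ExtraspecialByC8 P Z t) : IsPGroup 5 P :=
  fun a => ⟨1, Subtype.ext (h.pow_five a a.2)⟩

lemma exists_ne_one_mem_Z (h : ExtraspecialByC8 P Z t) : ∃ z ∈ Z, z ≠ 1 := by
  by_contra! hle
  have h1 : Z = ⊥ := (eq_bot_iff_forall Z).2 hle
  have h2 := h.card_Z
  rw [h1, card_bot] at h2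
  omega

lemma card_eq (h : ExtraspecialByC8 P Z t) (K : Subgroup G) :
    ∃ d, d ∣ 8 ∧ d = P.relIndex K ∧ Nat.card K = Nat.card (P ⊓ K : Subgroup G) * d := by
  have := h.normal_P
  refine ⟨P.relIndex K, h.index_P ▸ relIndex_dvd_index_of_normal P K, rfl, ?_⟩
  rw [← inf_relIndex_right, ← relIndex_bot_left, ← relIndex_bot_left]
  exact (relIndex_mul_relIndex ⊥ (P ⊓ K) K bot_le inf_le_right).symm

variable [Finite G]

lemma isSolvable (h : ExtraspecialByC8 P Z t) : Group.IsSolvable G := by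
  have : Fact (Nat.Prime 5) := ⟨by norm_num⟩
  have := h.normal_P
  have : Group.IsSolvable P := by
    have := h.isPGroup_P.isNilpotent
    infer_instance
  have : Group.IsSolvable (G ⧸ P) := by
    refine Group.isSolvable_of_comm fun a b => ?_
    induction a using QuotientGroup.induction_on with
    | H a =>
    induction b using QuotientGroup.induction_on with
    | H b =>
      rw [← commutatorElement_eq_one_iff_mul_comm]
      exact (QuotientGroup.eq_one_iff _).2 (h.quot_comm a b)
  exact Group.isSolvable_of_ker_le_range P.subtype (QuotientGroup.mk' P)
    (by rw [QuotientGroup.ker_mk', range_subtype])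

/-- The Sylow 5-subgroups have order at most 25, hence are abelian. For other primes, commutators
come from P and have fifth power 1, so they vanish. -/
lemma solvableAbelianSylow_quotient (h : ExtraspecialByC8 P Z t) (H : Subgroup G) (N : Subgroup H)
    [N.Normal] (hd : ¬ 125 ∣ Nat.card (H ⧸ N)) : SolvableAbelianSylow (H ⧸ N) := by
  have := h.isSolvable
  refine ⟨inferInstance, fun p hp Q => ?_⟩
  have : Fact p.Prime := ⟨hp⟩
  by_cases hp5 : p = 5
  · subst hp5
    obtain ⟨k, hk⟩ := IsPGroup.iff_card.1 Q.2
    have hk2 : k ≤ 2 := by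
      by_contra! hlt
      refine hd (dvd_trans ?_ (card_subgroup_dvd_card (Q : Subgroup (H ⧸ N))))
      rw [hk]
      exact pow_dvd_pow 5 hlt
    interval_cases k
    · rw [pow_zero, card_eq_one] at hk
      exact ⟨⟨fun a b => Subtype.ext (by
        have ha := a.2
        have hb := b.2
        have ha' : (a : H ⧸ N) = 1 := by
          have : (a : H ⧸ N) ∈ (⊥ : Subgroup (H ⧸ N)) := hk ▸ ha
          exact this
        have hb' : (b : H ⧸ N) = 1 := by
          have : (b : H ⧸ N) ∈ (⊥ : Subgroup (H ⧸ N)) := hk ▸ hb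
          exact this
        simp [ha', hb'])⟩⟩
    · have : IsCyclic Q := isCyclic_of_prime_card (p := 5) (by simpa using hk)
      exact IsCyclic.isMulCommutative
    · exact IsPGroup.isMulCommutative_of_card_eq_prime_sq hk
  · refine ⟨⟨fun a b => ?_⟩⟩
    rw [← commutatorElement_eq_one_iff_mul_comm]
    obtain ⟨n, hn⟩ := Q.2 ⁅a, b⁆
    have h5 : ⁅a, b⁆ ^ 5 = 1 := by
      apply Subtype.ext
      change ⁅(a : H ⧸ N), (b : H ⧸ N)⁆ ^ 5 = 1
      generalize (a : H ⧸ N) = a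
      generalize (b : H ⧸ N) = b
      induction a using QuotientGroup.induction_on with
      | H a =>
      induction b using QuotientGroup.induction_on with
      | H b =>
        have : ⁅a, b⁆ ^ 5 = 1 := Subtype.ext (h.pow_five _ (h.quot_comm a b))
        have h2 := congrArg (QuotientGroup.mk' N) this
        rwa [map_pow, map_commutatorElement, map_one] at h2
    have hmem : ⁅a, b⁆ ∈ (⊥ : Subgroup Q) := mem_of_pow_mem_of_coprime
      (Nat.Coprime.pow_left n ((Nat.coprime_primes hp (by norm_num)).2 hp5)) hn h5
    exact hmem

lemma exists_not_mem_Z (h : ExtraspecialByC8 P Z t) : ∃ a ∈ P, a ∉ Z := by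
  by_contra! hle
  have h1 := card_le_of_le (show P ≤ Z from hle)
  rw [h.card_P, h.card_Z] at h1
  omega

/-- The centralizer of `P` is contained in `P`. -/
lemma mem_P_of_forall_commute (h : ExtraspecialByC8 P Z t) {g : G}
    (hg : ∀ a ∈ P, g * a = a * g) : g ∈ P := by
  by_contra hgP
  obtain ⟨a, ha, haZ⟩ := h.exists_not_mem_Z
  exact haZ (h.fixed_free g hgP a ha (hg a ha))

/-- If H does not centralize Z, then Z itself works. Otherwise H preserves every line of P/Z, so
⟨a⟩Z is normal in H for a in P outside Z, and a is conjugate to its nontrivial multiples az. -/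
lemma abelianOrNoncentral_of_le (h : ExtraspecialByC8 P Z t) {H : Subgroup G} (hH : P ≤ H) :
    AbelianOrNoncentral H := by
  have := h.normal_Z
  right
  by_cases hc : ∀ g ∈ H, ∀ z ∈ Z, g * z = z * g
  · obtain ⟨a, ha, haZ⟩ := h.exists_not_mem_Z
    have hA : ∀ x, x ∈ zpowers a ⊔ Z ↔ ∃ n : ℤ, ∃ z ∈ Z, a ^ n * z = x := by
      intro x
      rw [mem_sup_of_normal_right]
      constructor
      · rintro ⟨_, ⟨n, rfl⟩, z, hz, rfl⟩
        exact ⟨n, z, hz, rfl⟩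
      · rintro ⟨n, z, hz, rfl⟩
        exact ⟨_, ⟨n, rfl⟩, z, hz, rfl⟩
    have hza : ∀ z ∈ Z, Commute a z := fun z hz => hc a (hH ha) z hz
    refine ⟨(zpowers a ⊔ Z).subgroupOf H, ⟨fun x hx g => ?_⟩, ⟨⟨fun x y => ?_⟩⟩, fun hle => ?_⟩
    · rw [mem_subgroupOf, hA] at hx ⊢
      obtain ⟨n, z, hz, hx⟩ := hx
      obtain ⟨m, z', hz', hm⟩ := h.line g (hc g g.2) a ha
      refine ⟨m * n, z' ^ n * z, Z.mul_mem (Z.zpow_mem hz' n) hz, ?_⟩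
      change _ = (g : G) * (x : G) * (g : G)⁻¹
      have h1 : (g : G) * (a ^ n * z) * (g : G)⁻¹ = (g * a * (g : G)⁻¹) ^ n * z := by
        rw [conj_zpow]
        simp only [mul_assoc]
        rw [hc (g : G)⁻¹ (inv_mem g.2) z hz]
      rw [← hx, h1, hm, ((hza z' hz').pow_left m).mul_zpow, zpow_mul, zpow_natCast, mul_assoc]
    · have hx := x.2
      have hy := y.2
      rw [mem_subgroupOf, hA] at hx hy
      obtain ⟨n, z, hz, hx⟩ := hx
      obtain ⟨m, z', hz', hy⟩ := hy
      refine Subtype.ext (Subtype.ext ?_)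
      change ((x : H) : G) * ((y : H) : G) = ((y : H) : G) * ((x : H) : G)
      rw [← hx, ← hy]
      have hzz : Commute z z' := hc z (hH (h.Z_le hz)) z' hz'
      exact (((Commute.refl a).zpow_zpow n m).mul_left ((hza z hz).symm.zpow_right m)).mul_right
        (((hza z' hz').zpow_left n).mul_left hzz)
    · obtain ⟨z, hz, hz1⟩ := h.exists_ne_one_mem_Z
      obtain ⟨b, hb, hba⟩ := h.conj_P a ha haZ z hz
      have h1 := mem_center_iff.1 (hle (x := ⟨a, hH ha⟩)
        (mem_subgroupOf.2 (mem_sup_left (mem_zpowers a)))) ⟨b, hH hb⟩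
      have h2 : b * a = a * b := congrArg Subtype.val h1
      rw [h2, mul_inv_cancel_right, eq_comm, mul_eq_left] at hba
      exact hz1 hba
  · push Not at hc
    obtain ⟨g, hg, z, hz, hgz⟩ := hc
    refine ⟨Z.subgroupOf H, inferInstance, ⟨⟨fun x y => ?_⟩⟩, fun hle => ?_⟩
    · exact Subtype.ext (Subtype.ext (h.central _ (h.Z_le x.2) _ y.2))
    · have h1 := mem_center_iff.1 (hle (x := ⟨z, hH (h.Z_le hz)⟩) (mem_subgroupOf.2 hz)) ⟨g, hg⟩
      exact hgz (congrArg Subtype.val h1)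

/-- Sections of order not divisible by 125 have abelian Sylow subgroups. In the others H contains P
and |N| divides 8, so N meets P trivially, centralizes it, and is trivial because the centralizer of
P lies in P. -/
theorem classC (h : ExtraspecialByC8 P Z t) : ClassC G := by
  intro H N _
  have := h.normal_P
  by_cases hd : 125 ∣ Nat.card (H ⧸ N)
  · have hHN : Nat.card H = Nat.card (H ⧸ N) * Nat.card N := card_eq_card_quotient_mul_card_subgroup N
    obtain ⟨d, hd8, -, hcard⟩ := h.card_eq H
    have hcop : Nat.Coprime 125 d :=
      Nat.Coprime.coprime_dvd_right hd8 (by norm_num)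
    have h125 : 125 ∣ Nat.card (P ⊓ H : Subgroup G) := by
      refine hcop.dvd_of_dvd_mul_right ?_
      rw [← hcard, hHN]
      exact hd.mul_right _
    have hPH : P ≤ H := by
      have h1 : P ⊓ H = P := eq_of_le_of_card_ge inf_le_left
        (by rw [h.card_P]; exact Nat.le_of_dvd Nat.card_pos h125)
      exact inf_eq_left.1 h1
    have hN8 : Nat.card N ∣ 8 := by
      obtain ⟨c, hc⟩ := hd
      have h1 : Nat.card H ∣ 1000 := h.card_G ▸ card_subgroup_dvd_card H
      rw [hHN, hc, show 1000 = 125 * 8 from rfl, mul_assoc] at h1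
      exact (Dvd.intro_left c rfl).trans ((Nat.mul_dvd_mul_iff_left (by norm_num)).1 h1)
    have hNbot : N = ⊥ := by
      have hNP : ∀ n ∈ N, (n : G) ∈ P → n = 1 := by
        intro n hn hnP
        have h1 : n ^ 5 = 1 := Subtype.ext (h.pow_five n hnP)
        have h2 : n ^ 8 = 1 := by
          have : (⟨n, hn⟩ : N) ^ 8 = 1 := by
            obtain ⟨c, hc⟩ := hN8
            rw [hc, pow_mul, pow_card_eq_one', one_pow]
          exact congrArg Subtype.val this
        have h3 : n ∈ (⊥ : Subgroup H) :=
          mem_of_pow_mem_of_coprime (m := 5) (n := 8) (by norm_num) h1 h2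
        exact h3
      rw [eq_bot_iff_forall]
      intro n hn
      refine hNP n hn (h.mem_P_of_forall_commute fun a ha => ?_)
      have h1 : n * ⟨a, hPH ha⟩ * n⁻¹ * ⟨a, hPH ha⟩⁻¹ = 1 := by
        refine hNP _ ?_ ?_
        · rw [mul_assoc, mul_assoc, ← mul_assoc _ n⁻¹]
          exact N.mul_mem hn (Normal.conj_mem inferInstance _ (N.inv_mem hn) _)
        · exact P.mul_mem (Normal.conj_mem inferInstance a ha (n : G)) (P.inv_mem ha)
      rw [mul_inv_eq_one, mul_inv_eq_iff_eq_mul] at h1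
      exact congrArg Subtype.val h1
    subst hNbot
    exact (h.abelianOrNoncentral_of_le hPH).of_equiv
      (QuotientGroup.quotientBot (G := H)).symm
  · have h1 := h.solvableAbelianSylow_quotient H N hd
    refine ABySup.abelianOrNoncentral ⟨⊤, inferInstance, ?_, ?_⟩
    · exact h1.of_injective (⊤ : Subgroup (H ⧸ N)).subtype (subtype_injective _)
    · have : Subsingleton ((H ⧸ N) ⧸ (⊤ : Subgroup (H ⧸ N))) :=
        QuotientGroup.subsingleton_quotient_top
      exact ⟨0, fun _ => ⊥, fun _ => inferInstance, rfl, Subsingleton.elim _ _,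
        fun i hi => absurd hi (Nat.not_lt_zero i)⟩

end ExtraspecialByC8

end MonomialClasses

namespace MonomialClasses

/-! ### Hats and conjugates in the rational group algebra -/

open Subgroup

section HatElements

variable {G : Type u} [Group G]

open scoped Classical in
lemma coeff_hat [Finite G] (H : Subgroup G) (g : G) :
    (hat H).coeff g = if g ∈ H then (Nat.card H : ℚ)⁻¹ else 0 := by
  have := Fintype.ofFinite H
  rw [hat, finsum_eq_sum_of_fintype, MonoidAlgebra.coeff_smul_apply, MonoidAlgebra.coeff_sum,
    Finsupp.finsetSum_apply]
  simp only [MonoidAlgebra.coeff_single, Finsupp.single_apply]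
  split_ifs with hg
  · rw [Finset.sum_eq_single (⟨g, hg⟩ : H)]
    · simp
    · intro b _ hb
      rw [if_neg]
      exact fun h => hb (Subtype.ext h)
    · simp
  · rw [Finset.sum_eq_zero]
    · simp
    · intro b _
      rw [if_neg]
      exact fun h => hg (h ▸ b.2)

lemma coeff_one_hat [Finite G] (H : Subgroup G) : (hat H).coeff 1 = (Nat.card H : ℚ)⁻¹ := by
  rw [coeff_hat, if_pos H.one_mem]

lemma single_mul_hat [Finite G] {H : Subgroup G} {k : G} (hk : k ∈ H) :
    MonoidAlgebra.single k (1 : ℚ) * hat H = hat H := by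
  ext g
  rw [MonoidAlgebra.coeff_single_mul_apply, one_mul, coeff_hat, coeff_hat]
  classical exact if_congr (H.mul_mem_cancel_left (H.inv_mem hk)) rfl rfl

lemma hat_mul_single [Finite G] {H : Subgroup G} {k : G} (hk : k ∈ H) :
    hat H * MonoidAlgebra.single k (1 : ℚ) = hat H := by
  ext g
  rw [MonoidAlgebra.coeff_mul_single_apply, mul_one, coeff_hat, coeff_hat]
  classical exact if_congr (H.mul_mem_cancel_right (H.inv_mem hk)) rfl rfl

lemma hat_mul_of_forall [Finite G] {K : Subgroup G} {a : MonoidAlgebra ℚ G}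
    (h : ∀ k ∈ K, MonoidAlgebra.single k (1 : ℚ) * a = a) : hat K * a = a := by
  have := Fintype.ofFinite K
  rw [hat, finsum_eq_sum_of_fintype, smul_mul_assoc, Finset.sum_mul,
    Finset.sum_congr rfl (fun (k : K) _ => h k k.2), Finset.sum_const, Finset.card_univ,
    ← Nat.card_eq_fintype_card, ← Nat.cast_smul_eq_nsmul ℚ, smul_smul, inv_mul_cancel₀, one_smul]
  exact_mod_cast Nat.card_pos.ne'

lemma mul_hat_of_forall [Finite G] {K : Subgroup G} {a : MonoidAlgebra ℚ G}
    (h : ∀ k ∈ K, a * MonoidAlgebra.single k (1 : ℚ) = a) : a * hat K = a := by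
  have := Fintype.ofFinite K
  rw [hat, finsum_eq_sum_of_fintype, mul_smul_comm, Finset.mul_sum,
    Finset.sum_congr rfl (fun (k : K) _ => h k k.2), Finset.sum_const, Finset.card_univ,
    ← Nat.card_eq_fintype_card, ← Nat.cast_smul_eq_nsmul ℚ, smul_smul, inv_mul_cancel₀, one_smul]
  exact_mod_cast Nat.card_pos.ne'

lemma hat_mul_hat [Finite G] {K L : Subgroup G} (h : K ≤ L) : hat K * hat L = hat L :=
  hat_mul_of_forall fun _ hk => single_mul_hat (h hk)

lemma hat_mul_hat' [Finite G] {K L : Subgroup G} (h : K ≤ L) : hat L * hat K = hat L :=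
  mul_hat_of_forall fun _ hk => hat_mul_single (h hk)

lemma commute_single_hat_of_normal [Finite G] (N : Subgroup G) [N.Normal] (g : G) :
    Commute (MonoidAlgebra.single g (1 : ℚ)) (hat N) :=
  commute_single_hat (H := ⊤) le_top inferInstance (mem_top g)

lemma commute_of_forall_single {a : MonoidAlgebra ℚ G}
    (h : ∀ g, Commute (MonoidAlgebra.single g (1 : ℚ)) a) (b : MonoidAlgebra ℚ G) :
    Commute b a := by
  induction b using MonoidAlgebra.induction_linear with
  | zero => exact Commute.zero_left _
  | add x y hx hy => exact hx.add_left hy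
  | single g r =>
    have : MonoidAlgebra.single g r = r • MonoidAlgebra.single g (1 : ℚ) := by
      ext; simp
    rw [this]
    exact (h g).smul_left r

/-- The coefficient at `1` of a product of two hats. -/
lemma coeff_one_hat_mul_hat [Finite G] (A B : Subgroup G) :
    (hat A * hat B).coeff 1 =
      Nat.card (A ⊓ B : Subgroup G) * ((Nat.card A : ℚ)⁻¹ * (Nat.card B : ℚ)⁻¹) := by
  classical
  have := Fintype.ofFinite A
  rw [hat, finsum_eq_sum_of_fintype, smul_mul_assoc, Finset.sum_mul,
    MonoidAlgebra.coeff_smul_apply, MonoidAlgebra.coeff_sum, Finsupp.finsetSum_apply]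
  simp only [MonoidAlgebra.coeff_single_mul_apply, coeff_hat, mul_one, one_mul, inv_mem_iff]
  rw [Finset.sum_ite, Finset.sum_const_zero, add_zero, Finset.sum_const, nsmul_eq_mul, smul_eq_mul]
  have : Nat.card (A ⊓ B : Subgroup G) = (Finset.univ.filter fun a : A => (a : G) ∈ B).card := by
    rw [← Fintype.card_subtype, ← Nat.card_eq_fintype_card]
    exact Nat.card_congr (Equiv.subtypeSubtypeEquivSubtypeInter (· ∈ A) (· ∈ B)).symm
  rw [this]
  ring

end HatElements

section Conjugates

variable {G : Type u} [Group G]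

lemma coeff_one_conjBy (a : MonoidAlgebra ℚ G) (g : G) : (conjBy a g).coeff 1 = a.coeff 1 := by
  rw [conjBy, MonoidAlgebra.coeff_mul_single_apply, MonoidAlgebra.coeff_single_mul_apply]
  simp

lemma conjBy_one (a : MonoidAlgebra ℚ G) : conjBy a 1 = a := by
  rw [conjBy, inv_one, ← MonoidAlgebra.one_def, one_mul, mul_one]

lemma single_mul_single_inv (g : G) :
    MonoidAlgebra.single g (1 : ℚ) * MonoidAlgebra.single g⁻¹ 1 = 1 := by
  rw [MonoidAlgebra.single_mul_single, mul_inv_cancel, one_mul, MonoidAlgebra.one_def]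

lemma single_inv_mul_single (g : G) :
    MonoidAlgebra.single g⁻¹ (1 : ℚ) * MonoidAlgebra.single g 1 = 1 := by
  rw [MonoidAlgebra.single_mul_single, inv_mul_cancel, one_mul, MonoidAlgebra.one_def]

lemma conjBy_mul_conjBy (a b : MonoidAlgebra ℚ G) (g : G) :
    conjBy a g * conjBy b g = conjBy (a * b) g := by
  simp only [conjBy]
  rw [mul_assoc _ (MonoidAlgebra.single g 1), ← mul_assoc (MonoidAlgebra.single g 1),
    ← mul_assoc (MonoidAlgebra.single g 1), single_mul_single_inv, one_mul]
  simp only [mul_assoc]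

lemma conjBy_mul (a : MonoidAlgebra ℚ G) (g h : G) : conjBy a (g * h) = conjBy (conjBy a g) h := by
  simp only [conjBy, mul_inv_rev]
  rw [← one_mul (1 : ℚ), ← MonoidAlgebra.single_mul_single, ← MonoidAlgebra.single_mul_single]
  simp only [mul_assoc, one_mul]

lemma mem_conjugates_self (a : MonoidAlgebra ℚ G) : a ∈ conjugates a := ⟨1, conjBy_one a⟩

/-- If `K` is the set of the group elements that fix `a` by left multiplication, then `a` has at
least `|G : N_G(K)|` conjugates. -/
lemma card_le_card_conjugates_mul [Finite G] {K : Subgroup G} {a : MonoidAlgebra ℚ G}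
    (hK : ∀ g, MonoidAlgebra.single g (1 : ℚ) * a = a ↔ g ∈ K) :
    Nat.card G ≤ Nat.card (conjugates a) * Nat.card (normalizer (K : Set G)) := by
  -- Conjugation carries the left stabilizer of a to that of the conjugate, so an element fixing a
  -- normalizes K.
  have hstab : ∀ g, conjBy a g = a → g ∈ normalizer (K : Set G) := by
    have h1 : ∀ g, conjBy a g = a → ∀ k ∈ K, g⁻¹ * k * g ∈ K := by
      intro g hg k hk
      rw [← hK] at hk ⊢
      calc _ = MonoidAlgebra.single (g⁻¹ * k * g) (1 : ℚ) * conjBy a g := by rw [hg]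
        _ = MonoidAlgebra.single g⁻¹ 1 * (MonoidAlgebra.single k 1 * a)
            * MonoidAlgebra.single g 1 := by
          simp only [conjBy, ← mul_assoc, MonoidAlgebra.single_mul_single, one_mul,
            mul_inv_cancel_right]
        _ = a := by rw [hk]; exact hg
    intro g hg
    have hg' : conjBy a g⁻¹ = a := by
      conv_lhs => rw [← hg]
      rw [← conjBy_mul, mul_inv_cancel, conjBy_one]
    rw [mem_normalizer_iff]
    intro k
    refine ⟨fun hk => by simpa using h1 g⁻¹ hg' k hk, fun hk => ?_⟩
    have := h1 g hg _ hk
    simpa [mul_assoc] using this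
  have hfin : Finite (conjugates a) := Set.finite_range _
  rw [← Nat.card_prod]
  choose s hs using fun b : conjugates a => b.2
  have hmem : ∀ g, conjBy a g ∈ conjugates a := fun g => ⟨g, rfl⟩
  have hs' : ∀ g, g * (s ⟨conjBy a g, hmem g⟩)⁻¹ ∈ normalizer (K : Set G) := by
    intro g
    apply hstab
    have h1 := hs ⟨conjBy a g, hmem g⟩
    generalize s ⟨conjBy a g, hmem g⟩ = r at h1
    rw [conjBy_mul]
    change conjBy a r = conjBy a g at h1
    rw [← h1, ← conjBy_mul, mul_inv_cancel, conjBy_one]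
  refine Nat.card_le_card_of_injective
    (fun g => (⟨conjBy a g, hmem g⟩, ⟨g * (s ⟨conjBy a g, hmem g⟩)⁻¹, hs' g⟩)) ?_
  intro g g' h
  simp only [Prod.mk.injEq, Subtype.mk.injEq] at h
  obtain ⟨h1, h2⟩ := h
  simp only [h1] at h2
  exact mul_right_cancel h2

variable {a : MonoidAlgebra ℚ G}

lemma isIdempotentElem_of_mem_conjugates (ha : IsIdempotentElem a) {b : MonoidAlgebra ℚ G}
    (hb : b ∈ conjugates a) : IsIdempotentElem b := by
  obtain ⟨g, rfl⟩ := hb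
  rw [IsIdempotentElem, conjBy_mul_conjBy, ha]

variable [Finite G]

lemma finite_conjugates (a : MonoidAlgebra ℚ G) : (conjugates a).Finite := Set.finite_range _

lemma coeff_one_finsum_conjugates (a : MonoidAlgebra ℚ G) :
    (∑ᶠ b ∈ conjugates a, b).coeff 1 = Nat.card (conjugates a) * a.coeff 1 := by
  rw [finsum_mem_eq_finite_toFinset_sum _ (finite_conjugates a), MonoidAlgebra.coeff_sum,
    Finsupp.finsetSum_apply, Finset.sum_congr rfl (g := fun _ => a.coeff 1), Finset.sum_const,
    nsmul_eq_mul, Nat.card_coe_set_eq, Set.ncard_eq_toFinset_card _ (finite_conjugates a)]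
  intro b hb
  obtain ⟨g, rfl⟩ := (finite_conjugates a).mem_toFinset.1 hb
  exact coeff_one_conjBy a g

lemma mul_finsum_conjugates (ha : IsIdempotentElem a)
    (ho : (conjugates a).Pairwise fun a b => a * b = 0) {b : MonoidAlgebra ℚ G}
    (hb : b ∈ conjugates a) : b * ∑ᶠ c ∈ conjugates a, c = b := by
  rw [finsum_mem_eq_finite_toFinset_sum _ (finite_conjugates a), Finset.mul_sum,
    Finset.sum_eq_single b]
  · exact isIdempotentElem_of_mem_conjugates ha hb
  · intro c hc hcb
    exact ho hb ((finite_conjugates a).mem_toFinset.1 hc) hcb.symm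
  · intro h
    exact absurd ((finite_conjugates a).mem_toFinset.2 hb) h

lemma isIdempotentElem_finsum_conjugates (ha : IsIdempotentElem a)
    (ho : (conjugates a).Pairwise fun a b => a * b = 0) :
    IsIdempotentElem (∑ᶠ c ∈ conjugates a, c) := by
  have h := fun b hb => mul_finsum_conjugates ha ho (b := b) hb
  rw [finsum_mem_eq_finite_toFinset_sum _ (finite_conjugates a)] at h ⊢
  rw [IsIdempotentElem, Finset.sum_mul]
  exact Finset.sum_congr rfl fun b hb => h b ((finite_conjugates a).mem_toFinset.1 hb)

end Conjugates

end MonomialClasses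

namespace MonomialClasses

/-! ### The elements `ε(H, K)` for `H / K` cyclic -/

open Subgroup

section CyclicQuotient

variable {G : Type u} [Group G] {H K : Subgroup G} {Q : Type*} [Group Q] {f : H →* Q}

lemma map_eq_one_iff_of_ker_eq (hf : f.ker = K.subgroupOf H) (x : H) : f x = 1 ↔ (x : G) ∈ K := by
  rw [← MonoidHom.mem_ker, hf, mem_subgroupOf]

/-- H/K is cyclic, so commutators of H lie in K; the normality condition in `minimalOver` is
automatic. -/
lemma normal_subgroupOf_of_ker_le [IsCyclic Q] (hf : f.ker = K.subgroupOf H) {M : Subgroup G}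
    (hM : K ≤ M) : (M.subgroupOf H).Normal := by
  refine ⟨fun m hm g => ?_⟩
  have h1 : g * m * g⁻¹ * m⁻¹ ∈ f.ker := by
    rw [MonoidHom.mem_ker]
    simp only [map_mul, map_inv]
    rw [(IsCyclic.isMulCommutative (α := Q)).is_comm.comm (f g) (f m), mul_inv_cancel_right, mul_inv_cancel]
  rw [hf] at h1
  have h2 : g * m * g⁻¹ * m⁻¹ ∈ M.subgroupOf H := hM h1
  simpa using (M.subgroupOf H).mul_mem h2 hm

lemma relIndex_eq_card_map (hf : f.ker = K.subgroupOf H) {L : Subgroup G} (hL : L ≤ H) :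
    K.relIndex L = Nat.card ((L.subgroupOf H).map f) := by
  rw [← relIndex_ker, hf, relIndex_subgroupOf hL]

variable [IsCyclic Q]

lemma eq_of_mem_minimalOver (hf : f.ker = K.subgroupOf H) {L M : Subgroup G}
    (hL : L ∈ minimalOver H K) (hM : K < M) (hML : M ≤ L) : M = L :=
  le_antisymm hML (hL.2 ⟨hML.trans hL.1.1, normal_subgroupOf_of_ker_le hf hM.le, hM⟩ hML)

variable [Finite G]

lemma exists_mem_minimalOver (hf : f.ker = K.subgroupOf H) (hKH : K ≤ H) {g : G} (hg : g ∈ H)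
    (hgK : g ∉ K) : ∃ L ∈ minimalOver H K, L ≤ K ⊔ zpowers g := by
  obtain ⟨L, hL, hmin⟩ := (Set.toFinite {M : Subgroup G | M ≤ H ∧ (M.subgroupOf H).Normal ∧
    K < M}).isPWO.exists_le_minimal (a := K ⊔ zpowers g)
    ⟨sup_le hKH ((zpowers_le).2 hg), normal_subgroupOf_of_ker_le hf le_sup_left,
      lt_of_le_of_ne le_sup_left fun h => hgK (h ▸ mem_sup_right (mem_zpowers g))⟩
  exact ⟨L, hmin, hL⟩

/-- A member of `minimalOver H K` is determined by its index over `K`, which is prime. -/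
lemma prime_relIndex_of_mem_minimalOver (hf : f.ker = K.subgroupOf H) {L : Subgroup G}
    (hL : L ∈ minimalOver H K) :
    (K.relIndex L).Prime ∧ ∀ x : H, (x : G) ∈ L ↔ f x ^ K.relIndex L = 1 := by
  classical
  have hLH := hL.1.1
  have hKL := hL.1.2.2
  obtain ⟨x, hxL, hxK⟩ := SetLike.exists_of_lt hKL
  have hpos : 0 < orderOf x := orderOf_pos x
  have hfx : f ⟨x, hLH hxL⟩ ≠ 1 := fun h => hxK ((map_eq_one_iff_of_ker_eq hf _).1 h)
  have hfin : IsOfFinOrder (f ⟨x, hLH hxL⟩) :=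
    f.isOfFinOrder (isOfFinOrder_of_finite _)
  set r := orderOf (f ⟨x, hLH hxL⟩) with hr
  have hr0 : 0 < r := hfin.orderOf_pos
  have hr1 : r ≠ 1 := fun h => hfx (orderOf_eq_one_iff.1 h)
  set p := r.minFac with hp
  have hpp : p.Prime := Nat.minFac_prime hr1
  have hpr : p ∣ r := Nat.minFac_dvd r
  set y : H := ⟨x, hLH hxL⟩ ^ (r / p) with hy
  have hyL : (y : G) ∈ L := L.pow_mem hxL _
  have hyo : orderOf (f y) = p := by
    rw [hy, map_pow, orderOf_pow_of_dvd (Nat.div_pos (Nat.le_of_dvd hr0 hpr) hpp.pos).ne'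
      (Nat.div_dvd_of_dvd hpr), ← hr, Nat.div_div_self hpr hr0.ne']
  have hyK : (y : G) ∉ K := by
    intro h
    rw [← map_eq_one_iff_of_ker_eq hf] at h
    rw [h, orderOf_one] at hyo
    exact hpp.one_lt.ne hyo
  have hLy : K ⊔ zpowers (y : G) = L := eq_of_mem_minimalOver hf hL
    (lt_of_le_of_ne le_sup_left fun h => hyK (h ▸ mem_sup_right (mem_zpowers (y : G))))
    (sup_le hKL.le ((zpowers_le).2 hyL))
  have hmap : (L.subgroupOf H).map f = zpowers (f y) := by
    refine le_antisymm ?_ ((zpowers_le).2 ⟨y, hyL, rfl⟩)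
    rw [map_le_iff_le_comap]
    have hle : L ≤ ((zpowers (f y)).comap f).map H.subtype := by
      rw [← hLy]
      refine sup_le (fun k hk => ⟨⟨k, hLH (hKL.le hk)⟩, ?_, rfl⟩) ((zpowers_le).2 ⟨y, ?_, rfl⟩)
      · have h1 : f ⟨k, hLH (hKL.le hk)⟩ = 1 := (map_eq_one_iff_of_ker_eq hf _).2 hk
        change f _ ∈ zpowers (f y)
        exact h1 ▸ one_mem _
      · exact mem_zpowers (f y)
    intro l hl
    obtain ⟨l', hl', h⟩ := hle hl
    rwa [← Subtype.ext (a1 := l') (a2 := l) h]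
  have hidx : K.relIndex L = p := by
    rw [relIndex_eq_card_map hf hLH, hmap, Nat.card_zpowers, hyo]
  refine ⟨hidx ▸ hpp, fun w => ?_⟩
  rw [hidx]
  constructor
  · intro hw
    have h1 : f w ∈ zpowers (f y) := hmap ▸ ⟨w, hw, rfl⟩
    obtain ⟨n, hn⟩ := h1
    change f y ^ n = f w at hn
    rw [← hn, ← zpow_natCast, ← zpow_mul, mul_comm, zpow_mul, zpow_natCast, ← hyo,
      pow_orderOf_eq_one, one_zpow]
  · intro hw
    -- A cyclic group has at most p solutions of a^p = 1, and the powers of the image of y already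
    -- provide p of them.
    have hw' : f w ∈ zpowers (f y) := by
      have hR : Finite f.range := Finite.of_surjective _ f.rangeRestrict_surjective
      have := Fintype.ofFinite f.range
      have hc := IsCyclic.card_pow_eq_one_le (α := f.range) hpp.pos
      have hsub : (Finset.univ.filter fun a : f.range => a ∈ zpowers (f.rangeRestrict y)) ⊆
          Finset.univ.filter fun a : f.range => a ^ p = 1 := by
        intro a ha
        obtain ⟨n, hn⟩ := (Finset.mem_filter.1 ha).2
        refine Finset.mem_filter.2 ⟨Finset.mem_univ _, ?_⟩
        change f.rangeRestrict y ^ n = a at hn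
        rw [← hn, ← zpow_natCast, ← zpow_mul, mul_comm, zpow_mul, zpow_natCast]
        have : f.rangeRestrict y ^ p = 1 := by
          apply Subtype.ext
          change f y ^ p = 1
          rw [← hyo, pow_orderOf_eq_one]
        rw [this, one_zpow]
      have hcard : (Finset.univ.filter fun a : f.range =>
          a ∈ zpowers (f.rangeRestrict y)).card = p := by
        rw [← Fintype.card_subtype, ← Nat.card_eq_fintype_card]
        rw [Nat.card_zpowers, ← hyo]
        exact (orderOf_injective f.range.subtype (subtype_injective _) (f.rangeRestrict y)).symm
      have heq := Finset.eq_of_subset_of_card_le hsub (by rw [hcard]; exact hc)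
      have hmem : f.rangeRestrict w ∈ Finset.univ.filter fun a : f.range => a ^ p = 1 :=
        Finset.mem_filter.2 ⟨Finset.mem_univ _, Subtype.ext hw⟩
      rw [← heq] at hmem
      obtain ⟨n, hn⟩ := (Finset.mem_filter.1 hmem).2
      exact ⟨n, congrArg Subtype.val hn⟩
    rw [← hmap] at hw'
    obtain ⟨l, hl, hlw⟩ := hw'
    have h1 : l⁻¹ * w ∈ f.ker := by
      rw [MonoidHom.mem_ker, map_mul, map_inv, hlw, inv_mul_cancel]
    rw [hf] at h1
    have h2 := L.mul_mem hl (hKL.le h1)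
    simpa using h2

lemma eq_of_relIndex_eq (hf : f.ker = K.subgroupOf H) {L M : Subgroup G}
    (hL : L ∈ minimalOver H K) (hM : M ∈ minimalOver H K) (h : K.relIndex L = K.relIndex M) :
    L = M := by
  have h1 := (prime_relIndex_of_mem_minimalOver hf hL).2
  have h2 := (prime_relIndex_of_mem_minimalOver hf hM).2
  ext x
  constructor
  · intro hx
    exact (h2 ⟨x, hL.1.1 hx⟩).2 (h ▸ (h1 ⟨x, hL.1.1 hx⟩).1 hx)
  · intro hx
    exact (h1 ⟨x, hM.1.1 hx⟩).2 (h ▸ (h2 ⟨x, hM.1.1 hx⟩).1 hx)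

end CyclicQuotient

section Epsilon

variable {G : Type u} [Group G] [Finite G] {H K : Subgroup G}

lemma epsilon_self (H : Subgroup G) : epsilon H H = hat H := if_pos rfl

lemma epsilon_eq_of_minimalOver_eq_singleton {L : Subgroup G} (hne : H ≠ K)
    (h : minimalOver H K = {L}) : epsilon H K = hat K - hat L := by
  classical
  have hs : (Set.toFinite (minimalOver H K)).toFinset = {L} := by
    ext; simp [h]
  rw [epsilon, if_neg hne]
  exact (Finset.noncommProd_congr hs (fun _ _ => rfl) _).trans (Finset.noncommProd_singleton _ _)

lemma epsilon_eq_of_minimalOver_eq_pair {L M : Subgroup G} (hne : H ≠ K) (hLM : L ≠ M)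
    (h : minimalOver H K = {L, M}) : epsilon H K = (hat K - hat L) * (hat K - hat M) := by
  classical
  have hs : (Set.toFinite (minimalOver H K)).toFinset = insert L {M} := by
    ext; simp [h]
  rw [epsilon, if_neg hne]
  exact (Finset.noncommProd_congr hs (fun _ _ => rfl) _).trans
    ((Finset.noncommProd_insert_of_notMem _ _ _ _ (by simpa using hLM)).trans
      (congrArg (_ * ·) (Finset.noncommProd_singleton _ _)))

lemma isIdempotentElem_hat_sub_hat {L : Subgroup G} (h : K ≤ L) :
    IsIdempotentElem (hat K - hat L) := by
  rw [IsIdempotentElem, sub_mul, mul_sub, mul_sub, hat_mul_hat le_rfl, hat_mul_hat h,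
    hat_mul_hat' h, hat_mul_hat le_rfl, sub_self, sub_zero]

lemma hat_mul_hat_sub_hat {L : Subgroup G} (h : K ≤ L) : hat L * (hat K - hat L) = 0 := by
  rw [mul_sub, hat_mul_hat' h, hat_mul_hat le_rfl, sub_self]

lemma hat_mul_hat_sub_hat' {L : Subgroup G} (h : K ≤ L) :
    hat K * (hat K - hat L) = hat K - hat L := by
  rw [mul_sub, hat_mul_hat h, hat_mul_hat le_rfl]

lemma coeff_hat_of_not_mem {L : Subgroup G} (h : L ≤ H) {g : G} (hg : g ∉ H) :
    (hat L).coeff g = 0 := by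
  classical
  rw [coeff_hat, if_neg fun hl => hg (h hl)]

lemma coeff_hat_mul_of_not_mem {L : Subgroup G} (h : L ≤ H) {a : MonoidAlgebra ℚ G}
    (ha : ∀ g ∉ H, a.coeff g = 0) {g : G} (hg : g ∉ H) : (hat L * a).coeff g = 0 := by
  have := Fintype.ofFinite L
  rw [hat, finsum_eq_sum_of_fintype, smul_mul_assoc, Finset.sum_mul,
    MonoidAlgebra.coeff_smul_apply, MonoidAlgebra.coeff_sum, Finsupp.finsetSum_apply,
    Finset.sum_eq_zero, smul_zero]
  intro l _
  rw [MonoidAlgebra.coeff_single_mul_apply, ha, mul_zero]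
  rwa [H.mul_mem_cancel_left (H.inv_mem (h l.2))]

/-- If an element `a` supported on `H` is fixed by `K` and annihilated by all the `L̂`, with `L`
in `minimalOver H K`, then `K` is the left stabilizer of `a`. -/
lemma single_mul_eq_self_iff {Q : Type*} [Group Q] [IsCyclic Q] {f : H →* Q}
    (hf : f.ker = K.subgroupOf H) (hKH : K ≤ H) {a : MonoidAlgebra ℚ G} (ha0 : a.coeff 1 ≠ 0)
    (ha : ∀ g ∉ H, a.coeff g = 0) (hK : hat K * a = a)
    (hL : ∀ L ∈ minimalOver H K, hat L * a = 0) (g : G) :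
    MonoidAlgebra.single g (1 : ℚ) * a = a ↔ g ∈ K := by
  constructor
  · intro hg
    have hgH : g ∈ H := by
      by_contra hgH
      refine ha0 ?_
      have h1 := congrArg (fun b => b.coeff g) hg
      simp only [MonoidAlgebra.coeff_single_mul_apply, one_mul, inv_mul_cancel] at h1
      rw [h1, ha g hgH]
    by_contra hgK
    obtain ⟨L, hLm, hLg⟩ := exists_mem_minimalOver hf hKH hgH hgK
    have h1 : hat L * a = a := by
      -- The left stabilizer of a contains K and g, hence L, so that L̂ fixes a; but L̂ annihilates
      -- a.
      let S : Subgroup G :=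
        { carrier := {x | MonoidAlgebra.single x (1 : ℚ) * a = a}
          one_mem' := by
            change MonoidAlgebra.single 1 (1 : ℚ) * a = a
            rw [← MonoidAlgebra.one_def, one_mul]
          mul_mem' := by
            intro x y hx hy
            change MonoidAlgebra.single (x * y) (1 : ℚ) * a = a
            change MonoidAlgebra.single x (1 : ℚ) * a = a at hx
            change MonoidAlgebra.single y (1 : ℚ) * a = a at hy
            rw [← one_mul (1 : ℚ), ← MonoidAlgebra.single_mul_single, mul_assoc, hy, hx]
          inv_mem' := by
            intro x hx
            change MonoidAlgebra.single x (1 : ℚ) * a = a at hx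
            change MonoidAlgebra.single x⁻¹ (1 : ℚ) * a = a
            conv_lhs => rw [← hx, ← mul_assoc, single_inv_mul_single, one_mul] }
      refine hat_mul_of_forall fun k hk => ?_
      have hS : K ⊔ zpowers g ≤ S := by
        refine sup_le (fun k hk => ?_) ((zpowers_le).2 hg)
        change MonoidAlgebra.single k (1 : ℚ) * a = a
        rw [← hK, ← mul_assoc, single_mul_hat hk]
      exact hS (hLg hk)
    rw [hL L hLm] at h1
    rw [← h1] at ha0
    simp at ha0
  · intro hg
    rw [← hK, ← mul_assoc, single_mul_hat hg]

end Epsilon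

end MonomialClasses

namespace MonomialClasses

/-! ### Strong Shoda pairs -/

open Subgroup

variable {G : Type u} [Group G] {H K : Subgroup G}

lemma card_eq_relIndex_mul {L : Subgroup G} (h : K ≤ L) :
    (Nat.card L : ℚ) = K.relIndex L * Nat.card K := by
  have := relIndex_mul_relIndex ⊥ K L bot_le h
  rw [relIndex_bot_left, relIndex_bot_left] at this
  rw [← this]
  push_cast
  ring

variable [Finite G]

lemma IsStrongShodaPair.exists_hom (h : IsStrongShodaPair H K) :
    ∃ (Q : Type u) (_ : Group Q) (_ : IsCyclic Q) (f : H →* Q), f.ker = K.subgroupOf H := by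
  let f : H →* normalizer (K : Set G) ⧸ K.subgroupOf (normalizer (K : Set G)) :=
    (QuotientGroup.mk' _).comp (inclusion h.le_normalizer)
  have hr : f.range = imageInNormalizerQuotient H K := by
    rw [imageInNormalizerQuotient, MonoidHom.range_comp, inclusion_range]
  have hc := h.cyclic
  rw [← hr] at hc
  refine ⟨f.range, inferInstance, hc, f.rangeRestrict, ?_⟩
  rw [MonoidHom.ker_rangeRestrict, ← MonoidHom.comap_ker, QuotientGroup.ker_mk']
  rfl

/-- The properties of `ε(H, K)` for a strong Shoda pair `(H, K)` of a `{2, 5}`-group. -/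
theorem IsStrongShodaPair.epsilon_spec (h : IsStrongShodaPair H K)
    (hG : ∀ p, p.Prime → p ∣ Nat.card G → p = 2 ∨ p = 5) :
    IsIdempotentElem (epsilon H K) ∧ epsilon H K * hat K = epsilon H K ∧
      (∀ g, MonoidAlgebra.single g (1 : ℚ) * epsilon H K = epsilon H K ↔ g ∈ K) ∧
      ((epsilon H K).coeff 1 * Nat.card K = 1 ∨ (epsilon H K).coeff 1 * Nat.card K = 1 / 2 ∨
        (epsilon H K).coeff 1 * Nat.card K = 4 / 5 ∨
        ((epsilon H K).coeff 1 * Nat.card K = 2 / 5 ∧ 10 ∣ K.relIndex H)) := by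
  obtain ⟨Q, _, _, f, hf⟩ := h.exists_hom
  have hK0 : (Nat.card K : ℚ) ≠ 0 := by exact_mod_cast Nat.card_pos.ne'
  have hidx : ∀ L ∈ minimalOver H K, K.relIndex L = 2 ∨ K.relIndex L = 5 := fun L hL =>
    hG _ (prime_relIndex_of_mem_minimalOver hf hL).1
      ((relIndex_dvd_card K L).trans (card_subgroup_dvd_card L))
  have hdvd : ∀ L ∈ minimalOver H K, K.relIndex L ∣ K.relIndex H := fun L hL =>
    ⟨_, (relIndex_mul_relIndex K L H hL.1.2.2.le hL.1.1).symm⟩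
  have hself : hat K * hat K = hat K := hat_mul_hat le_rfl
  have hsub : ∀ L ∈ minimalOver H K, ∀ g ∉ H, (hat K - hat L).coeff g = 0 := by
    intro L hL g hg
    rw [MonoidAlgebra.coeff_sub, Finsupp.sub_apply, coeff_hat_of_not_mem h.le hg,
      coeff_hat_of_not_mem hL.1.1 hg, sub_zero]
  have hright : ∀ L ∈ minimalOver H K, (hat K - hat L) * hat K = hat K - hat L := by
    intro L hL
    rw [sub_mul, hself, hat_mul_hat' hL.1.2.2.le]
  -- Indices 2 and 5 give the values 1/2 and 4/5; when both occur the value is their product 2/5.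
  have hcoeff : ∀ L ∈ minimalOver H K,
      (hat K - hat L).coeff 1 * Nat.card K = 1 - (K.relIndex L : ℚ)⁻¹ := by
    intro L hL
    have hi : (K.relIndex L : ℚ) ≠ 0 := by
      exact_mod_cast (prime_relIndex_of_mem_minimalOver hf hL).1.ne_zero
    rw [MonoidAlgebra.coeff_sub, Finsupp.sub_apply, coeff_one_hat, coeff_one_hat,
      card_eq_relIndex_mul hL.1.2.2.le]
    field_simp
  by_cases hne : H = K
  · subst hne
    have hc : (hat H).coeff 1 * Nat.card H = 1 := by
      rw [coeff_one_hat, inv_mul_cancel₀ hK0]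
    rw [epsilon_self]
    refine ⟨hself, hself, single_mul_eq_self_iff hf le_rfl (left_ne_zero_of_mul_eq_one hc)
      (fun g hg => coeff_hat_of_not_mem le_rfl hg) hself fun L hL => ?_, Or.inl hc⟩
    exact absurd hL.1.2.2 (not_lt_of_ge hL.1.1)
  obtain ⟨x, hxH, hxK⟩ := SetLike.exists_of_lt (lt_of_le_of_ne h.le (Ne.symm hne))
  obtain ⟨L, hL, -⟩ := exists_mem_minimalOver hf h.le hxH hxK
  by_cases hall : ∀ M ∈ minimalOver H K, M = L
  · have hm : minimalOver H K = {L} := by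
      ext M
      exact ⟨fun hM => hall M hM, fun hM => by rwa [Set.mem_singleton_iff.1 hM]⟩
    rw [epsilon_eq_of_minimalOver_eq_singleton hne hm]
    have hc : (hat K - hat L).coeff 1 * Nat.card K = 1 / 2 ∨
        (hat K - hat L).coeff 1 * Nat.card K = 4 / 5 := by
      rw [hcoeff L hL]
      rcases hidx L hL with h2 | h5
      · left; rw [h2]; norm_num
      · right; rw [h5]; norm_num
    refine ⟨isIdempotentElem_hat_sub_hat hL.1.2.2.le, hright L hL,
      single_mul_eq_self_iff hf h.le ?_ (hsub L hL) (hat_mul_hat_sub_hat' hL.1.2.2.le) ?_, ?_⟩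
    · rintro h0
      rw [h0] at hc
      norm_num at hc
    · intro M hM
      rw [hall M hM]
      exact hat_mul_hat_sub_hat hL.1.2.2.le
    · rcases hc with hc | hc
      · exact Or.inr (Or.inl hc)
      · exact Or.inr (Or.inr (Or.inl hc))
  · push Not at hall
    obtain ⟨M, hM, hML⟩ := hall
    -- A minimal overgroup is determined by its index, so two different ones have indices 2 and 5.
    wlog h2 : K.relIndex L = 2 generalizing L M
    · refine this M hM L hL hML.symm ?_
      rcases hidx M hM with h2' | h5'
      · exact h2'
      · refine absurd (eq_of_relIndex_eq hf hM hL ?_) hML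
        rw [h5']
        exact ((hidx L hL).resolve_left h2).symm
    have h5 : K.relIndex M = 5 := by
      refine (hidx M hM).resolve_left fun h2' => hML (eq_of_relIndex_eq hf hM hL ?_)
      rw [h2', h2]
    have hm : minimalOver H K = {L, M} := by
      ext N
      constructor
      · intro hN
        rcases hidx N hN with h2' | h5'
        · exact Or.inl (eq_of_relIndex_eq hf hN hL (h2'.trans h2.symm))
        · exact Or.inr (eq_of_relIndex_eq hf hN hM (h5'.trans h5.symm))
      · rintro (rfl | rfl)
        · exact hL
        · exact hM
    have hcomm := commute_factors H K hL hM
    have hKL := hL.1.2.2.le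
    have hKM := hM.1.2.2.le
    rw [epsilon_eq_of_minimalOver_eq_pair hne hML.symm hm]
    have hinf : L ⊓ M = K := by
      refine le_antisymm ?_ (le_inf hKL hKM)
      rw [← relIndex_eq_one]
      have d1 : K.relIndex (L ⊓ M) ∣ 2 := h2 ▸
        ⟨_, (relIndex_mul_relIndex K (L ⊓ M) L (le_inf hKL hKM) inf_le_left).symm⟩
      have d2 : K.relIndex (L ⊓ M) ∣ 5 := h5 ▸
        ⟨_, (relIndex_mul_relIndex K (L ⊓ M) M (le_inf hKL hKM) inf_le_right).symm⟩
      exact Nat.dvd_one.1 (Nat.dvd_gcd d1 d2)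
    have hc : ((hat K - hat L) * (hat K - hat M)).coeff 1 * Nat.card K = 2 / 5 := by
      rw [sub_mul, mul_sub, mul_sub, hself, hat_mul_hat hKM, hat_mul_hat' hKL]
      simp only [MonoidAlgebra.coeff_sub, Finsupp.sub_apply, coeff_one_hat,
        coeff_one_hat_mul_hat, hinf, card_eq_relIndex_mul hKL, card_eq_relIndex_mul hKM, h2, h5]
      field_simp
      norm_num
    refine ⟨?_, ?_, single_mul_eq_self_iff hf h.le ?_ ?_ ?_ ?_, ?_⟩
    · rw [IsIdempotentElem, hcomm.symm.mul_mul_mul_comm, isIdempotentElem_hat_sub_hat hKL,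
        isIdempotentElem_hat_sub_hat hKM]
    · rw [mul_assoc, hright M hM]
    · intro h0
      rw [h0] at hc
      norm_num at hc
    · intro g hg
      rw [sub_mul, MonoidAlgebra.coeff_sub, Finsupp.sub_apply,
        coeff_hat_mul_of_not_mem h.le (hsub M hM) hg,
        coeff_hat_mul_of_not_mem hL.1.1 (hsub M hM) hg, sub_zero]
    · rw [← mul_assoc, hat_mul_hat_sub_hat' hKL]
    · intro N hN
      rw [hm] at hN
      rcases hN with rfl | rfl
      · rw [← mul_assoc, hat_mul_hat_sub_hat hKL, zero_mul]
      · rw [hcomm.eq, ← mul_assoc, hat_mul_hat_sub_hat hKM, zero_mul]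
    · refine Or.inr (Or.inr (Or.inr ⟨hc, ?_⟩))
      exact Nat.Coprime.mul_dvd_of_dvd_of_dvd (m := 2) (n := 5) (by norm_num)
        (h2 ▸ hdvd L hL) (h5 ▸ hdvd M hM)

/-- If the idempotent `e` is a multiple of `e(G, H, K)`, then it is equal to it, and
`e` restricts to the identity on `ε(H, K)`. -/
theorem IsStrongShodaPair.eq_eSum (h : IsStrongShodaPair H K) (hi : IsIdempotentElem (epsilon H K))
    {e : MonoidAlgebra ℚ G} (he : IsIdempotentElem e) (he0 : e ≠ 0) {α : ℚ}
    (hα : e = α • eSum H K) :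
    epsilon H K * e = epsilon H K ∧
      e.coeff 1 = Nat.card (conjugates (epsilon H K)) * (epsilon H K).coeff 1 := by
  have hS : IsIdempotentElem (eSum H K) := isIdempotentElem_finsum_conjugates hi h.orthogonal
  -- Both e and the sum of conjugates are idempotent, so α² = α, and e ≠ 0 excludes α = 0.
  have h1 : α = 1 := by
    have h2 : (α * α - α) • eSum H K = 0 := by
      rw [sub_smul, ← hα, mul_smul, ← hα, sub_eq_zero, hα, ← mul_smul]
      have := he
      rw [hα, IsIdempotentElem, smul_mul_smul_comm, hS] at this
      exact this
    rcases smul_eq_zero.1 h2 with h3 | h3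
    · have h4 : α * (α - 1) = 0 := by linarith
      rcases mul_eq_zero.1 h4 with h5 | h5
      · rw [h5, zero_smul] at hα
        exact absurd hα he0
      · linarith
    · rw [h3, smul_zero] at hα
      exact absurd hα he0
  rw [h1, one_smul] at hα
  rw [hα]
  exact ⟨mul_finsum_conjugates hi h.orthogonal (mem_conjugates_self _),
    coeff_one_finsum_conjugates _⟩

end MonomialClasses

namespace MonomialClasses

/-! ### A primitive central idempotent for the group of order `1000` -/

open Subgroup

section

variable {G : Type u} [Group G]

/-- The sum of the involutions in the group algebra. -/
noncomputable def involutionSum (G : Type u) [Group G] : MonoidAlgebra ℚ G :=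
  ∑ᶠ g : {g : G // g ^ 2 = 1 ∧ g ≠ 1}, MonoidAlgebra.single (g : G) (1 : ℚ)

lemma coeff_conj_of_commute {a : MonoidAlgebra ℚ G} {h : G}
    (ha : Commute (MonoidAlgebra.single h (1 : ℚ)) a) (g : G) :
    a.coeff (h * g * h⁻¹) = a.coeff g := by
  have h1 := congrArg (fun b => b.coeff (h * g)) ha.eq
  simp only [MonoidAlgebra.coeff_single_mul_apply, MonoidAlgebra.coeff_mul_single_apply, one_mul,
    mul_one, inv_mul_cancel_left] at h1
  exact h1.symm

lemma coeff_mul_hat (a : MonoidAlgebra ℚ G) (N : Subgroup G) [Fintype N] (g : G) :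
    (a * hat N).coeff g = (Nat.card N : ℚ)⁻¹ * ∑ z : N, a.coeff (g * z) := by
  rw [hat, finsum_eq_sum_of_fintype, mul_smul_comm, Finset.mul_sum,
    MonoidAlgebra.coeff_smul_apply, MonoidAlgebra.coeff_sum, Finsupp.finsetSum_apply, smul_eq_mul]
  congr 1
  refine Fintype.sum_equiv (Equiv.inv N) _ _ fun z => ?_
  rw [MonoidAlgebra.coeff_mul_single_apply, mul_one]
  rfl

variable [Finite G]

open scoped Classical in
lemma coeff_involutionSum (g : G) :
    (involutionSum G).coeff g = if g ^ 2 = 1 ∧ g ≠ 1 then 1 else 0 := by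
  have := Fintype.ofFinite G
  rw [involutionSum, finsum_eq_sum_of_fintype, MonoidAlgebra.coeff_sum, Finsupp.finsetSum_apply]
  simp only [MonoidAlgebra.coeff_single, Finsupp.single_apply]
  split_ifs with hg
  · rw [Finset.sum_eq_single (⟨g, hg⟩ : {g : G // g ^ 2 = 1 ∧ g ≠ 1})]
    · simp
    · intro b _ hb
      rw [if_neg]
      exact fun h => hb (Subtype.ext h)
    · simp
  · rw [Finset.sum_eq_zero]
    intro b _
    rw [if_neg]
    exact fun h => hg (h ▸ b.2)

lemma commute_single_involutionSum (h : G) :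
    Commute (MonoidAlgebra.single h (1 : ℚ)) (involutionSum G) := by
  ext g
  rw [MonoidAlgebra.coeff_single_mul_apply, MonoidAlgebra.coeff_mul_single_apply, one_mul, mul_one,
    coeff_involutionSum, coeff_involutionSum]
  have hg : h⁻¹ * g = h⁻¹ * (g * h⁻¹) * h := by group
  have h1 : (h⁻¹ * g) ^ 2 = 1 ↔ (g * h⁻¹) ^ 2 = 1 := by
    rw [hg, show (h⁻¹ * (g * h⁻¹) * h) ^ 2 = h⁻¹ * (g * h⁻¹) ^ 2 * h by simp [pow_two, mul_assoc]]
    exact ⟨fun h2 => by rw [mul_assoc, inv_mul_eq_one] at h2; exact (right_eq_mul.1 h2),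
      fun h2 => by simp [h2]⟩
  have h2 : h⁻¹ * g = 1 ↔ g * h⁻¹ = 1 := by
    rw [inv_mul_eq_one, mul_inv_eq_one, eq_comm]
  classical exact if_congr (and_congr h1 (not_congr h2)) rfl rfl

lemma coeff_involutionSum_mul [Fintype G] (a : MonoidAlgebra ℚ G) (g : G) :
    (involutionSum G * a).coeff g = ∑ h : G, (involutionSum G).coeff h * a.coeff (h⁻¹ * g) := by
  classical
  rw [involutionSum, finsum_eq_sum_of_fintype, Finset.sum_mul, MonoidAlgebra.coeff_sum,
    Finsupp.finsetSum_apply]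
  have := coeff_involutionSum (G := G)
  rw [involutionSum, finsum_eq_sum_of_fintype] at this
  simp only [this, MonoidAlgebra.coeff_single_mul_apply, one_mul, ite_mul, zero_mul]
  rw [← Finset.sum_filter]
  exact (Finset.sum_subtype (Finset.univ.filter fun g : G => g ^ 2 = 1 ∧ g ≠ 1)
    (fun g => Finset.mem_filter_univ g) fun x => a.coeff (x⁻¹ * g)).symm

end

namespace ExtraspecialByC8

variable {G : Type u} [Group G] {P Z : Subgroup G} {t : G}

lemma involution_not_mem_P (h : ExtraspecialByC8 P Z t) {g : G} (hg : g ^ 2 = 1) (hg1 : g ≠ 1) :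
    g ∉ P := by
  intro hgP
  have h5 := h.pow_five g hgP
  rw [show 5 = 2 * 2 + 1 from rfl, pow_succ, pow_mul, hg, one_pow, one_mul] at h5
  exact hg1 h5

lemma eq_one_of_sq_eq_one (h : ExtraspecialByC8 P Z t) {g : G} (hgP : g ∈ P) (hg : g ^ 2 = 1) :
    g = 1 := by
  by_contra hg1
  exact h.involution_not_mem_P hg hg1 hgP

lemma t_ne_one (h : ExtraspecialByC8 P Z t) : t ≠ 1 := fun ht => h.t_not_mem (ht ▸ P.one_mem)

/-- `1 - Ẑ`. -/
noncomputable def faithfulPart (Z : Subgroup G) : MonoidAlgebra ℚ G := 1 - hat Z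

lemma coeff_mul_faithfulPart (h : ExtraspecialByC8 P Z t) [Fintype Z] (a : MonoidAlgebra ℚ G)
    (g : G) : (a * faithfulPart Z).coeff g = a.coeff g - 5⁻¹ * ∑ z : Z, a.coeff (g * z) := by
  rw [faithfulPart, mul_sub, mul_one, MonoidAlgebra.coeff_sub, Finsupp.sub_apply, coeff_mul_hat,
    h.card_Z]
  rfl

variable [Finite G]

/-- A central element of the group algebra annihilated by `Ẑ` is determined by its coefficients at
`1` and `t`. -/
lemma eq_zero_of_coeff_eq_zero (h : ExtraspecialByC8 P Z t) {a : MonoidAlgebra ℚ G}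
    (ha : ∀ g, Commute (MonoidAlgebra.single g (1 : ℚ)) a) (hZ : a * hat Z = 0)
    (h1 : a.coeff 1 = 0) (ht : a.coeff t = 0) : a = 0 := by
  have := Fintype.ofFinite Z
  have hcard : (Finset.univ : Finset Z).card = 5 := by
    rw [Finset.card_univ, ← Nat.card_eq_fintype_card, h.card_Z]
  have hconj : ∀ g x, a.coeff (x * g * x⁻¹) = a.coeff g := fun g x => coeff_conj_of_commute (ha x) g
  have hsum : ∀ g, ∑ z : Z, a.coeff (g * z) = 0 := by
    intro g
    have h2 := coeff_mul_hat a Z g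
    rw [hZ, h.card_Z] at h2
    simpa using h2.symm
  -- Here the coefficient is constant on the coset gZ, over which the coefficients sum to zero.
  have hall : ∀ g, (∀ z ∈ Z, ∃ x, x * g * x⁻¹ = g * z) → a.coeff g = 0 := by
    intro g hg
    have h2 := hsum g
    rw [Finset.sum_congr rfl (g := fun _ => a.coeff g), Finset.sum_const, hcard] at h2
    · simpa using h2
    · intro z _
      obtain ⟨x, hx⟩ := hg z z.2
      rw [← hx, hconj]
  -- For u = 1 and u = t the other four elements of uZ are conjugate, so their equal coefficients
  -- are determined by the one at u.
  have hcos : ∀ u, a.coeff u = 0 → (∀ z ∈ Z, z ≠ 1 → ∀ z' ∈ Z, z' ≠ 1 →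
      ∃ g, g * (u * z) * g⁻¹ = u * z') → ∀ z ∈ Z, a.coeff (u * z) = 0 := by
    intro u hu htr z hz
    classical
    by_cases hz1 : z = 1
    · rw [hz1, mul_one, hu]
    have h2 := hsum u
    rw [← Finset.add_sum_erase _ _ (Finset.mem_univ (1 : Z)),
      Finset.sum_congr rfl (g := fun _ => a.coeff (u * z)), Finset.sum_const,
      Finset.card_erase_of_mem (Finset.mem_univ _), hcard, OneMemClass.coe_one, mul_one, hu,
      zero_add] at h2
    · simpa using h2
    · intro z' hz'
      obtain ⟨g, hg⟩ := htr z hz hz1 z' z'.2 fun h3 => (Finset.mem_erase.1 hz').1 (Subtype.ext h3)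
      rw [← hg, hconj]
  ext g
  change a.coeff g = 0
  by_cases hgZ : g ∈ Z
  · have := hcos 1 h1 (fun z hz hz1 z' hz' hz1' => ?_) g hgZ
    · rwa [one_mul] at this
    · obtain ⟨x, -, hx⟩ := h.trans z hz hz1 z' hz' hz1'
      exact ⟨x, by rw [one_mul, one_mul, hx]⟩
  by_cases hgP : g ∈ P
  · refine hall g fun z hz => ?_
    obtain ⟨b, -, hb⟩ := h.conj_P g hgP hgZ z hz
    exact ⟨b, hb⟩
  by_cases htg : t⁻¹ * g ∈ P
  · obtain ⟨x, z, hz, hx⟩ := h.conj_t g htg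
    rw [← hconj g x, hx]
    refine hcos t ht (fun z hz hz1 z' hz' hz1' => ?_) z hz
    obtain ⟨x, hxt, hx⟩ := h.trans z hz hz1 z' hz' hz1'
    refine ⟨x, ?_⟩
    rw [← hx, ← mul_assoc x t z, hxt]
    simp only [mul_assoc]
  · exact hall g (h.conj_out g hgP htg)

lemma faithfulPart_mul_self : faithfulPart Z * faithfulPart Z = faithfulPart Z := by
  rw [faithfulPart, mul_sub, mul_one, sub_mul, one_mul, hat_mul_hat le_rfl, sub_self, sub_zero]

lemma faithfulPart_mul_hat : faithfulPart Z * hat Z = 0 := by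
  rw [faithfulPart, sub_mul, one_mul, hat_mul_hat le_rfl, sub_self]

lemma commute_faithfulPart (h : ExtraspecialByC8 P Z t) (a : MonoidAlgebra ℚ G) :
    Commute a (faithfulPart Z) :=
  have := h.normal_Z
  (Commute.one_right a).sub_right (commute_of_forall_single (commute_single_hat_of_normal Z) a)

lemma commute_involutionSum (a : MonoidAlgebra ℚ G) : Commute a (involutionSum G) :=
  commute_of_forall_single commute_single_involutionSum a

lemma coeff_one_faithfulPart (h : ExtraspecialByC8 P Z t) : (faithfulPart Z).coeff 1 = 4 / 5 := by
  rw [faithfulPart, MonoidAlgebra.coeff_sub, Finsupp.sub_apply, coeff_one_hat, h.card_Z,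
    MonoidAlgebra.one_def, MonoidAlgebra.coeff_single, Finsupp.single_eq_same]
  norm_num

lemma coeff_t_faithfulPart (h : ExtraspecialByC8 P Z t) : (faithfulPart Z).coeff t = 0 := by
  classical
  rw [faithfulPart, MonoidAlgebra.coeff_sub, Finsupp.sub_apply, coeff_hat,
    if_neg fun ht => h.t_not_mem (h.Z_le ht), MonoidAlgebra.one_def, MonoidAlgebra.coeff_single,
    Finsupp.single_apply, if_neg h.t_ne_one.symm, sub_zero]

/-- The part of the sum of the involutions on which `Ẑ` vanishes. -/
noncomputable def faithfulInvolutionSum (Z : Subgroup G) : MonoidAlgebra ℚ G :=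
  involutionSum G * faithfulPart Z

lemma coeff_one_faithfulInvolutionSum (h : ExtraspecialByC8 P Z t) :
    (faithfulInvolutionSum Z).coeff 1 = 0 := by
  classical
  have := Fintype.ofFinite Z
  rw [faithfulInvolutionSum, h.coeff_mul_faithfulPart, Finset.sum_eq_zero, mul_zero, sub_zero,
    coeff_involutionSum, if_neg (by simp)]
  intro z _
  rw [one_mul, coeff_involutionSum, if_neg]
  rintro ⟨h1, h2⟩
  exact h2 (h.eq_one_of_sq_eq_one (h.Z_le z.2) h1)

lemma coeff_t_faithfulInvolutionSum (h : ExtraspecialByC8 P Z t) :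
    (faithfulInvolutionSum Z).coeff t = 4 / 5 := by
  classical
  have := Fintype.ofFinite Z
  rw [faithfulInvolutionSum, h.coeff_mul_faithfulPart, Finset.sum_eq_single (1 : Z),
    OneMemClass.coe_one, mul_one, coeff_involutionSum, if_pos ⟨h.t_sq, h.t_ne_one⟩]
  · norm_num
  · intro z _ hz
    rw [coeff_involutionSum, if_neg]
    rintro ⟨h1, -⟩
    have hc : Commute t (z : G) := h.invol_central t h.t_sq z z.2
    rw [hc.mul_pow, h.t_sq, one_mul] at h1
    exact hz (Subtype.ext (h.eq_one_of_sq_eq_one (h.Z_le z.2) h1))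
  · simp

lemma coeff_involutionSum_sq_of_not_mem (h : ExtraspecialByC8 P Z t) {g : G} (hg : g ∉ P) :
    (involutionSum G * involutionSum G).coeff g = 0 := by
  classical
  have := Fintype.ofFinite G
  rw [coeff_involutionSum_mul, Finset.sum_eq_zero]
  intro x _
  rw [coeff_involutionSum, coeff_involutionSum]
  split_ifs with h1 h2
  · have h3 := h.invol_mul x (x⁻¹ * g) h1.1 h1.2 h2.1 h2.2
    rw [mul_inv_cancel_left] at h3
    exact absurd h3 hg
  all_goals simp

lemma coeff_involutionSum_sq_of_mem (h : ExtraspecialByC8 P Z t) {z : G} (hz : z ∈ Z)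
    (hz1 : z ≠ 1) : (involutionSum G * involutionSum G).coeff z = 0 := by
  classical
  have := Fintype.ofFinite G
  rw [coeff_involutionSum_mul, Finset.sum_eq_zero]
  intro x _
  rw [coeff_involutionSum, coeff_involutionSum]
  split_ifs with h1 h2
  · have hc : Commute x⁻¹ z := (show Commute x z from h.invol_central x h1.1 z hz).inv_left
    have h3 := h2.1
    rw [hc.mul_pow, inv_pow, h1.1, inv_one, one_mul] at h3
    exact absurd (h.eq_one_of_sq_eq_one (h.Z_le hz) h3) hz1
  all_goals simp

lemma coeff_one_involutionSum_sq (h : ExtraspecialByC8 P Z t) :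
    (involutionSum G * involutionSum G).coeff 1 = 25 := by
  classical
  have := Fintype.ofFinite G
  have h25 := h.card_invol
  rw [Nat.card_eq_fintype_card, Fintype.card_subtype] at h25
  rw [coeff_involutionSum_mul, ← show ((25 : ℕ) : ℚ) = 25 by norm_num, ← h25,
    Finset.card_filter, Nat.cast_sum]
  refine Finset.sum_congr rfl fun x _ => ?_
  rw [coeff_involutionSum, coeff_involutionSum, mul_one, inv_pow]
  by_cases hx : x ^ 2 = 1 ∧ x ≠ 1
  · rw [if_pos hx, if_pos hx, if_pos ⟨by rw [hx.1, inv_one], inv_ne_one.2 hx.2⟩]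
    norm_num
  · rw [if_neg hx, if_neg hx]
    norm_num

/-- The central elements of the group algebra annihilated by `Ẑ`. -/
lemma eq_smul_add_smul (h : ExtraspecialByC8 P Z t) {a : MonoidAlgebra ℚ G}
    (ha : ∀ g, Commute (MonoidAlgebra.single g (1 : ℚ)) a) (hZ : a * hat Z = 0) :
    a = (5 / 4 * a.coeff 1) • faithfulPart Z + (5 / 4 * a.coeff t) • faithfulInvolutionSum Z := by
  rw [← sub_eq_zero]
  refine h.eq_zero_of_coeff_eq_zero (fun g => ?_) ?_ ?_ ?_
  · exact (ha g).sub_right (((h.commute_faithfulPart _).smul_right _).add_right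
      (((commute_involutionSum _).mul_right (h.commute_faithfulPart _)).smul_right _))
  · rw [sub_mul, add_mul, hZ, smul_mul_assoc, smul_mul_assoc, faithfulInvolutionSum, mul_assoc,
      faithfulPart_mul_hat]
    simp
  · simp only [MonoidAlgebra.coeff_sub, MonoidAlgebra.coeff_add, Finsupp.sub_apply,
      Finsupp.add_apply, MonoidAlgebra.coeff_smul_apply, smul_eq_mul, h.coeff_one_faithfulPart,
      h.coeff_one_faithfulInvolutionSum]
    ring
  · simp only [MonoidAlgebra.coeff_sub, MonoidAlgebra.coeff_add, Finsupp.sub_apply,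
      Finsupp.add_apply, MonoidAlgebra.coeff_smul_apply, smul_eq_mul, h.coeff_t_faithfulPart,
      h.coeff_t_faithfulInvolutionSum]
    ring

/-- By `eq_smul_add_smul` only the coefficients at 1 and t matter. The square of the sum of
involutions has coefficient 25 at 1, and 0 at the other elements of Z and on tZ; cutting by 1 - Ẑ
leaves 25 · 4/5 at 1 and 0 at t. -/
lemma faithfulInvolutionSum_mul_self (h : ExtraspecialByC8 P Z t) :
    faithfulInvolutionSum Z * faithfulInvolutionSum Z = (25 : ℚ) • faithfulPart Z := by
  have := Fintype.ofFinite Z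
  have h1 : faithfulInvolutionSum Z * faithfulInvolutionSum Z =
      (involutionSum G * involutionSum G) * faithfulPart Z := by
    rw [faithfulInvolutionSum, (h.commute_faithfulPart _).symm.mul_mul_mul_comm,
      faithfulPart_mul_self]
  rw [h1, h.eq_smul_add_smul (a := involutionSum G * involutionSum G * faithfulPart Z)
    (fun g => ((commute_involutionSum _).mul_right (commute_involutionSum _)).mul_right
      (h.commute_faithfulPart _)) (by rw [mul_assoc, faithfulPart_mul_hat, mul_zero]),
    h.coeff_mul_faithfulPart, h.coeff_mul_faithfulPart, h.coeff_one_involutionSum_sq,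
    h.coeff_involutionSum_sq_of_not_mem h.t_not_mem, Finset.sum_eq_single (1 : Z),
    Finset.sum_eq_zero, OneMemClass.coe_one, mul_one, h.coeff_one_involutionSum_sq]
  · norm_num
  · intro z _
    refine h.coeff_involutionSum_sq_of_not_mem fun hz => h.t_not_mem ?_
    exact (P.mul_mem_cancel_right (h.Z_le z.2)).1 hz
  · intro z _ hz
    rw [one_mul]
    exact h.coeff_involutionSum_sq_of_mem z.2 fun h2 => hz (Subtype.ext h2)
  · simp

/-- One of the two primitive central idempotents of `ℚG` that are annihilated by `Ẑ`. -/
noncomputable def faithfulIdempotent (Z : Subgroup G) : MonoidAlgebra ℚ G :=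
  (1 / 2 : ℚ) • faithfulPart Z + (1 / 10 : ℚ) • faithfulInvolutionSum Z

lemma faithfulPart_mul_faithfulInvolutionSum (h : ExtraspecialByC8 P Z t) :
    faithfulPart Z * faithfulInvolutionSum Z = faithfulInvolutionSum Z := by
  rw [(h.commute_faithfulPart _).symm.eq, faithfulInvolutionSum, mul_assoc, faithfulPart_mul_self]

lemma faithfulPart_mul_faithfulIdempotent (h : ExtraspecialByC8 P Z t) :
    faithfulPart Z * faithfulIdempotent Z = faithfulIdempotent Z := by
  rw [faithfulIdempotent, mul_add, mul_smul_comm, mul_smul_comm, faithfulPart_mul_self,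
    h.faithfulPart_mul_faithfulInvolutionSum]

lemma faithfulInvolutionSum_mul_faithfulIdempotent (h : ExtraspecialByC8 P Z t) :
    faithfulInvolutionSum Z * faithfulIdempotent Z = (5 : ℚ) • faithfulIdempotent Z := by
  rw [faithfulIdempotent, mul_add, mul_smul_comm, mul_smul_comm, h.faithfulInvolutionSum_mul_self,
    (h.commute_faithfulPart _).eq, h.faithfulPart_mul_faithfulInvolutionSum, smul_add, smul_smul,
    smul_smul, smul_smul, add_comm]
  norm_num

lemma isIdempotentElem_faithfulIdempotent (h : ExtraspecialByC8 P Z t) :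
    IsIdempotentElem (faithfulIdempotent Z) := by
  rw [IsIdempotentElem]
  conv_lhs => enter [1]; rw [faithfulIdempotent]
  rw [add_mul, smul_mul_assoc, smul_mul_assoc, h.faithfulPart_mul_faithfulIdempotent,
    h.faithfulInvolutionSum_mul_faithfulIdempotent, smul_smul, ← add_smul]
  norm_num

lemma coeff_one_faithfulIdempotent (h : ExtraspecialByC8 P Z t) :
    (faithfulIdempotent Z).coeff 1 = 2 / 5 := by
  simp only [faithfulIdempotent, MonoidAlgebra.coeff_add, Finsupp.add_apply,
    MonoidAlgebra.coeff_smul_apply, smul_eq_mul, h.coeff_one_faithfulPart,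
    h.coeff_one_faithfulInvolutionSum]
  norm_num

lemma faithfulIdempotent_ne_zero (h : ExtraspecialByC8 P Z t) : faithfulIdempotent Z ≠ 0 := by
  intro h0
  have := h.coeff_one_faithfulIdempotent
  rw [h0] at this
  norm_num at this

lemma faithfulIdempotent_mul_hat : faithfulIdempotent Z * hat Z = 0 := by
  rw [faithfulIdempotent, faithfulInvolutionSum, add_mul, smul_mul_assoc, smul_mul_assoc,
    mul_assoc, faithfulPart_mul_hat]
  simp

/-- Every central element below e is a combination of 1 - Ẑ and the cut involution sum, which act on
e as 1 and 5. It is therefore a rational multiple of e, and an idempotent one is 0 or e. -/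
theorem isPrimitiveCentralIdempotent (h : ExtraspecialByC8 P Z t) :
    IsPrimitiveCentralIdempotent (faithfulIdempotent Z) := by
  refine ⟨?_, h.isIdempotentElem_faithfulIdempotent, h.faithfulIdempotent_ne_zero, ?_⟩
  · rw [Subring.mem_center_iff]
    intro a
    exact ((h.commute_faithfulPart a).smul_right _).add_right
      (((commute_involutionSum a).mul_right (h.commute_faithfulPart a)).smul_right _)
  · intro a b ha hb hai hbi hab hsum
    rw [Subring.mem_center_iff] at ha hb
    have hae : a * faithfulIdempotent Z = a := by
      rw [← hsum, mul_add, hai, hab, add_zero]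
    have haZ : a * hat Z = 0 := by
      rw [← hae, mul_assoc, faithfulIdempotent_mul_hat, mul_zero]
    have hlin := h.eq_smul_add_smul (fun g => ha _) haZ
    obtain ⟨c, hc⟩ : ∃ c : ℚ, a = c • faithfulIdempotent Z := by
      refine ⟨5 / 4 * a.coeff 1 + 5 / 4 * a.coeff t * 5, ?_⟩
      conv_lhs => rw [← hae, hlin]
      rw [add_mul, smul_mul_assoc, smul_mul_assoc, h.faithfulPart_mul_faithfulIdempotent,
        h.faithfulInvolutionSum_mul_faithfulIdempotent, smul_smul, ← add_smul]
    have hcc : (c * c - c) • faithfulIdempotent Z = 0 := by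
      have h2 := hai
      rw [hc, IsIdempotentElem, smul_mul_smul_comm, h.isIdempotentElem_faithfulIdempotent] at h2
      rw [sub_smul, h2, sub_self]
    have hc0 := (smul_eq_zero.1 hcc).resolve_right h.faithfulIdempotent_ne_zero
    have hc1 : c * (c - 1) = 0 := by linarith
    rcases mul_eq_zero.1 hc1 with h3 | h3
    · left
      rw [hc, h3, zero_smul]
    · right
      have h4 : c = 1 := by linarith
      rw [h4, one_smul] at hc
      rw [hc] at hsum
      exact add_eq_left.1 hsum

end ExtraspecialByC8

end MonomialClasses

namespace MonomialClasses

/-! ### The group of order `1000` is not strongly monomial -/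

open Subgroup

lemma IsStrongShodaPair.commutator_mem {G : Type u} [Group G] [Finite G] {H K : Subgroup G}
    (h : IsStrongShodaPair H K) {x y : G} (hx : x ∈ H) (hy : y ∈ H) :
    x * y * x⁻¹ * y⁻¹ ∈ K := by
  obtain ⟨Q, _, _, f, hf⟩ := h.exists_hom
  have h1 := map_eq_one_iff_of_ker_eq hf
    (⟨x, hx⟩ * ⟨y, hy⟩ * (⟨x, hx⟩ : H)⁻¹ * (⟨y, hy⟩ : H)⁻¹)
  refine h1.1 ?_
  simp only [map_mul, map_inv]
  rw [(IsCyclic.isMulCommutative (α := Q)).is_comm.comm (f ⟨x, hx⟩) (f ⟨y, hy⟩),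
    mul_inv_cancel_right, mul_inv_cancel]

namespace ExtraspecialByC8

variable {G : Type u} [Group G] {P Z : Subgroup G} {t : G}

lemma le_or_inf_eq_bot (h : ExtraspecialByC8 P Z t) (S : Subgroup G) :
    Z ≤ S ∨ ∀ z ∈ Z, z ∈ S → z = 1 := by
  have : Fact (Nat.card Z).Prime := ⟨by rw [h.card_Z]; norm_num⟩
  rcases eq_bot_or_eq_top_of_prime_card (S.subgroupOf Z) with h1 | h1
  · right
    intro z hz hzS
    have : (⟨z, hz⟩ : Z) ∈ S.subgroupOf Z := hzS
    rw [h1] at this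
    exact congrArg Subtype.val (mem_bot.1 this)
  · left
    exact subgroupOf_eq_top.1 h1

lemma exists_not_commute (h : ExtraspecialByC8 P Z t) {y : G} (hy : y ∈ P) (hyZ : y ∉ Z) :
    ∃ b ∈ P, b * y ≠ y * b := by
  obtain ⟨z, hz, hz1⟩ := h.exists_ne_one_mem_Z
  obtain ⟨b, hb, hby⟩ := h.conj_P y hy hyZ z hz
  refine ⟨b, hb, fun hc => hz1 ?_⟩
  rwa [hc, mul_inv_cancel_right, eq_comm, mul_eq_left] at hby

/-- Commutators of H with Z lie in Z ∩ K = 1, so H lies in the centralizer of Z, of order 250. -/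
lemma card_dvd_of_commutator_mem (h : ExtraspecialByC8 P Z t) {K H : Subgroup G}
    (hKZ : ∀ z ∈ Z, z ∈ K → z = 1) (hc : ∀ x ∈ H, ∀ z ∈ Z, x * z * x⁻¹ * z⁻¹ ∈ K) :
    Nat.card H ∣ 250 := by
  rw [← h.card_centralizer]
  refine card_dvd_of_le fun x hx => ?_
  rw [mem_centralizer_iff]
  intro z hz
  have h1 := hKZ _ (Z.mul_mem (h.normal_Z.conj_mem z hz x) (Z.inv_mem hz)) (hc x hx z hz)
  rw [mul_inv_eq_one, mul_inv_eq_iff_eq_mul] at h1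
  exact h1.symm

variable [Finite G]

/-- An abelian normal subgroup contains no involution. -/
lemma not_sq_eq_one_of_normal (h : ExtraspecialByC8 P Z t) {H : Subgroup G} (hH : H.Normal)
    (hc : ∀ x ∈ H, ∀ y ∈ H, x * y = y * x) {s : G} (hs : s ∈ H) (hs2 : s ^ 2 = 1) : s = 1 := by
  by_contra hs1
  have hsP := h.involution_not_mem_P hs2 hs1
  obtain ⟨a, ha, haZ⟩ := h.exists_not_mem_Z
  -- The commutator z of s and a lies in P and in the abelian H, so it commutes with s and hence is
  -- in Z. Conjugating twice by s gives z² = 1, so z = 1 and s fixes a, which is impossible.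
  have hz := h.quot_comm s a
  set z := s * a * s⁻¹ * a⁻¹ with hzdef
  have hzH : z ∈ H := by
    rw [hzdef, mul_assoc, mul_assoc, ← mul_assoc a]
    exact H.mul_mem hs (hH.conj_mem _ (H.inv_mem hs) a)
  have hzZ : z ∈ Z := h.fixed_free s hsP z hz (hc s hs z hzH)
  have hsz := h.invol_central s hs2 z hzZ
  have hsa : s * a * s⁻¹ = z * a := by rw [hzdef, inv_mul_cancel_right]
  clear_value z
  have hss : s * s = 1 := by rw [← pow_two, hs2]
  have h1 : a = z ^ 2 * a := by
    calc a = s * (s * a * s⁻¹) * s⁻¹ := by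
          rw [← mul_assoc, ← mul_assoc, hss, one_mul, mul_assoc, ← mul_inv_rev, hss, inv_one,
            mul_one]
      _ = z * (s * a * s⁻¹) := by
          rw [hsa, ← mul_assoc s, hsz, mul_assoc z s, mul_assoc z, hsa]
      _ = z ^ 2 * a := by rw [hsa, pow_two, mul_assoc]
  have hz1 : z = 1 := h.eq_one_of_sq_eq_one hz (right_eq_mul.1 h1)
  rw [hz1, one_mul, mul_inv_eq_iff_eq_mul] at hsa
  exact haZ (h.fixed_free s hsP a ha hsa)

/-- The possible orders of the normalizer of a subgroup that meets `Z` trivially but not `P`. -/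
lemma card_normalizer (h : ExtraspecialByC8 P Z t) {K : Subgroup G}
    (hKZ : ∀ z ∈ Z, z ∈ K → z = 1) {y : G} (hyK : y ∈ K) (hyP : y ∈ P) (hy1 : y ≠ 1) :
    Nat.card (P ⊓ K : Subgroup G) = 5 ∧
      (∃ c d, (c = 1 ∨ c = 5 ∨ c = 25) ∧ d ∣ 4 ∧ (c = 25 → Z ≤ normalizer (K : Set G)) ∧
        Nat.card (normalizer (K : Set G)) = c * d) := by
  have hZn := h.normal_Z
  have hPn := h.normal_P
  have hyZ : y ∉ Z := fun hz => hy1 (hKZ y hz hyK)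
  set N := normalizer (K : Set G) with hN
  have hNK : ∀ n ∈ N, ∀ k ∈ K, n * k * n⁻¹ ∈ K := fun n hn k hk =>
    (mem_normalizer_iff.1 hn k).1 hk
  have hKN : K ≤ N := le_normalizer
  -- The commutator of a and y lies in Z ∩ K = 1; so P ∩ N lies in ⟨y⟩Z.
  have hcomm : ∀ a ∈ P, a ∈ N → y * a = a * y := by
    intro a ha haN
    have h1 := hKZ _ (h.comm_P a ha y hyP) (K.mul_mem (hNK a haN y hyK) (K.inv_mem hyK))
    rw [mul_inv_eq_one, mul_inv_eq_iff_eq_mul] at h1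
    exact h1.symm
  have hform : ∀ a ∈ P, a ∈ N → ∃ n : ℕ, ∃ z ∈ Z, a = y ^ n * z := fun a ha haN =>
    h.centralizer_in_P y hyP hyZ a ha (hcomm a ha haN)
  have hfive : Nat.card (zpowers y) = 5 := by
    rw [Nat.card_zpowers]
    exact orderOf_eq_prime (h.pow_five y hyP) hy1
  have hPK : P ⊓ K = zpowers y := by
    refine le_antisymm (fun a ha => ?_) ((zpowers_le).2 ⟨hyP, hyK⟩)
    obtain ⟨n, z, hz, rfl⟩ := hform a ha.1 (hKN ha.2)
    have hzK : z ∈ K := by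
      have := K.mul_mem (K.inv_mem (K.pow_mem hyK n)) ha.2
      rwa [inv_mul_cancel_left] at this
    rw [hKZ z hz hzK, mul_one]
    exact ⟨n, zpow_natCast y n⟩
  refine ⟨by rw [hPK, hfive], ?_⟩
  have hPN : ¬ P ≤ N := by
    intro hle
    obtain ⟨b, hb, hby⟩ := h.exists_not_commute hyP hyZ
    exact hby (hcomm b hb (hle hb)).symm
  obtain ⟨d, hd8, hd, hcard⟩ := h.card_eq N
  refine ⟨Nat.card (P ⊓ N : Subgroup G), d, ?_, ?_, ?_, hcard⟩
  · have h1 : Nat.card (P ⊓ N : Subgroup G) ∣ 5 ^ 3 := by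
      rw [show 5 ^ 3 = 125 from rfl, ← h.card_P]
      exact card_dvd_of_le inf_le_left
    obtain ⟨i, hi, hc⟩ := (Nat.dvd_prime_pow (by norm_num)).1 h1
    have h3 : i ≠ 3 := by
      rintro rfl
      have h2 : P ⊓ N = P := eq_of_le_of_card_ge inf_le_left (by rw [h.card_P, hc]; norm_num)
      exact hPN (inf_eq_left.1 h2)
    interval_cases i
    · left; exact hc
    · right; left; exact hc
    · right; right; exact hc
    · exact absurd rfl h3
  · have h8 : d ≠ 8 := by
      intro h8
      have hsup : N ⊔ P = ⊤ := by
        rw [← index_eq_one]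
        have h1 := relIndex_mul_index (H := P) (K := N ⊔ P) le_sup_right
        rw [relIndex_sup_right, ← hd, h8, h.index_P] at h1
        omega
      have hW : ((P ⊓ K) ⊔ Z).Normal := by
        refine ⟨fun w hw g => ?_⟩
        have hg : g ∈ N ⊔ P := hsup ▸ mem_top g
        obtain ⟨n, hn, p, hp, rfl⟩ := (mem_sup_of_normal_right).1 hg
        obtain ⟨k, hk, z, hz, rfl⟩ := (mem_sup_of_normal_right).1 hw
        have h1 : n * p * (k * z) * (n * p)⁻¹ =
            n * k * n⁻¹ * (n * (k⁻¹ * (p * k * p⁻¹ * k⁻¹) * k) * n⁻¹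
              * ((n * p) * z * (n * p)⁻¹)) := by group
        rw [h1]
        refine mul_mem (mem_sup_left ⟨hPn.conj_mem k hk.1 n, hNK n hn k hk.2⟩)
          (mem_sup_right (Z.mul_mem (hZn.conj_mem _ ?_ n) (hZn.conj_mem z hz _)))
        have := hZn.conj_mem _ (h.comm_P p hp k hk.1) k⁻¹
        rwa [inv_inv] at this
      have hWP := h.irred _ hW (sup_le inf_le_left h.Z_le)
        (fun hle => hyZ (hle (mem_sup_left ⟨hyP, hyK⟩)))
      obtain ⟨b, hb, hby⟩ := h.exists_not_commute hyP hyZ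
      rw [← hWP] at hb
      obtain ⟨k, hk, z, hz, rfl⟩ := (mem_sup_of_normal_right).1 hb
      refine hby ?_
      have c1 : Commute k y := (hcomm k hk.1 (hKN hk.2)).symm
      have c2 : Commute z y := (h.central y hyP z hz).symm
      exact c1.mul_left c2
    obtain ⟨i, hi, rfl⟩ := (Nat.dvd_prime_pow Nat.prime_two).1 (show d ∣ 2 ^ 3 from hd8)
    interval_cases i <;> first | exact absurd rfl h8 | norm_num
  · intro hc
    refine (h.le_or_inf_eq_bot N).resolve_right fun hNZ => ?_
    have hle : P ⊓ N ≤ zpowers y := by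
      intro a ha
      obtain ⟨n, z, hz, rfl⟩ := hform a ha.1 ha.2
      have hzN : z ∈ N := by
        have := N.mul_mem (N.inv_mem (N.pow_mem (hKN hyK) n)) ha.2
        rwa [inv_mul_cancel_left] at this
      rw [hNZ z hz hzN, mul_one]
      exact ⟨n, zpow_natCast y n⟩
    have := card_le_of_le hle
    rw [hc, hfive] at this
    omega

/-- Let m be the number of conjugates of ε(H, K) and k = |K|. The coefficient 2/5 of e ties m to k,
with m ≤ k throughout, while m |N_G(K)| ≥ 1000. Since K meets Z trivially, K and its normalizer are
too small, except for a last case in which H would both have order divisible by 100 and centralize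
Z. -/
theorem not_stronglyMonomial (h : ExtraspecialByC8 P Z t) : ¬ StronglyMonomial G := by
  intro hst
  have hPn := h.normal_P
  obtain ⟨H, K, α, hs, hα⟩ := hst _ h.isPrimitiveCentralIdempotent
  have hprime : ∀ p, p.Prime → p ∣ Nat.card G → p = 2 ∨ p = 5 := by
    intro p hp hpG
    rw [h.card_G, show 1000 = 2 ^ 3 * 5 ^ 3 by norm_num, hp.dvd_mul] at hpG
    exact hpG.imp (fun h1 => (Nat.prime_dvd_prime_iff_eq hp Nat.prime_two).1 (hp.dvd_of_dvd_pow h1))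
      fun h1 => (Nat.prime_dvd_prime_iff_eq hp (by norm_num)).1 (hp.dvd_of_dvd_pow h1)
  obtain ⟨hi, hKr, hstab, hco⟩ := hs.epsilon_spec hprime
  obtain ⟨hmul, hone⟩ := hs.eq_eSum hi h.isIdempotentElem_faithfulIdempotent
    h.faithfulIdempotent_ne_zero hα
  have hN := card_le_card_conjugates_mul hstab
  rw [h.coeff_one_faithfulIdempotent] at hone
  rw [h.card_G] at hN
  -- If Z ≤ K then Ẑ fixes ε(H, K); but ε(H, K) lies below e, which Ẑ annihilates.
  have hKZ : ∀ z ∈ Z, z ∈ K → z = 1 := by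
    refine (h.le_or_inf_eq_bot K).resolve_left fun hle => ?_
    have h0 : epsilon H K * hat Z = 0 := by
      rw [← hmul, mul_assoc, faithfulIdempotent_mul_hat, mul_zero]
    rw [← hKr, mul_assoc, hat_mul_hat' hle, hKr] at h0
    rw [h0] at hone
    norm_num at hone
  set m := Nat.card (conjugates (epsilon H K)) with hm
  set k := Nat.card K with hk
  set N := normalizer (K : Set G) with hNdef
  have hNK : ∀ n ∈ N, ∀ k ∈ K, n * k * n⁻¹ ∈ K := fun n hn k hk =>
    (mem_normalizer_iff.1 hn k).1 hk
  have hKN : K ≤ N := le_normalizer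
  have hmk : 5 * m = 2 * k ∨ 5 * m = 4 * k ∨ 2 * m = k ∨ m = k ∧ 10 ∣ K.relIndex H := by
    have h2 : (m : ℚ) * ((epsilon H K).coeff 1 * k) = 2 / 5 * k := by rw [← mul_assoc, ← hone]
    rcases hco with h1 | h1 | h1 | ⟨h1, h10⟩ <;> rw [h1] at h2
    · left
      have : (5 * m : ℚ) = 2 * k := by linarith
      exact_mod_cast this
    · right; left
      have : (5 * m : ℚ) = 4 * k := by linarith
      exact_mod_cast this
    · right; right; left
      have : (2 * m : ℚ) = k := by linarith
      exact_mod_cast this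
    · right; right; right
      have : (m : ℚ) = k := by linarith
      exact ⟨by exact_mod_cast this, h10⟩
  -- For k = 1 integrality leaves only m = 1 with 10 dividing |H|. Then H is abelian and normal in G
  -- and contains an involution.
  by_cases hK1 : K = ⊥
  · have hk1 : k = 1 := by rw [hk, hK1, card_bot]
    have h10 : 10 ∣ K.relIndex H := by
      rcases hmk with h1 | h1 | h1 | h1
      · omega
      · omega
      · omega
      · exact h1.2
    rw [hK1, relIndex_bot_left] at h10
    have hNtop : N = ⊤ := by
      rw [eq_top_iff]
      intro g _
      rw [hNdef, hK1, mem_normalizer_iff]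
      intro x
      simp only [mem_bot, conj_eq_one_iff]
    have hHn : H.Normal := by
      have h1 := hs.normal_normalizer
      rw [← hNdef, hNtop] at h1
      exact ⟨fun x hx g => h1.conj_mem ⟨x, mem_top x⟩ hx ⟨g, mem_top g⟩⟩
    have : Fact (Nat.Prime 2) := ⟨Nat.prime_two⟩
    obtain ⟨s, hs2⟩ := exists_prime_orderOf_dvd_card' (G := H) 2 (dvd_trans (by norm_num) h10)
    have hs1 : (s : G) = 1 := by
      refine h.not_sq_eq_one_of_normal hHn (fun x hx y hy => ?_) s.2 ?_
      · have h1 := hs.commutator_mem hx hy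
        rw [hK1, mem_bot, mul_inv_eq_one, mul_inv_eq_iff_eq_mul] at h1
        exact h1
      · have h1 := pow_orderOf_eq_one s
        rw [hs2] at h1
        exact congrArg Subtype.val h1
    rw [show s = 1 from Subtype.ext hs1, orderOf_one] at hs2
    omega
  -- Here k ≤ 8, and P ∩ N centralizes an element of K outside P, so it lies in Z and |N| ≤ 40. Thus
  -- m |N| ≤ 320.
  by_cases hKP : ∀ y ∈ K, y ∈ P → y = 1
  · obtain ⟨x, hx, hx1⟩ := (K.ne_bot_iff_exists_ne_one).1 hK1 |>.elim fun a ha =>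
      (⟨a, a.2, fun h1 => ha (Subtype.ext h1)⟩ : ∃ x ∈ K, x ≠ 1)
    have hk8 : k ≤ 8 := by
      obtain ⟨d, hd8, -, hcard⟩ := h.card_eq K
      rw [(eq_bot_iff_forall (P ⊓ K)).2 fun y hy => hKP y hy.2 hy.1, card_bot, one_mul] at hcard
      rw [hk, hcard]
      exact Nat.le_of_dvd (by norm_num) hd8
    have hn40 : Nat.card N ≤ 40 := by
      obtain ⟨d, hd8, -, hcard⟩ := h.card_eq N
      rw [hcard]
      suffices hle : P ⊓ N ≤ Z by
        have h5 := card_le_of_le hle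
        rw [h.card_Z] at h5
        exact Nat.mul_le_mul h5 (Nat.le_of_dvd (by norm_num) hd8)
      rintro a ⟨haP, haN⟩
      refine h.fixed_free x (fun hxP => hx1 (hKP x hx hxP)) a haP ?_
      have h1 := hKP (a * x * a⁻¹ * x⁻¹) (K.mul_mem (hNK a haN x hx) (K.inv_mem hx)) (by
        rw [mul_assoc, mul_assoc, ← mul_assoc x]
        exact P.mul_mem haP (hPn.conj_mem _ (P.inv_mem haP) x))
      rw [mul_inv_eq_one, mul_inv_eq_iff_eq_mul] at h1
      exact h1.symm
    have hm8 : m ≤ 8 := by omega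
    have := Nat.mul_le_mul hm8 hn40
    omega
  push Not at hKP
  obtain ⟨y, hyK, hyP, hy1⟩ := hKP
  obtain ⟨hPK, c, d, hc, hd, hZN, hcard⟩ := h.card_normalizer hKZ hyK hyP hy1
  rw [← hNdef] at hZN hcard
  obtain ⟨d', hd', -, hcardK⟩ := h.card_eq K
  rw [hPK, ← hk] at hcardK
  have hd4 : d ≤ 4 := Nat.le_of_dvd (by norm_num) hd
  have hkn : k ∣ Nat.card N := card_dvd_of_le hKN
  have hd4' : d' ∣ 4 := by
    have h1 : 5 * d' ∣ 25 * 4 := by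
      rw [← hcardK]
      refine hkn.trans (hcard ▸ Nat.mul_dvd_mul ?_ hd)
      rcases hc with rfl | rfl | rfl <;> norm_num
    have h2 : d' ∣ 20 := (Nat.mul_dvd_mul_iff_left (by norm_num : 0 < 5)).1 (by simpa using h1)
    exact (Nat.dvd_gcd hd' h2)
  have hd'le : d' ≤ 4 := Nat.le_of_dvd (by norm_num) hd4'
  have hmle : m ≤ 20 := by omega
  -- With m ≤ 20 and d ≤ 4, the bound m |N| ≥ 1000 excludes c = 1 and c = 5.
  have hc25 : c = 25 := by
    rcases hc with rfl | rfl | rfl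
    · nlinarith
    · nlinarith
    · rfl
  have hZN' := hZN hc25
  have hK250 : k ∣ 250 := by
    refine h.card_dvd_of_commutator_mem hKZ fun x hx z hz => ?_
    rw [mul_assoc, mul_assoc, ← mul_assoc z]
    exact K.mul_mem hx (hNK z (hZN' hz) _ (K.inv_mem hx))
  -- As Z normalizes K, also K centralizes Z, so k = 5d' divides 250 and d' is not 4. Now k ≤ 10,
  -- while |N| ≤ 100 forces m ≥ 10.
  have hd2 : d' ≤ 2 := by
    rw [hcardK] at hK250
    interval_cases d' <;> revert hK250 hd4' <;> decide
  rw [hc25] at hcard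
  have hm10 : 10 ≤ m := by
    by_contra! hlt
    have h1 : Nat.card N ≤ 100 := by omega
    have := Nat.mul_le_mul (Nat.le_of_lt_succ hlt) h1
    omega
  have hm_eq : m = 10 ∧ k = 10 ∧ 10 ∣ K.relIndex H := by
    rcases hmk with h1 | h1 | h1 | h1
    · omega
    · omega
    · omega
    · exact ⟨by omega, by omega, h1.2⟩
  obtain ⟨hm1, hk1, h10⟩ := hm_eq
  rw [hm1] at hN
  have hHcard : 100 ∣ Nat.card H := by
    have h1 := relIndex_mul_relIndex ⊥ K H bot_le hs.le
    rw [relIndex_bot_left, relIndex_bot_left, ← hk, hk1] at h1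
    rw [← h1]
    exact Nat.mul_dvd_mul_left 10 h10
  -- |H| is divisible by 100 and |N| ≤ 100. So H contains Z and, its commutators lying in K,
  -- centralizes it; but 100 does not divide 250.
  have hHN : H = N := eq_of_le_of_card_ge hs.le_normalizer
    (le_trans (by omega) (Nat.le_of_dvd Nat.card_pos hHcard))
  have h250 : Nat.card H ∣ 250 := h.card_dvd_of_commutator_mem hKZ fun x hx z hz =>
    hs.commutator_mem hx (hHN ▸ hZN' hz)
  have := hHcard.trans h250
  omega

end ExtraspecialByC8

end MonomialClasses

namespace MonomialClasses

/-! ### Transfer to the presented group and conclusion -/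

theorem SmallGroup1000.exists_extraspecialByC8 :
    ∃ (P Z : Subgroup SmallGroup1000) (t : SmallGroup1000), ExtraspecialByC8 P Z t :=
  ⟨_, _, _, Model.extraspecialByC8.of_equiv
    (MulEquiv.ofBijective toModel SmallGroup1000.toModel_bijective)⟩

theorem SmallGroup1000.classC : ClassC SmallGroup1000 := by
  obtain ⟨P, Z, t, h⟩ := SmallGroup1000.exists_extraspecialByC8
  exact h.classC

theorem SmallGroup1000.not_stronglyMonomial : ¬ StronglyMonomial SmallGroup1000 := by
  obtain ⟨P, Z, t, h⟩ := SmallGroup1000.exists_extraspecialByC8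
  exact h.not_stronglyMonomial

end MonomialClasses

open MonomialClasses in
theorem proposition2p1 :
    -- (i)
    (Contained AbByNil.{u} AbBySup ∧ Contained AbBySup.{u} ABySup ∧
      Contained ABySup.{u} ClassC) ∧
    -- (ii)
    (Contained (MonomialClasses.Union NormallyMonomial.{u} AbByNil) SubnormallyMonomial ∧
      Contained SubnormallyMonomial.{u} ClassX ∧ Contained ClassX.{u} ClassC) ∧
    -- (iii)
    ¬ Contained ABySup.{0} ClassX ∧
    -- (iv)
    ¬ Contained ClassX.{0} ABySup ∧
    -- (v)
    ¬ Contained ClassC.{0} StronglyMonomial ∧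
    -- the witness for (v)
    (Nat.card SmallGroup1000 = 1000 ∧
      ∃ _ : Finite SmallGroup1000, ClassC SmallGroup1000 ∧ ¬ StronglyMonomial SmallGroup1000) :=
  ⟨⟨By.mono (fun _ _ _ h => h) Nilpotent.supersolvable,
      By.mono Abelian.solvableAbelianSylow (fun _ _ _ h => h), ABySup.classC⟩,
    ⟨fun G _ _ h => h.elim (NormallyMonomial.subnormallyMonomial G)
      (AbByNil.subnormallyMonomial G), SubnormallyMonomial.classX, ClassX.classC⟩,
    not_aBySup_le_classX, not_classX_le_aBySup,
    fun h => SmallGroup1000.not_stronglyMonomial (h _ SmallGroup1000.classC),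
    SmallGroup1000.card, inferInstance, SmallGroup1000.classC, SmallGroup1000.not_stronglyMonomial⟩
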